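/- Let $p$ be a prime, let $T\le S_0\le S$ be finite $p$-groups, and let $\mathcal{E}\le\mathcal{F}_0\le\mathcal{F}$ be saturated fusion systems over $T$, $S_0$ and $S$, respectively. For saturated fusion systems $\mathcal{E}\le\mathcal{D}$ over finite $p$-groups $T\le R$, say that $\mathcal{E}$ is \emph{weakly normal} in $\mathcal{D}$ if $T$ is strongly closed in $\mathcal{D}$ and, for all $P\le Q\le T$, all $\varphi\in\mathrm{Hom}_{\mathcal{E}}(P,Q)$ and all $\psi\in\mathrm{Hom}_{\mathcal{D}}(Q,T)$, one has $\psi\varphi(\psi|_P)^{-1}\in\mathrm{Hom}_{\mathcal{E}}(\psi(P),\psi(Q))$. Say that $\mathcal{E}$ is \emph{normal} in $\mathcal{D}$, written $\mathcal{E}\trianglelefteq\mathcal{D}$, if it is weakly normal and each $\alpha\in\mathrm{Aut}_{\mathcal{E}}(T)$ extends to some $\overline{\alpha}\in\mathrm{Aut}_{\mathcal{D}}(TC_R(T))$ such that $[\overline{\alpha},C_R(T)]\le Z(T)$. Say that $\mathcal{E}$ has \emph{$p$-power index} in $\mathcal{D}$ if $T$ contains the hyperfocal subgroup $\langle x^{-1}\alpha(x)\mid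 x\in P\le R,\ \alpha\in O^p(\mathrm{Aut}_{\mathcal{D}}(P))\rangle$ and $\mathrm{Aut}_{\mathcal{E}}(P)\ge O^p(\mathrm{Aut}_{\mathcal{D}}(P))$ for all $P\le T$. Say that $\mathcal{E}$ has \emph{index prime to $p$} in $\mathcal{D}$ if $T=R$ and $\mathrm{Aut}_{\mathcal{E}}(P)\ge O^{p'}(\mathrm{Aut}_{\mathcal{D}}(P))$ for all $P\le R$. Let $O^{p'}(\mathcal{D})$ be the smallest saturated fusion subsystem of index prime to $p$ in $\mathcal{D}$, that is, the intersection of all of them. Then the following hold. (a) If $\mathcal{E}$ is weakly normal in $\mathcal{F}$, then $\mathcal{E}$ is weakly normal in $\mathcal{F}_0$. (b) If $\mathcal{E}\trianglelefteq\mathcal{F}$ and $\mathcal{E}=O^{p'}(\mathcal{E})$, then $\mathcal{E}\trianglelefteq\mathcal{F}_0$. (c) If $\mathcal{E}\trianglelefteq\mathcal{F}$ and $\mathcal{F}_0$ has $p$-power index in $\mathcal{F}$, then $\mathcal{E}\trianglelefteq\mathcal{F}_0$. -/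

import Mathlib

/-- `O^p(Γ)` for a finite group `Γ`: the smallest normal subgroup of `p`-power index, i.e. the
intersection of all normal subgroups of `p`-power index. -/
def pPowerResidual (p : ℕ) (Γ : Type*) [Group Γ] : Subgroup Γ :=
  sInf {N : Subgroup Γ | N.Normal ∧ ∃ k : ℕ, N.index = p ^ k}

/-- `O^{p'}(Γ)` for a finite group `Γ`: the smallest normal subgroup of index prime to `p`, i.e.
the intersection of all normal subgroups of index prime to `p`. -/
def pPrimeResidual (p : ℕ) (Γ : Type*) [Group Γ] : Subgroup Γ :=
  sInf {N : Subgroup Γ | N.Normal ∧ N.index.Coprime p}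

/-- A fusion system over a subgroup `S` of an ambient group `G`. The group `G` only houses `S` and
its subgroups, so that systems over different subgroups can be compared; `S = ⊤` is the case
without ambient group. `Hom P Q` is the set of morphisms from `P` to `Q`, for `P, Q ≤ S`. -/
@[ext]
structure FusionSystem {G : Type*} [Group G] (S : Subgroup G) where
  /-- The set of morphisms from `P` to `Q`. -/
  Hom : (P Q : Subgroup G) → Set (P →* Q)
  /-- The objects are the subgroups of `S`. -/
  le_of_mem : ∀ {P Q : Subgroup G} {φ : P →* Q}, φ ∈ Hom P Q → P ≤ S ∧ Q ≤ S
  /-- Morphisms are injective. -/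
  injective_of_mem : ∀ {P Q : Subgroup G} {φ : P →* Q}, φ ∈ Hom P Q → Function.Injective φ
  /-- Homomorphisms induced by conjugation in `S` (in particular identities and inclusions) are
  morphisms. -/
  conj_mem : ∀ {P Q : Subgroup G}, P ≤ S → Q ≤ S → ∀ φ : P →* Q,
    (∃ g ∈ S, ∀ x : P, (φ x : G) = g * x * g⁻¹) → φ ∈ Hom P Q
  /-- Morphisms are closed under composition. -/
  comp_mem : ∀ {P Q R : Subgroup G} {φ : P →* Q} {ψ : Q →* R},
    φ ∈ Hom P Q → ψ ∈ Hom Q R → ψ.comp φ ∈ Hom P R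
  /-- Each morphism is an isomorphism of the system followed by an inclusion. -/
  factor : ∀ {P Q : Subgroup G} {φ : P →* Q}, φ ∈ Hom P Q →
    ∃ (R : Subgroup G) (hR : R ≤ Q) (e : P ≃* R),
      e.toMonoidHom ∈ Hom P R ∧ e.symm.toMonoidHom ∈ Hom R P ∧
        φ = (Subgroup.inclusion hR).comp e.toMonoidHom

namespace FusionSystem

variable {G : Type*} [Group G]

/-- `Extends ψ φ`: the source of `ψ` contains that of `φ`, and `ψ` restricts to `φ`. -/
def Extends {P Q P' Q' : Subgroup G} (ψ : P' →* Q') (φ : P →* Q) : Prop :=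
  ∃ h : P ≤ P', ∀ x : P, (ψ (Subgroup.inclusion h x) : G) = φ x

/-- The subgroup `ψ(P)`, for a homomorphism `ψ` defined on `Q ≥ P`. -/
def image {Q R : Subgroup G} (ψ : Q →* R) (P : Subgroup G) : Subgroup G :=
  ((P.subgroupOf Q).map ψ).map R.subtype

/-- The restriction `ψ|_P`, as a homomorphism onto `ψ(P)`. -/
def restrictImage {P Q R : Subgroup G} (ψ : Q →* R) (h : P ≤ Q) : P →* image ψ P :=
  (R.subtype.comp (ψ.comp (Subgroup.inclusion h))).codRestrict (image ψ P) fun x =>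
    ⟨ψ (Subgroup.inclusion h x),
      ⟨Subgroup.inclusion h x, Subgroup.mem_subgroupOf.2 x.2, rfl⟩, rfl⟩

/-- `Aut_S(P)`: the automorphisms of `P` induced by conjugation by elements of `N_S(P)`. -/
def autS (S P : Subgroup G) : Subgroup (MulAut P) :=
  (S.subgroupOf (Subgroup.normalizer (P : Set G))).map P.normalizerMonoidHom

/-- `N_φ = {g ∈ N_S(Q) | φ c_g φ⁻¹ ∈ Aut_S(P)}`, for an isomorphism `φ` from `Q` to `P`. -/
def extensionDomain (S : Subgroup G) {Q P : Subgroup G} (φ : Q ≃* P) : Subgroup G :=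
  S ⊓ ((autS S P).comap
    ((MulAut.congr φ).toMonoidHom.comp Q.normalizerMonoidHom)).map
      (Subgroup.normalizer (Q : Set G)).subtype

section

variable {S : Subgroup G} (F : FusionSystem S)

theorem symm_mem {P Q : Subgroup G} {e : P ≃* Q} (he : e.toMonoidHom ∈ F.Hom P Q) :
    e.symm.toMonoidHom ∈ F.Hom Q P := by
  obtain ⟨R, hR, e', -, h2, h3⟩ := F.factor he
  have hx : ∀ x : P, (e x : G) = e' x := fun x =>
    congrArg (fun f : P →* Q => ((f x : Q) : G)) h3
  have hRQ : R = Q := by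
    refine le_antisymm hR fun y hy => ?_
    have := hx (e.symm ⟨y, hy⟩)
    rw [e.apply_symm_apply] at this
    have h4 : y = _ := this
    rw [h4]
    exact (e' _).2
  subst hRQ
  have : e = e' := MulEquiv.ext fun x => Subtype.ext (hx x)
  rwa [this]

/-- `Aut_F(P)`, for `P ≤ S`. -/
def aut {P : Subgroup G} (hP : P ≤ S) : Subgroup (MulAut P) where
  carrier := {α | α.toMonoidHom ∈ F.Hom P P}
  mul_mem' := fun {_ _} ha hb => F.comp_mem hb ha
  one_mem' := F.conj_mem hP hP _ ⟨1, S.one_mem, fun x => by simp⟩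
  inv_mem' := fun {_} ha => F.symm_mem ha

/-- `P` and `Q` are isomorphic in `F` (`F`-conjugate). -/
def IsConjugate (P Q : Subgroup G) : Prop :=
  ∃ e : P ≃* Q, e.toMonoidHom ∈ F.Hom P Q

/-- `P` is fully automized: `Aut_S(P)` is a Sylow `p`-subgroup of `Aut_F(P)`. -/
def IsFullyAutomized (p : ℕ) {P : Subgroup G} (hP : P ≤ S) : Prop :=
  ∃ A : Sylow p (F.aut hP), (A : Subgroup (F.aut hP)).map (F.aut hP).subtype = autS S P

/-- `P` is receptive: each isomorphism `φ : Q → P` in `F` extends to a morphism in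
`Hom_F(N_φ, S)`. -/
def IsReceptive (P : Subgroup G) : Prop :=
  ∀ (Q : Subgroup G) (φ : Q ≃* P), φ.toMonoidHom ∈ F.Hom Q P →
    ∃ ψ ∈ F.Hom (extensionDomain S φ) S, Extends ψ φ.toMonoidHom

/-- Saturation (for `S` a finite `p`-group): each subgroup of `S` is `F`-conjugate to one that is
fully automized and receptive. -/
def IsSaturated (p : ℕ) : Prop :=
  ∀ P : Subgroup G, P ≤ S → ∃ (Q : Subgroup G) (hQ : Q ≤ S),
    F.IsConjugate P Q ∧ F.IsFullyAutomized p hQ ∧ F.IsReceptive Q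

/-- `O^p(Aut_F(P))`, as a subgroup of `Aut(P)`. -/
def pPowerAut (p : ℕ) {P : Subgroup G} (hP : P ≤ S) : Subgroup (MulAut P) :=
  (pPowerResidual p (F.aut hP)).map (F.aut hP).subtype

/-- `O^{p'}(Aut_F(P))`, as a subgroup of `Aut(P)`. -/
def pPrimeAut (p : ℕ) {P : Subgroup G} (hP : P ≤ S) : Subgroup (MulAut P) :=
  (pPrimeResidual p (F.aut hP)).map (F.aut hP).subtype

/-- The hyperfocal subgroup `hyp(F) = ⟨x⁻¹ α(x) | x ∈ P ≤ S, α ∈ O^p(Aut_F(P))⟩`. -/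
def hyperfocal (p : ℕ) : Subgroup G :=
  Subgroup.closure {y | ∃ (P : Subgroup G) (hP : P ≤ S), ∃ α ∈ F.pPowerAut p hP,
    ∃ x : P, y = (x : G)⁻¹ * (α x : P)}

/-- A subgroup `T ≤ S` is strongly closed in `F`: no element of `T` is sent outside of `T` by a
morphism of `F`. -/
def IsStronglyClosed (T : Subgroup G) : Prop :=
  T ≤ S ∧ ∀ ⦃P Q : Subgroup G⦄, ∀ φ ∈ F.Hom P Q, ∀ x : P, (x : G) ∈ T → (φ x : G) ∈ T

end

section

variable {T S : Subgroup G} (E : FusionSystem T) (F : FusionSystem S)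

/-- `E ≤ F`: `E` is a fusion subsystem of `F`. -/
def IsSubsystem : Prop :=
  T ≤ S ∧ ∀ P Q : Subgroup G, E.Hom P Q ⊆ F.Hom P Q

/-- The strong invariance condition: for `P ≤ Q ≤ T`, `φ ∈ Hom_E(P, Q)` and `ψ ∈ Hom_F(Q, T)`, the
homomorphism `θ = ψ φ (ψ|_P)⁻¹` from `ψ(P)` to `ψ(Q)` is in `E`. As `ψ|_P : P → ψ(P)` is
bijective, `θ` is the unique homomorphism with `θ ∘ ψ|_P = ψ ∘ φ`. -/
def StrongInvariance : Prop :=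
  ∀ ⦃P Q : Subgroup G⦄ (hPQ : P ≤ Q), Q ≤ T → ∀ φ ∈ E.Hom P Q, ∀ ψ ∈ F.Hom Q T,
    ∃ θ ∈ E.Hom (image ψ P) (image ψ Q),
      θ.comp (restrictImage ψ hPQ) = (restrictImage ψ le_rfl).comp φ

/-- The extension condition: each `α ∈ Aut_E(T)` extends to some `β ∈ Aut_F(T C_S(T))` such that
`[β, C_S(T)] ≤ Z(T)`. -/
def ExtensionCondition : Prop :=
  ∀ α : MulAut T, α.toMonoidHom ∈ E.Hom T T →
    ∃ β : MulAut ↥(T ⊔ (S ⊓ Subgroup.centralizer (T : Set G))),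
      β.toMonoidHom ∈ F.Hom _ _ ∧ Extends β.toMonoidHom α.toMonoidHom ∧
        ∀ x : ↥(T ⊔ (S ⊓ Subgroup.centralizer (T : Set G))),
          (x : G) ∈ S ⊓ Subgroup.centralizer (T : Set G) →
            (x : G)⁻¹ * (β x : G) ∈ (Subgroup.center T).map T.subtype

/-- `E` is weakly normal in `F` (for saturated `E` and `F`). -/
def IsWeaklyNormal : Prop :=
  E.IsSubsystem F ∧ F.IsStronglyClosed T ∧ E.StrongInvariance F

/-- `E` is normal in `F` (for saturated `E` and `F`). -/
def IsNormal : Prop :=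
  E.IsWeaklyNormal F ∧ E.ExtensionCondition F

/-- `E` has `p`-power index in `F` (for saturated `E` and `F`): `T` contains the hyperfocal
subgroup of `F`, and `Aut_E(P) ≥ O^p(Aut_F(P))` for each `P ≤ T`. -/
def HasPPowerIndex (p : ℕ) : Prop :=
  E.IsSubsystem F ∧ F.hyperfocal p ≤ T ∧
    ∀ (P : Subgroup G) (hT : P ≤ T) (hS : P ≤ S), F.pPowerAut p hS ≤ E.aut hT

end

section

variable {S : Subgroup G}

/-- `F₀` has index prime to `p` in `F` (for saturated `F₀` and `F`): both are systems over the same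
`S`, and `Aut_{F₀}(P) ≥ O^{p'}(Aut_F(P))` for each `P ≤ S`. -/
def HasIndexPrimeTo (p : ℕ) (F₀ F : FusionSystem S) : Prop :=
  F₀.IsSubsystem F ∧ ∀ (P : Subgroup G) (hP : P ≤ S), F.pPrimeAut p hP ≤ F₀.aut hP

/-- `O^{p'}(F)`, the smallest saturated subsystem of index prime to `p` in a saturated `F`, given as
the intersection of all saturated subsystems of index prime to `p`. -/
def pPrimeSubsystem (p : ℕ) (F : FusionSystem S) : FusionSystem S where
  Hom P Q := {φ | φ ∈ F.Hom P Q ∧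
    ∀ F₀ : FusionSystem S, F₀.IsSaturated p → HasIndexPrimeTo p F₀ F → φ ∈ F₀.Hom P Q}
  le_of_mem h := F.le_of_mem h.1
  injective_of_mem h := F.injective_of_mem h.1
  conj_mem hP hQ φ h := ⟨F.conj_mem hP hQ φ h, fun F₀ _ _ => F₀.conj_mem hP hQ φ h⟩
  comp_mem h h' := ⟨F.comp_mem h.1 h'.1, fun F₀ hs hi =>
    F₀.comp_mem (h.2 F₀ hs hi) (h'.2 F₀ hs hi)⟩
  factor := by
    rintro P Q φ ⟨h, h'⟩
    obtain ⟨R, hR, e, he, hes, hφ⟩ := F.factor h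
    have key : ∀ F₀ : FusionSystem S, F₀.IsSaturated p → HasIndexPrimeTo p F₀ F →
        e.toMonoidHom ∈ F₀.Hom P R := by
      intro F₀ hs hi
      obtain ⟨R', hR', e', he', -, hφ'⟩ := F₀.factor (h' F₀ hs hi)
      have hx : ∀ x : P, (e x : G) = e' x := fun x => by
        have h1 : (φ x : G) = e x := by rw [hφ]; rfl
        have h2 : (φ x : G) = e' x := by rw [hφ']; rfl
        rw [← h1, h2]
      have hRR : R = R' := by
        apply le_antisymm
        · intro y hy
          have h1 := hx (e.symm ⟨y, hy⟩)
          rw [e.apply_symm_apply] at h1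
          have h2 : y = _ := h1
          rw [h2]
          exact (e' _).2
        · intro y hy
          have h1 := hx (e'.symm ⟨y, hy⟩)
          rw [e'.apply_symm_apply] at h1
          have h2 : _ = y := h1
          rw [← h2]
          exact (e _).2
      subst hRR
      have : e = e' := MulEquiv.ext fun x => Subtype.ext (hx x)
      rwa [this]
    exact ⟨R, hR, e, ⟨he, key⟩, ⟨hes, fun F₀ hs hi => F₀.symm_mem (key F₀ hs hi)⟩, hφ⟩

end

end FusionSystem

/-! Part (a) is restriction: strong closure of `T` and strong invariance quantify over morphisms of
the larger system, so they pass to `F₀`. What remains in (b) and (c) is the extension condition for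
`E` in `F₀`.

For (c), let `β` be an extension of `α ∈ Aut_E(T)` in `F`. It is the identity modulo `T` on
`C_S(T)`, so it restricts to an automorphism `δ` of `X = T C_{S₀}(T)`. A power `δⁿ` equal to the
`p'`-part of `δ` lies in `O^p(Aut_F(X))`, hence in `F₀`. The remaining factor `α^{1-n}` has
`p`-power order in `Aut_E(T)`, so it is conjugation by some `t ∈ T`. The map `c_t δⁿ` is the
required extension.

For (b), it suffices that `E` is weakly normal in a saturated system and equal to `O^{p'}(E)`;
below, that system is called `F`, over `S`. An isomorphism `P → Q` is called good if it extends to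
`P C_S(T) → Q C_S(T)` with the identity induced modulo `T`. Let `E₁ ≤ E` be generated by the
restrictions of good `E`-isomorphisms between `E`-centric subgroups. The core of the proof is that
`E₁` is saturated and has index prime to `p` in `E`. Then `E = O^{p'}(E) ≤ E₁`, so every element of
`Aut_E(T)` is good, which is the extension condition.

Three facts on good isomorphisms carry this: automorphisms of `p`-power order in `E` of centric
subgroups are good (`good_of_pow_eq_one`); goodness is stable under conjugation by `Aut_F(T)`
(`good_aut`); and an isomorphism on `N ≤ N_T(P)` that is good on the centric subgroup `P`, and good
on `N` up to an element of `Aut_E(T)`, is good on `N` (`good_lift`). `PPrimePair` abstracts them.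
From it, a Frattini argument gives index prime to `p` (`hasIndexPrimeTo`). Saturation
(`isSaturated`) follows by descending induction on the order of a subgroup `Q`. For centric `Q`
receptivity comes from `lift`; for other `Q`, morphisms of `E₁` are first extended to `P C_T(P)`,
which is centric (`extendsCent_of_iso`, `isReceptive_of_isDFN`). -/

section GroupTheory

/-! ### Sylow subgroups and conjugacy inside subgroups of a group. -/

variable {M : Type*} [Group M] {p : ℕ}

/-- `U` is a maximal `p`-subgroup of the subgroup `A`. -/
def IsSylowIn (p : ℕ) (A U : Subgroup M) : Prop :=
  U ≤ A ∧ IsPGroup p U ∧ ∀ H ≤ A, IsPGroup p H → U ≤ H → H ≤ U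

theorem IsPGroup.subgroupOf_of_isPGroup {A H : Subgroup M} (hH : IsPGroup p H) :
    IsPGroup p (H.subgroupOf A) :=
  hH.comap_of_injective _ A.subtype_injective

theorem exists_isSylowIn {A H : Subgroup M} (hHA : H ≤ A) (hH : IsPGroup p H) :
    ∃ U, IsSylowIn p A U ∧ H ≤ U := by
  obtain ⟨P, hP⟩ := (hH.subgroupOf_of_isPGroup (A := A)).exists_le_sylow
  refine ⟨(P : Subgroup A).map A.subtype, ⟨Subgroup.map_subtype_le _, P.isPGroup'.map _,
    fun K hKA hK hPK => ?_⟩, fun x hx => ?_⟩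
  · have h1 : (P : Subgroup A) ≤ K.subgroupOf A := Subgroup.map_le_iff_le_comap.1 hPK
    have h2 := P.is_maximal' (hK.subgroupOf_of_isPGroup (A := A)) h1
    intro x hx
    exact ⟨⟨x, hKA hx⟩, h2 ▸ (Subgroup.mem_subgroupOf.2 hx), rfl⟩
  · exact ⟨⟨x, hHA hx⟩, hP (Subgroup.mem_subgroupOf.2 hx), rfl⟩

theorem IsSylowIn.exists_conj [Fact p.Prime] {A U H : Subgroup M} [Finite A]
    (hU : IsSylowIn p A U) (hHA : H ≤ A) (hH : IsPGroup p H) :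
    ∃ a ∈ A, ∀ h ∈ H, a * h * a⁻¹ ∈ U := by
  let P : Sylow p A := ⟨U.subgroupOf A, hU.2.1.subgroupOf_of_isPGroup, fun {Q} hQ hle => by
    refine le_antisymm (fun x hx => ?_) hle
    refine Subgroup.mem_subgroupOf.2 (hU.2.2 (Q.map A.subtype) (Subgroup.map_subtype_le _)
      (hQ.map _) (fun y hy => ?_) ⟨x, hx, rfl⟩)
    exact ⟨⟨y, hU.1 hy⟩, hle (Subgroup.mem_subgroupOf.2 hy), rfl⟩⟩
  obtain ⟨Q, hQ⟩ := (hH.subgroupOf_of_isPGroup (A := A)).exists_le_sylow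
  obtain ⟨g, hg⟩ := MulAction.exists_smul_eq A Q P
  refine ⟨g, g.2, fun h hh => ?_⟩
  have h1 : (⟨h, hHA hh⟩ : A) ∈ Q := hQ (Subgroup.mem_subgroupOf.2 hh)
  have h2 : g * ⟨h, hHA hh⟩ * g⁻¹ ∈ P := by
    rw [← hg]
    exact Subgroup.smul_mem_pointwise_smul _ (MulAut.conj g) _ h1
  exact h2

theorem IsSylowIn.of_le {A B U : Subgroup M} (hU : IsSylowIn p A U) (hUB : U ≤ B) (hBA : B ≤ A) :
    IsSylowIn p B U :=
  ⟨hUB, hU.2.1, fun H hH hp h => hU.2.2 H (hH.trans hBA) hp h⟩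

/-- Conjugation of a subgroup, as a subgroup. -/
def conjSubgroup (a : M) (H : Subgroup M) : Subgroup M := H.map (MulAut.conj a).toMonoidHom

theorem mem_conjSubgroup {a x : M} {H : Subgroup M} :
    x ∈ conjSubgroup a H ↔ ∃ h ∈ H, a * h * a⁻¹ = x := by
  simp [conjSubgroup, Subgroup.mem_map]

theorem IsPGroup.conjSubgroup {H : Subgroup M} (hH : IsPGroup p H) (a : M) :
    IsPGroup p (conjSubgroup a H) := hH.map _

theorem mem_sup_of_conj_mem {P N : Subgroup M} (h : ∀ n ∈ N, ∀ x ∈ P, n * x * n⁻¹ ∈ P) {z : M} :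
    z ∈ P ⊔ N ↔ ∃ x ∈ P, ∃ n ∈ N, x * n = z := by
  constructor
  · intro hz
    let K : Subgroup M :=
      { carrier := {z | ∃ x ∈ P, ∃ n ∈ N, x * n = z}
        one_mem' := ⟨1, P.one_mem, 1, N.one_mem, by simp⟩
        mul_mem' := by
          rintro _ _ ⟨x, hx, n, hn, rfl⟩ ⟨y, hy, m, hm, rfl⟩
          exact ⟨x * (n * y * n⁻¹), P.mul_mem hx (h n hn y hy), n * m, N.mul_mem hn hm, by group⟩
        inv_mem' := by
          rintro _ ⟨x, hx, n, hn, rfl⟩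
          refine ⟨n⁻¹ * x⁻¹ * n, ?_, n⁻¹, N.inv_mem hn, by group⟩
          simpa using h n⁻¹ (N.inv_mem hn) x⁻¹ (P.inv_mem hx) }
    have hle : P ⊔ N ≤ K := sup_le (fun x hx => ⟨x, hx, 1, N.one_mem, by simp⟩)
      (fun n hn => ⟨1, P.one_mem, n, hn, by simp⟩)
    exact hle hz
  · rintro ⟨x, hx, n, hn, rfl⟩
    exact Subgroup.mul_mem_sup hx hn

/-- Here `U` is a Sylow subgroup of `ZU`: if a `p`-group `K` between `U` and `ZU` contains `zu`,
then `z` lies in the `p`-subgroup `K ∩ Z` of `Z`, hence in `U`. The factor from `U` in the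
conjugating element can then be dropped. -/
theorem exists_conj_of_le_sup [Fact p.Prime] [Finite M] {Z U H : Subgroup M} (hU : IsPGroup p U)
    (hZ : ∀ u ∈ U, ∀ z ∈ Z, u * z * u⁻¹ ∈ Z) (hZU : ∀ K ≤ Z, IsPGroup p K → K ≤ U)
    (hH : IsPGroup p H) (hHZ : H ≤ Z ⊔ U) : ∃ z ∈ Z, ∀ h ∈ H, z * h * z⁻¹ ∈ U := by
  have hS : IsSylowIn p (Z ⊔ U) U := by
    refine ⟨le_sup_right, hU, fun K hK hp hle x hx => ?_⟩
    obtain ⟨z, hz, u, hu, rfl⟩ := (mem_sup_of_conj_mem hZ).1 (hK hx)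
    have hzK : z ∈ K ⊓ Z := ⟨by simpa using K.mul_mem hx (K.inv_mem (hle hu)), hz⟩
    exact U.mul_mem (hZU _ inf_le_right (hp.to_le inf_le_left) hzK) hu
  obtain ⟨a, ha, hconj⟩ := hS.exists_conj hHZ hH
  obtain ⟨z, hz, u, hu, hzu⟩ := (mem_sup_of_conj_mem hZ).1 (Subgroup.inv_mem _ ha)
  refine ⟨z⁻¹, Z.inv_mem hz, fun h hh => ?_⟩
  have h1 := hconj h hh
  have ha' : a = u⁻¹ * z⁻¹ := by rw [← mul_inv_rev, hzu, inv_inv]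
  have h2 := U.mul_mem (U.mul_mem hu h1) (U.inv_mem hu)
  rw [ha'] at h2
  simpa [mul_assoc] using h2

/-- A Sylow subgroup `Y ≥ N ∩ U` of `N` is `J`-conjugate into `N ∩ U`, so by orders `N ∩ U` is
itself Sylow in `N`, and conjugation inside `N` suffices. -/
theorem exists_conj_of_normal [Fact p.Prime] [Finite M] {J N U : Subgroup M} (hNJ : N ≤ J)
    (hN : ∀ j ∈ J, ∀ n ∈ N, j * n * j⁻¹ ∈ N)
    (hU : ∀ H ≤ J, IsPGroup p H → ∃ j ∈ J, ∀ h ∈ H, j * h * j⁻¹ ∈ U) (hUp : IsPGroup p U)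
    {H : Subgroup M} (hHN : H ≤ N) (hH : IsPGroup p H) : ∃ u ∈ N, ∀ h ∈ H, u * h * u⁻¹ ∈ U := by
  obtain ⟨Y, hY, hYU⟩ := exists_isSylowIn (p := p) (A := N) (H := N ⊓ U) inf_le_left
    (hUp.to_le inf_le_right)
  obtain ⟨j, hj, hjY⟩ := hU Y (hY.1.trans hNJ) hY.2.1
  have h1 : conjSubgroup j Y ≤ N ⊓ U := by
    intro x hx
    obtain ⟨y, hy, rfl⟩ := mem_conjSubgroup.1 hx
    exact ⟨hN j hj y (hY.1 hy), hjY y hy⟩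
  have h2 : Nat.card Y ≤ Nat.card (N ⊓ U : Subgroup M) := by
    refine le_trans (le_of_eq ?_) (Subgroup.card_le_of_le h1)
    exact (Subgroup.card_map_of_injective (MulAut.conj j).injective).symm
  have h3 : N ⊓ U = Y := Subgroup.eq_of_le_of_card_ge hYU h2
  obtain ⟨a, ha, hc⟩ := hY.exists_conj hHN hH
  exact ⟨a, ha, fun h hh => (h3.symm ▸ hc h hh : a * h * a⁻¹ ∈ N ⊓ U).2⟩

theorem exists_mem_normalizer_of_lt [Fact p.Prime] {H K : Subgroup M} [Finite K]
    (hK : IsPGroup p K) (hHK : H < K) : ∃ x ∈ K, x ∉ H ∧ ∀ h ∈ H, x * h * x⁻¹ ∈ H := by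
  have hn : Group.IsNilpotent K := hK.isNilpotent
  have h1 : H.subgroupOf K < ⊤ := by
    rw [lt_top_iff_ne_top]
    intro h
    exact not_le_of_gt hHK (Subgroup.subgroupOf_eq_top.1 h)
  obtain ⟨x, hx, hxH⟩ := SetLike.exists_of_lt (Group.normalizerCondition_of_isNilpotent _ h1)
  refine ⟨x, x.2, fun h => hxH (Subgroup.mem_subgroupOf.2 h), fun h hh => ?_⟩
  have := (Subgroup.mem_normalizer_iff.1 hx ⟨h, hHK.le hh⟩).1 (Subgroup.mem_subgroupOf.2 hh)
  exact Subgroup.mem_subgroupOf.1 this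

theorem mem_normalizer_of_conj_mem {H : Subgroup M} [Finite H] {x : M}
    (h : ∀ y ∈ H, x * y * x⁻¹ ∈ H) : x ∈ Subgroup.normalizer (H : Set M) := by
  rw [Subgroup.mem_normalizer_iff_map_conj_eq]
  refine Subgroup.eq_of_le_of_card_ge ?_ ?_
  · rintro _ ⟨y, hy, rfl⟩
    exact h y hy
  · exact (Subgroup.card_map_of_injective (MulAut.conj x).injective).ge

end GroupTheory

/-! ### Isomorphisms of a fusion system as functions on the ambient group. -/

namespace FusionSystem

variable {G : Type*} [Group G] {S : Subgroup G} {F : FusionSystem S} {P Q R P' Q' R' : Subgroup G}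
  {f g : G → G}

/-- The function `f` restricts to an isomorphism from `P` to `Q` in the fusion system. -/
def Iso (F : FusionSystem S) (P Q : Subgroup G) (f : G → G) : Prop :=
  ∃ φ : P ≃* Q, φ.toMonoidHom ∈ F.Hom P Q ∧ ∀ x : P, (φ x : G) = f x

namespace Iso

theorem le_left (h : F.Iso P Q f) : P ≤ S := by
  obtain ⟨φ, hφ, -⟩ := h
  exact (F.le_of_mem hφ).1

theorem le_right (h : F.Iso P Q f) : Q ≤ S := by
  obtain ⟨φ, hφ, -⟩ := h
  exact (F.le_of_mem hφ).2

theorem mem (h : F.Iso P Q f) {x : G} (hx : x ∈ P) : f x ∈ Q := by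
  obtain ⟨φ, hφ, hf⟩ := h
  rw [← hf ⟨x, hx⟩]
  exact (φ _).2

theorem map_mul (h : F.Iso P Q f) {x y : G} (hx : x ∈ P) (hy : y ∈ P) :
    f (x * y) = f x * f y := by
  obtain ⟨φ, hφ, hf⟩ := h
  rw [← hf ⟨x, hx⟩, ← hf ⟨y, hy⟩, ← hf ⟨x * y, P.mul_mem hx hy⟩, ← Subgroup.coe_mul, ← _root_.map_mul]
  rfl

theorem map_one (h : F.Iso P Q f) : f 1 = 1 := by
  obtain ⟨φ, hφ, hf⟩ := h
  rw [← hf ⟨1, P.one_mem⟩]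
  exact congrArg Subtype.val (_root_.map_one φ)

theorem map_inv (h : F.Iso P Q f) {x : G} (hx : x ∈ P) : f x⁻¹ = (f x)⁻¹ := by
  obtain ⟨φ, hφ, hf⟩ := h
  rw [← hf ⟨x, hx⟩, ← hf ⟨x⁻¹, P.inv_mem hx⟩, ← Subgroup.coe_inv, ← _root_.map_inv]
  rfl

theorem map_conj (h : F.Iso P Q f) {x y : G} (hx : x ∈ P) (hy : y ∈ P) :
    f (x * y * x⁻¹) = f x * f y * (f x)⁻¹ := by
  rw [h.map_mul (P.mul_mem hx hy) (P.inv_mem hx), h.map_mul hx hy, h.map_inv hx]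

theorem inj (h : F.Iso P Q f) {x y : G} (hx : x ∈ P) (hy : y ∈ P) (hxy : f x = f y) : x = y := by
  obtain ⟨φ, hφ, hf⟩ := h
  rw [← hf ⟨x, hx⟩, ← hf ⟨y, hy⟩] at hxy
  exact congrArg Subtype.val (φ.injective (Subtype.ext hxy))

theorem surj (h : F.Iso P Q f) {y : G} (hy : y ∈ Q) : ∃ x ∈ P, f x = y := by
  obtain ⟨φ, hφ, hf⟩ := h
  exact ⟨φ.symm ⟨y, hy⟩, (φ.symm _).2, by rw [← hf, φ.apply_symm_apply]⟩

theorem mem_iff (h : F.Iso P Q f) {y : G} : y ∈ Q ↔ ∃ x ∈ P, f x = y :=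
  ⟨h.surj, fun ⟨_, hx, hxy⟩ => hxy ▸ h.mem hx⟩

theorem target_unique (h : F.Iso P Q f) (h' : F.Iso P Q' f) : Q = Q' := by
  ext y
  rw [h.mem_iff, h'.mem_iff]

theorem congr (h : F.Iso P Q f) (hfg : ∀ x ∈ P, f x = g x) : F.Iso P Q g := by
  obtain ⟨φ, hφ, hf⟩ := h
  exact ⟨φ, hφ, fun x => (hf x).trans (hfg x x.2)⟩

theorem comp (h : F.Iso P Q f) (h' : F.Iso Q R g) : F.Iso P R (g ∘ f) := by
  obtain ⟨φ, hφ, hf⟩ := h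
  obtain ⟨ψ, hψ, hg⟩ := h'
  exact ⟨φ.trans ψ, F.comp_mem hφ hψ, fun x => by simp [hg, hf]⟩

theorem symm_of (h : F.Iso P Q f) (hg : ∀ x ∈ P, g (f x) = x) : F.Iso Q P g := by
  obtain ⟨φ, hφ, hf⟩ := h
  refine ⟨φ.symm, F.symm_mem hφ, fun y => ?_⟩
  obtain ⟨x, rfl⟩ := φ.surjective y
  rw [φ.symm_apply_apply, hf, hg _ x.2]

theorem symm (h : F.Iso P Q f) :
    ∃ g, F.Iso Q P g ∧ (∀ x ∈ P, g (f x) = x) ∧ ∀ y ∈ Q, f (g y) = y := by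
  have hg : ∀ x ∈ P, Function.invFunOn f P (f x) = x := fun x hx =>
    h.inj (Function.invFunOn_mem ⟨x, hx, rfl⟩) hx (Function.invFunOn_eq ⟨x, hx, rfl⟩)
  refine ⟨_, h.symm_of hg, hg, fun y hy => ?_⟩
  obtain ⟨x, hx, rfl⟩ := h.surj hy
  rw [hg x hx]

theorem of_hom {φ : P →* Q} (h : φ ∈ F.Hom P Q) (hf : ∀ x : P, (φ x : G) = f x) :
    ∃ R ≤ Q, F.Iso P R f := by
  obtain ⟨R, hR, e, he, -, rfl⟩ := F.factor h
  exact ⟨R, hR, e, he, fun x => hf x⟩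

theorem hom_mem (h : F.Iso P R f) (hRQ : R ≤ Q) (hQ : Q ≤ S) {φ : P →* Q}
    (hf : ∀ x : P, (φ x : G) = f x) : φ ∈ F.Hom P Q := by
  obtain ⟨e, he, hfe⟩ := h
  have h1 : Subgroup.inclusion hRQ ∈ F.Hom R Q :=
    F.conj_mem (hRQ.trans hQ) hQ _ ⟨1, S.one_mem, fun x => by simp⟩
  convert F.comp_mem he h1
  ext x
  rw [hf, ← hfe]
  rfl

theorem id (hP : P ≤ S) : F.Iso P P id :=
  ⟨MulEquiv.refl P, F.conj_mem hP hP _ ⟨1, S.one_mem, fun x => by simp⟩, fun _ => rfl⟩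

theorem restrict (h : F.Iso P Q f) (hP : P' ≤ P) : ∃ Q' ≤ Q, F.Iso P' Q' f := by
  obtain ⟨φ, hφ, hf⟩ := h
  have h1 : Subgroup.inclusion hP ∈ F.Hom P' P :=
    F.conj_mem (hP.trans (F.le_of_mem hφ).1) (F.le_of_mem hφ).1 _ ⟨1, S.one_mem, fun x => by simp⟩
  exact of_hom (F.comp_mem h1 hφ) fun x => hf _

theorem restrict_to (h : F.Iso P Q f) (hP : P' ≤ P) (hQ : ∀ y, y ∈ Q' ↔ ∃ x ∈ P', f x = y) :
    F.Iso P' Q' f := by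
  obtain ⟨R, -, hR⟩ := h.restrict hP
  have : R = Q' := by
    ext y
    rw [hR.mem_iff, hQ]
  exact this ▸ hR

theorem le_of_le (h : F.Iso P Q f) (h' : F.Iso P' Q' f) (hP : P' ≤ P) : Q' ≤ Q := fun y hy => by
  obtain ⟨x, hx, rfl⟩ := h'.surj hy
  exact h.mem (hP hx)

theorem comp_restrict (h : F.Iso P Q f) (h' : F.Iso Q' R g) (hQ : Q ≤ Q') :
    ∃ R' ≤ R, F.Iso P R' (g ∘ f) := by
  obtain ⟨R', hR', h''⟩ := h'.restrict hQ
  exact ⟨R', hR', h.comp h''⟩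

theorem conj (hP : P ≤ S) {s : G} (hs : s ∈ S) (hQ : ∀ y, y ∈ Q ↔ ∃ x ∈ P, s * x * s⁻¹ = y) :
    F.Iso P Q fun x => s * x * s⁻¹ := by
  have hQ' : Q = P.map (MulAut.conj s).toMonoidHom := by
    ext y
    rw [hQ]
    simp [Subgroup.mem_map]
  subst hQ'
  refine ⟨P.equivMapOfInjective _ (MulAut.conj s).injective, F.conj_mem hP ?_ _
    ⟨s, hs, fun x => rfl⟩, fun x => rfl⟩
  rintro _ ⟨x, hx, rfl⟩
  exact S.mul_mem (S.mul_mem hs (hP hx)) (S.inv_mem hs)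

theorem conj_self (hP : P ≤ S) {s : G} (hs : s ∈ S)
    (hn : s ∈ Subgroup.normalizer (P : Set G)) : F.Iso P P fun x => s * x * s⁻¹ := by
  refine conj hP hs fun y => ⟨fun hy => ⟨s⁻¹ * y * s, ?_, by group⟩, ?_⟩
  · rw [Subgroup.mem_normalizer_iff] at hn
    rw [hn]
    simpa [mul_assoc] using hy
  · rintro ⟨x, hx, rfl⟩
    exact (Subgroup.mem_normalizer_iff.1 hn x).1 hx

theorem card_eq (h : F.Iso P Q f) : Nat.card P = Nat.card Q := by
  obtain ⟨φ, -, -⟩ := h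
  exact Nat.card_congr φ.toEquiv

theorem mono {T : Subgroup G} {E : FusionSystem T} (hE : E.IsSubsystem F) (h : E.Iso P Q f) :
    F.Iso P Q f := by
  obtain ⟨φ, hφ, hf⟩ := h
  exact ⟨φ, hE.2 _ _ hφ, hf⟩

theorem exists_mulAut (h : F.Iso P P f) (hP : P ≤ S) : ∃ α ∈ F.aut hP, ∀ x : P, (α x : G) = f x := by
  obtain ⟨φ, hφ, hf⟩ := h
  exact ⟨φ, hφ, hf⟩

theorem eq_of_le [Finite S] (h : F.Iso P Q f) (hQ : Q ≤ Q') (hQ' : Q' ≤ S)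
    (hc : Nat.card Q' ≤ Nat.card P) : Q = Q' := by
  have : Finite Q' := Finite.of_injective _ (Subgroup.inclusion_injective hQ')
  exact Subgroup.eq_of_le_of_card_ge hQ (h.card_eq ▸ hc)

end Iso

open Classical in
/-- The extension of an automorphism of `P` by the identity. -/
noncomputable def extFun (α : MulAut P) (x : G) : G := if h : x ∈ P then α ⟨x, h⟩ else x

theorem extFun_coe (α : MulAut P) (x : P) : extFun α x = α x := by
  simp [extFun]

theorem extFun_of_mem (α : MulAut P) {x : G} (hx : x ∈ P) : extFun α x = α ⟨x, hx⟩ := by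
  simp [extFun, hx]

theorem mem_aut_iff {hP : P ≤ S} {α : MulAut P} : α ∈ F.aut hP ↔ F.Iso P P (extFun α) := by
  constructor
  · intro h
    exact ⟨α, h, fun x => (extFun_coe α x).symm⟩
  · intro h
    exact h.hom_mem le_rfl hP fun x => (extFun_coe α x).symm

theorem iso_of_mem_aut {hP : P ≤ S} {α : MulAut P} (hα : α ∈ F.aut hP) : F.Iso P P (extFun α) :=
  mem_aut_iff.1 hα

theorem mem_aut_of_iso {hP : P ≤ S} {α : MulAut P} (h : F.Iso P P f) (hf : ∀ x : P, (α x : G) = f x) :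
    α ∈ F.aut hP :=
  h.hom_mem le_rfl hP hf

/-- `N_S(P)`. -/
def nz (S P : Subgroup G) : Subgroup G := S ⊓ Subgroup.normalizer (P : Set G)

theorem nz_le : nz S P ≤ S := inf_le_left

theorem le_nz (hP : P ≤ S) : P ≤ nz S P := le_inf hP Subgroup.le_normalizer

theorem conj_mem_of_mem_nz {x y : G} (hx : x ∈ nz S P) (hy : y ∈ P) : x * y * x⁻¹ ∈ P :=
  (Subgroup.mem_normalizer_iff.1 hx.2 y).1 hy

theorem mem_nz [Finite S] (hP : P ≤ S) {x : G} (hx : x ∈ S) (h : ∀ y ∈ P, x * y * x⁻¹ ∈ P) :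
    x ∈ nz S P :=
  have : Finite P := Finite.of_injective _ (Subgroup.inclusion_injective hP)
  ⟨hx, mem_normalizer_of_conj_mem h⟩

theorem mem_autS {α : MulAut P} : α ∈ autS S P ↔ ∃ s ∈ nz S P, ∀ x : P, (α x : G) = s * x * s⁻¹ := by
  constructor
  · rintro ⟨n, hn, rfl⟩
    exact ⟨n, ⟨Subgroup.mem_subgroupOf.1 hn, n.2⟩, fun x => rfl⟩
  · rintro ⟨s, hs, h⟩
    refine ⟨⟨s, hs.2⟩, Subgroup.mem_subgroupOf.2 hs.1, ?_⟩
    ext x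
    rw [h]
    rfl

theorem autS_le_aut (F : FusionSystem S) (hP : P ≤ S) : autS S P ≤ F.aut hP := by
  intro α hα
  obtain ⟨s, hs, h⟩ := mem_autS.1 hα
  exact mem_aut_of_iso (Iso.conj_self hP hs.1 hs.2) h

theorem isPGroup_autS {p : ℕ} (hS : IsPGroup p S) (P : Subgroup G) : IsPGroup p (autS S P) :=
  (hS.subgroupOf_of_isPGroup).map _

theorem isFullyAutomized_iff {p : ℕ} {hP : P ≤ S} :
    F.IsFullyAutomized p hP ↔ IsSylowIn p (F.aut hP) (autS S P) := by
  constructor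
  · rintro ⟨A, hA⟩
    refine ⟨autS_le_aut F hP, hA ▸ A.isPGroup'.map _, fun H hH hp hle => ?_⟩
    have h1 : (A : Subgroup (F.aut hP)) ≤ H.subgroupOf (F.aut hP) :=
      Subgroup.map_le_iff_le_comap.1 (hA.le.trans hle)
    have h2 := A.is_maximal' hp.subgroupOf_of_isPGroup h1
    intro x hx
    rw [← hA]
    exact ⟨⟨x, hH hx⟩, h2 ▸ (Subgroup.mem_subgroupOf.2 hx), rfl⟩
  · intro h
    refine ⟨⟨(autS S P).subgroupOf (F.aut hP), h.2.1.subgroupOf_of_isPGroup, fun {Q} hQ hle => ?_⟩, ?_⟩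
    · refine le_antisymm (fun x hx => ?_) hle
      refine Subgroup.mem_subgroupOf.2 (h.2.2 (Q.map (F.aut hP).subtype)
        (Subgroup.map_subtype_le _) (hQ.map _) (fun y hy => ?_) ⟨x, hx, rfl⟩)
      exact ⟨⟨y, h.1 hy⟩, hle (Subgroup.mem_subgroupOf.2 hy), rfl⟩
    · exact Subgroup.map_subgroupOf_eq_of_le h.1

theorem mem_extensionDomain {φ : P ≃* Q} {n : G} :
    n ∈ extensionDomain S φ ↔ n ∈ nz S P ∧
      ∃ s ∈ nz S Q, ∀ x : P, ∀ y : P, (y : G) = n * x * n⁻¹ → (φ y : G) = s * φ x * s⁻¹ := by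
  constructor
  · rintro ⟨hn, m, hm, rfl⟩
    obtain ⟨s, hs, h⟩ := mem_autS.1 (Subgroup.mem_comap.1 hm)
    refine ⟨⟨hn, m.2⟩, s, hs, fun x y hxy => ?_⟩
    rw [← h (φ x)]
    have : y = P.normalizerMonoidHom m x := Subtype.ext hxy
    rw [this]
    simp [MulAut.congr]
  · rintro ⟨hn, s, hs, h⟩
    refine ⟨hn.1, ⟨n, hn.2⟩, Subgroup.mem_comap.2 (mem_autS.2 ⟨s, hs, fun x => ?_⟩), rfl⟩
    obtain ⟨x, rfl⟩ := φ.surjective x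
    rw [← h x (P.normalizerMonoidHom ⟨n, hn.2⟩ x) rfl]
    simp [MulAut.congr]

end FusionSystem

/-! ### Fully automized and receptive subgroups. -/

namespace FusionSystem

variable {G : Type*} [Group G] {S : Subgroup G} {F : FusionSystem S} {P Q R P' Q' R' N N' : Subgroup G}
  {f g : G → G} {p : ℕ}

theorem Iso.of_mulEquiv {e : P ≃* Q} (he : e.toMonoidHom ∈ F.Hom P Q) :
    ∃ f, F.Iso P Q f ∧ ∀ x : P, (e x : G) = f x := by
  classical
  refine ⟨fun x => if h : x ∈ P then e ⟨x, h⟩ else x, ⟨e, he, fun x => by simp⟩, fun x => by simp⟩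

theorem Iso.le_nz [Finite S] (h : F.Iso N N' f) (hN : N ≤ nz S P) (hP : P ≤ N) (h' : F.Iso P Q f) :
    N' ≤ nz S Q := by
  intro y hy
  obtain ⟨x, hx, rfl⟩ := h.surj hy
  refine mem_nz h'.le_right (h.le_right hy) fun z hz => ?_
  obtain ⟨w, hw, rfl⟩ := h'.surj hz
  rw [← h.map_conj hx (hP hw)]
  exact h'.mem (conj_mem_of_mem_nz (hN hx) hw)

theorem congr_mem_aut {φ : P ≃* Q} (hφ : φ.toMonoidHom ∈ F.Hom P Q) (hP : P ≤ S) (hQ : Q ≤ S)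
    {α : MulAut P} (hα : α ∈ F.aut hP) : MulAut.congr φ α ∈ F.aut hQ :=
  F.comp_mem (F.comp_mem (F.symm_mem hφ) hα) hφ

theorem congr_apply (φ : P ≃* Q) (α : MulAut P) (x : P) : MulAut.congr φ α (φ x) = φ (α x) := by
  simp [MulAut.congr]

/-- The group `N` is `N_f`. The last clause is the membership test by which later proofs show that a
given subgroup lies in the domain of the extension. -/
theorem IsReceptive.extend [Finite S] (hQ : F.IsReceptive Q) (h : F.Iso P Q f) :
    ∃ N N' f', F.Iso N N' f' ∧ (∀ x ∈ P, f' x = f x) ∧ P ≤ N ∧ N ≤ nz S P ∧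
      ∀ n ∈ S, (∀ x ∈ P, n * x * n⁻¹ ∈ P) →
        (∃ s ∈ S, ∀ x ∈ P, f (n * x * n⁻¹) = s * f x * s⁻¹) → n ∈ N := by
  classical
  have hP := h.le_left
  have hQS := h.le_right
  obtain ⟨φ, hφ, hf⟩ := h
  obtain ⟨ψ, hψ, hext⟩ := hQ P φ hφ
  obtain ⟨hle, hext⟩ := hext
  obtain ⟨R, -, hR⟩ := Iso.of_hom (f := fun x => if h : x ∈ extensionDomain S φ then ψ ⟨x, h⟩ else x)
    hψ (fun x => by simp)
  refine ⟨_, R, _, hR, fun x hx => ?_, hle, fun n hn => (mem_extensionDomain.1 hn).1, ?_⟩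
  · have h1 : x ∈ extensionDomain S φ := hle hx
    have h2 := hext ⟨x, hx⟩
    simp only [h1, dif_pos]
    rw [← hf ⟨x, hx⟩]
    exact h2
  · rintro n hn hnP ⟨s, hs, hsx⟩
    refine mem_extensionDomain.2 ⟨mem_nz hP hn hnP, s, mem_nz hQS hs fun y hy => ?_,
      fun x y hxy => by rw [hf, hf, hxy, hsx x x.2]⟩
    obtain ⟨x, hx⟩ := φ.surjective ⟨y, hy⟩
    have hxy : f x = y := by rw [← hf, hx]
    rw [← hxy, ← hsx x x.2]
    have := hf ⟨_, hnP x x.2⟩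
    rw [← this]
    exact (φ _).2

theorem isReceptive_of (h : ∀ P f N, F.Iso P Q f → P ≤ N → N ≤ nz S P →
    (∀ n ∈ N, ∃ s ∈ nz S Q, ∀ x ∈ P, f (n * x * n⁻¹) = s * f x * s⁻¹) →
      ∃ N' f', F.Iso N N' f' ∧ ∀ x ∈ P, f' x = f x) : F.IsReceptive Q := by
  intro P φ hφ
  obtain ⟨f, hf, hφf⟩ := Iso.of_mulEquiv hφ
  have hle : P ≤ extensionDomain S φ := fun x hx =>
    mem_extensionDomain.2 ⟨le_nz hf.le_left hx, φ ⟨x, hx⟩, le_nz hf.le_right (φ _).2,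
      fun a b hab => by
        have : b = ⟨x, hx⟩ * a * ⟨x, hx⟩⁻¹ := Subtype.ext hab
        rw [this]; simp⟩
  obtain ⟨N', f', hf', hext⟩ := h P f (extensionDomain S φ) hf hle
    (fun n hn => (mem_extensionDomain.1 hn).1) (fun n hn => by
      obtain ⟨hn, s, hs, h1⟩ := mem_extensionDomain.1 hn
      refine ⟨s, hs, fun x hx => ?_⟩
      have := h1 ⟨x, hx⟩ ⟨_, conj_mem_of_mem_nz hn hx⟩ rfl
      rwa [hφf, hφf] at this)
  obtain ⟨e, he, hef⟩ := hf'
  have h1 : N' ≤ S := (F.le_of_mem he).2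
  refine ⟨(Subgroup.inclusion h1).comp e.toMonoidHom, F.comp_mem he
    (F.conj_mem h1 le_rfl _ ⟨1, S.one_mem, fun x => by simp⟩), hle, fun x => ?_⟩
  have h2 : (e (Subgroup.inclusion hle x) : G) = f' x := hef _
  have h3 : (φ x : G) = f x := hφf x
  rw [← hext x x.2, ← h2] at h3
  exact h3.symm

/-- `Q` is fully automized and receptive. -/
structure IsFN (F : FusionSystem S) (p : ℕ) (Q : Subgroup G) : Prop where
  le : Q ≤ S
  automized : F.IsFullyAutomized p le
  receptive : F.IsReceptive Q

theorem finite_of_le [Finite S] (h : P ≤ S) : Finite P :=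
  Finite.of_injective _ (Subgroup.inclusion_injective h)

theorem card_lt_of_lt [Finite S] (hQ : Q ≤ S) (h : P < Q) : Nat.card P < Nat.card Q := by
  have := finite_of_le hQ
  refine lt_of_le_of_ne (Subgroup.card_le_of_le h.le) fun hc => h.ne ?_
  exact Subgroup.eq_of_le_of_card_ge h.le hc.ge

theorem finite_mulAut [Finite S] (h : P ≤ S) : Finite (MulAut P) :=
  have := finite_of_le h
  Finite.of_injective (fun e : MulAut P => (e : P → P)) DFunLike.coe_injective

theorem IsFullyAutomized.exists_conj [Finite S] [Fact p.Prime] {hQ : Q ≤ S}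
    (h : F.IsFullyAutomized p hQ) {H : Subgroup (MulAut Q)} (hH : H ≤ F.aut hQ)
    (hp : IsPGroup p H) : ∃ γ ∈ F.aut hQ, ∀ h ∈ H, γ * h * γ⁻¹ ∈ autS S Q :=
  have := finite_mulAut hQ
  (isFullyAutomized_iff.1 h).exists_conj hH hp

theorem IsSaturated.exists_isFN (hF : F.IsSaturated p) (hP : P ≤ S) :
    ∃ Q f, F.IsFN p Q ∧ F.Iso P Q f := by
  obtain ⟨Q, hQ, ⟨e, he⟩, h1, h2⟩ := hF P hP
  obtain ⟨f, hf, -⟩ := Iso.of_mulEquiv he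
  exact ⟨Q, f, ⟨hQ, h1, h2⟩, hf⟩

/-- A `p`-subgroup of `Aut(P)` can be moved by an isomorphism to a fully normalized subgroup into
the group of automorphisms induced by `S`. -/
theorem IsFN.exists_iso_conj [Finite S] [Fact p.Prime] (hQ : F.IsFN p Q) (h : F.Iso P Q f)
    {H : Subgroup (MulAut P)} (hH : H ≤ F.aut h.le_left) (hp : IsPGroup p H) :
    ∃ f', F.Iso P Q f' ∧ (∃ γ ∈ F.aut hQ.le, ∀ x ∈ P, f' x = extFun γ (f x)) ∧
      ∀ α ∈ H, ∃ s ∈ nz S Q, ∀ x : P, f' (α x) = s * f' x * s⁻¹ := by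
  have hP := h.le_left
  obtain ⟨φ, hφ, hf⟩ := id h
  obtain ⟨γ, hγ, hc⟩ := hQ.automized.exists_conj (H := H.map (MulAut.congr φ).toMonoidHom)
    (by rintro _ ⟨α, hα, rfl⟩; exact congr_mem_aut hφ hP hQ.le (hH hα)) (hp.map _)
  refine ⟨extFun γ ∘ f, h.comp (iso_of_mem_aut hγ), ⟨γ, hγ, fun x _ => rfl⟩, fun α hα => ?_⟩
  obtain ⟨s, hs, hsx⟩ := mem_autS.1 (hc _ ⟨α, hα, rfl⟩)
  refine ⟨s, hs, fun x => ?_⟩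
  have h1 := hsx (γ (φ x))
  have h2 : (γ * (MulAut.congr φ).toMonoidHom α * γ⁻¹) (γ (φ x)) = γ (φ (α x)) := by
    simp [MulAut.congr]
  rw [h2] at h1
  simpa [← hf, extFun_coe] using h1

/-- The image of `Aut_S(P)` in `Aut_F(Q)` is a `p`-group, so after a change of `f` by an element of
`Aut_F(Q)` it lies in `Aut_S(Q)`. Then `N_f` is all of `N_S(P)`. -/
theorem IsFN.exists_extend [Finite S] [Fact p.Prime] (hS : IsPGroup p S) (hQ : F.IsFN p Q)
    (h : F.Iso P Q f) : ∃ f' N', F.Iso (nz S P) N' f' ∧ F.Iso P Q f' ∧ N' ≤ nz S Q := by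
  obtain ⟨f₁, h₁, -, hc⟩ := hQ.exists_iso_conj h (autS_le_aut F h.le_left) (isPGroup_autS hS P)
  obtain ⟨N, N', f', hf', hext, hPN, hN, hmem⟩ := hQ.receptive.extend h₁
  have hle : nz S P ≤ N := fun n hn => by
    refine hmem n hn.1 (fun x hx => conj_mem_of_mem_nz hn hx) ?_
    have hα : P.normalizerMonoidHom ⟨n, hn.2⟩ ∈ autS S P := mem_autS.2 ⟨n, hn, fun x => rfl⟩
    obtain ⟨s, hs, hsx⟩ := hc _ hα
    exact ⟨s, hs.1, fun x hx => hsx ⟨x, hx⟩⟩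
  obtain ⟨M, hM, h2⟩ := hf'.restrict hle
  have h3 := h₁.congr fun x hx => (hext x hx).symm
  exact ⟨f', M, h2, h3, h2.le_nz le_rfl (FusionSystem.le_nz h.le_left) h3⟩

theorem IsFN.card_nz_le [Finite S] [Fact p.Prime] (hS : IsPGroup p S) (hQ : F.IsFN p Q)
    (h : F.Iso P Q f) : Nat.card (nz S P) ≤ Nat.card (nz S Q) := by
  obtain ⟨f', N', h1, -, h3⟩ := hQ.exists_extend hS h
  have := finite_of_le (nz_le (S := S) (P := Q))
  rw [h1.card_eq]
  exact Subgroup.card_le_of_le h3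

theorem IsFN.of_iso [Finite S] (hQ : F.IsFN p Q) (h : F.Iso P Q f)
    (hnz : F.Iso (nz S P) (nz S Q) f) : F.IsFN p P := by
  have hP := h.le_left
  refine ⟨hP, ?_, ?_⟩
  · rw [isFullyAutomized_iff]
    have hsy := isFullyAutomized_iff.1 hQ.automized
    obtain ⟨φ, hφ, hf⟩ := id h
    have hmap : ∀ α : MulAut P, MulAut.congr φ α ∈ autS S Q → α ∈ autS S P := by
      intro α hα
      obtain ⟨s, hs, hsx⟩ := mem_autS.1 hα
      obtain ⟨t, ht, rfl⟩ := hnz.surj hs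
      refine mem_autS.2 ⟨t, ht, fun x => ?_⟩
      have h1 := hsx (φ x)
      rw [congr_apply, hf, hf, ← hnz.map_conj ht (le_nz hP x.2)] at h1
      exact h.inj (α x).2 (conj_mem_of_mem_nz ht x.2) h1
    have hle : autS S Q ≤ (autS S P).map (MulAut.congr φ).toMonoidHom := by
      intro α hα
      refine ⟨(MulAut.congr φ).symm α, hmap _ ?_, ?_⟩
      · rwa [MulEquiv.apply_symm_apply]
      · exact (MulAut.congr φ).apply_symm_apply α
    refine ⟨autS_le_aut F hP, ?_, fun H hH hp hle' α hα => hmap α ?_⟩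
    · have hle2 : (autS S P).map (MulAut.congr φ).toMonoidHom ≤ autS S Q := by
        rintro _ ⟨α, hα, rfl⟩
        obtain ⟨s, hs, hsx⟩ := mem_autS.1 hα
        refine mem_autS.2 ⟨f s, hnz.mem hs, fun y => ?_⟩
        obtain ⟨x, rfl⟩ := φ.surjective y
        have : ((MulAut.congr φ).toMonoidHom α) (φ x) = φ (α x) := congr_apply φ α x
        rw [this, hf, hf, hsx, ← hnz.map_conj hs (le_nz hP x.2)]
      have h1 := hsy.2.1.to_le hle2
      exact h1.of_injective ((MulAut.congr φ).toMonoidHom.subgroupMap (autS S P))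
        (by
          intro a b hab
          have := congrArg Subtype.val hab
          exact Subtype.ext ((MulAut.congr φ).injective this))
    · refine hsy.2.2 (H.map (MulAut.congr φ).toMonoidHom) ?_ (hp.map _) ?_ ⟨α, hα, rfl⟩
      · rintro _ ⟨β, hβ, rfl⟩
        exact congr_mem_aut hφ hP hQ.le (hH hβ)
      · exact hle.trans (Subgroup.map_mono hle')
  · refine isReceptive_of fun R g N hg hRN hN hc => ?_
    obtain ⟨M, M', ψ, hψ, hext, hRM, hM, hmem⟩ := hQ.receptive.extend (hg.comp h)
    have hNM : N ≤ M := fun n hn => by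
      refine hmem n (hN hn).1 (fun x hx => conj_mem_of_mem_nz (hN hn) hx) ?_
      obtain ⟨s, hs, hsx⟩ := hc n hn
      refine ⟨f s, nz_le (hnz.mem hs), fun x hx => ?_⟩
      have hx' := le_nz hP (hg.mem hx)
      simp only [Function.comp_apply]
      rw [hsx x hx, hnz.map_conj hs hx']
    obtain ⟨N', -, hψN⟩ := hψ.restrict hNM
    have h1 : F.Iso R Q ψ := (hg.comp h).congr fun x hx => (hext x hx).symm
    obtain ⟨k, hk, hkf, hfk⟩ := hnz.symm
    obtain ⟨N'', -, h2⟩ := hψN.comp_restrict hk (hψN.le_nz hN hRN h1)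
    refine ⟨N'', _, h2, fun x hx => ?_⟩
    simp only [Function.comp_apply]
    rw [hext x hx, Function.comp_apply, hkf _ (le_nz hP (hg.mem hx))]

/-- With `card_nz_le`, this identifies the fully automized and receptive subgroups of a class that
contains one: they are those with normalizer in `S` of largest order. -/
theorem IsFN.of_card [Finite S] [Fact p.Prime] (hS : IsPGroup p S) (hQ : F.IsFN p Q)
    (h : F.Iso P Q f) (hc : Nat.card (nz S Q) ≤ Nat.card (nz S P)) : F.IsFN p P := by
  obtain ⟨f', N', h1, h2, h3⟩ := hQ.exists_extend hS h
  exact hQ.of_iso h2 (h1.eq_of_le h3 nz_le hc ▸ h1)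

end FusionSystem

/-! ### Strongly closed subgroups and the Frattini decomposition. -/

namespace FusionSystem

variable {G : Type*} [Group G] {S T : Subgroup G} {F : FusionSystem S}
  {P Q R P' Q' R' N N' : Subgroup G} {f g a b : G → G} {p : ℕ}

theorem IsStronglyClosed.le_of_iso (hT : F.IsStronglyClosed T) (h : F.Iso P Q f) (hP : P ≤ T) :
    Q ≤ T := by
  obtain ⟨φ, hφ, hf⟩ := h
  intro y hy
  obtain ⟨x, hx⟩ := φ.surjective ⟨y, hy⟩
  have := hT.2 _ hφ x (hP x.2)
  have h2 : (φ x : G) = y := congrArg Subtype.val hx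
  rw [← h2]
  exact this

theorem IsStronglyClosed.mem_of_iso (hT : F.IsStronglyClosed T) (h : F.Iso P Q f) {x : G}
    (hx : x ∈ P) (hxT : x ∈ T) : f x ∈ T := by
  obtain ⟨φ, hφ, hf⟩ := h
  rw [← hf ⟨x, hx⟩]
  exact hT.2 _ hφ ⟨x, hx⟩ hxT

theorem IsStronglyClosed.mem_of_iso' (hT : F.IsStronglyClosed T) (h : F.Iso P Q f) {x : G}
    (hx : x ∈ P) (hxT : f x ∈ T) : x ∈ T := by
  obtain ⟨g, hg, hgf, -⟩ := h.symm
  have := hT.mem_of_iso hg (h.mem hx) hxT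
  rwa [hgf x hx] at this

theorem isStronglyClosed_self (F : FusionSystem S) : F.IsStronglyClosed S :=
  ⟨le_rfl, fun _ _ φ hφ x _ => (F.le_of_mem hφ).2 (φ x).2⟩

theorem lt_nz [Fact p.Prime] [Finite T] (hT : IsPGroup p T) (hP : P < T) : P < nz T P := by
  obtain ⟨x, hx, hxP, hn⟩ := exists_mem_normalizer_of_lt hT hP
  refine lt_of_le_of_ne (le_nz hP.le) fun h => hxP ?_
  rw [h]
  exact mem_nz hP.le hx hn

theorem nz_mono (hT : T ≤ S) : nz T P ≤ nz S P := inf_le_inf_right _ hT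

/-- A class of isomorphisms between subgroups of `T`, closed under the operations of a fusion
system and under conjugation by automorphisms of `T`. -/
structure IsoClass (F : FusionSystem S) (T : Subgroup G)
    (D : Subgroup G → Subgroup G → (G → G) → Prop) : Prop where
  iso : ∀ {P Q f}, D P Q f → F.Iso P Q f
  id : ∀ {P}, P ≤ T → D P P id
  comp : ∀ {P Q R f g}, D P Q f → D Q R g → D P R (g ∘ f)
  symm_of : ∀ {P Q f g}, D P Q f → (∀ x ∈ P, g (f x) = x) → D Q P g
  restrict : ∀ {P Q P' Q' f}, D P Q f → P' ≤ P → F.Iso P' Q' f → D P' Q' f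
  conj : ∀ {P Q P' Q' f a b}, F.Iso T T a → (∀ x ∈ T, b (a x) = x) → D P Q f →
    F.Iso P P' a → F.Iso Q Q' a → D P' Q' (a ∘ f ∘ b)

/-- `f` is a morphism of the class `D` followed by an automorphism of `T`. -/
def Decomp (F : FusionSystem S) (T : Subgroup G) (D : Subgroup G → Subgroup G → (G → G) → Prop)
    (P Q : Subgroup G) (f : G → G) : Prop :=
  ∃ a R e, F.Iso T T a ∧ D P R e ∧ F.Iso R Q a ∧ ∀ x ∈ P, f x = a (e x)

variable {D : Subgroup G → Subgroup G → (G → G) → Prop}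

namespace Decomp

theorem of_class (hD : IsoClass F T D) (hT : T ≤ S) (h : D P Q f) :
    Decomp F T D P Q f :=
  ⟨id, Q, f, Iso.id hT, h, Iso.id (hD.iso h).le_right, fun _ _ => rfl⟩

theorem of_aut (hD : IsoClass F T D) (hP : P ≤ T) (h : F.Iso T T a) (h' : F.Iso P Q a) :
    Decomp F T D P Q a :=
  ⟨a, P, id, h, hD.id hP, h', fun _ _ => rfl⟩

theorem congr (h : Decomp F T D P Q f) (hfg : ∀ x ∈ P, f x = g x) : Decomp F T D P Q g := by
  obtain ⟨a, R, e, h1, h2, h3, h4⟩ := h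
  exact ⟨a, R, e, h1, h2, h3, fun x hx => (hfg x hx).symm.trans (h4 x hx)⟩

/-- With `b = a⁻¹`, the composite `a' e' a e` equals `(a' a)(b e' a) e`, and `b e' a` stays in `D`
by stability under conjugation. -/
theorem comp (hD : IsoClass F T D) (hT : F.IsStronglyClosed T) (hP : P ≤ T)
    (h : Decomp F T D P Q f) (h' : Decomp F T D Q Q' g) : Decomp F T D P Q' (g ∘ f) := by
  obtain ⟨a, R, e, h1, h2, h3, h4⟩ := h
  obtain ⟨a', R', e', h1', h2', h3', h4'⟩ := h'
  have hR : R ≤ T := hT.le_of_iso (hD.iso h2) hP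
  have hQ : Q ≤ T := hT.le_of_iso h3 hR
  have hR' : R' ≤ T := hT.le_of_iso (hD.iso h2') hQ
  obtain ⟨b, hb, hba, hab⟩ := h1.symm
  have hQR : F.Iso Q R b := h3.symm_of fun x hx => hba x (hR hx)
  obtain ⟨R'', -, hR''⟩ := hb.restrict hR'
  have h5 := hD.conj hb hab h2' hQR hR''
  have h6 : F.Iso R'' R' a := hR''.symm_of fun x hx => hab x (hR' hx)
  refine ⟨a' ∘ a, R'', _, h1.comp h1', hD.comp h2 h5, h6.comp h3', fun x hx => ?_⟩
  have hex : e x ∈ R := (hD.iso h2).mem hx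
  have h7 : a (e x) ∈ Q := h3.mem hex
  simp only [Function.comp_apply]
  rw [h4 x hx, h4' _ h7, hab _ (hR' ((hD.iso h2').mem h7))]

theorem symm_of (hD : IsoClass F T D) (hT : F.IsStronglyClosed T) (hP : P ≤ T)
    (h : Decomp F T D P Q f) (hg : ∀ x ∈ P, g (f x) = x) : Decomp F T D Q P g := by
  obtain ⟨a, R, e, h1, h2, h3, h4⟩ := h
  have hR : R ≤ T := hT.le_of_iso (hD.iso h2) hP
  obtain ⟨b, hb, hba, hab⟩ := h1.symm
  obtain ⟨e', he', hee, hee'⟩ := (hD.iso h2).symm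
  have h2' := hD.symm_of h2 hee
  obtain ⟨P', hP', hPP⟩ := h1.restrict hP
  have h5 := hD.conj h1 hba h2' h3 hPP
  refine ⟨b, P', _, hb, h5, hPP.symm_of fun x hx => hba x (hP hx), fun y hy => ?_⟩
  obtain ⟨x, hx, rfl⟩ := h3.surj hy
  obtain ⟨z, hz, rfl⟩ := (hD.iso h2).surj hx
  simp only [Function.comp_apply]
  rw [hba _ (hR hx), hee z hz, hba z (hP hz), ← h4 z hz, hg z hz]

theorem restrict (hD : IsoClass F T D) (h : Decomp F T D P Q f)
    (hP : P' ≤ P) (h' : F.Iso P' Q' f) : Decomp F T D P' Q' f := by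
  obtain ⟨a, R, e, h1, h2, h3, h4⟩ := h
  obtain ⟨R', hR', h5⟩ := (hD.iso h2).restrict hP
  obtain ⟨Q'', -, h6⟩ := h3.restrict hR'
  have h7 := (h5.comp h6).congr fun x hx => (h4 x (hP hx)).symm
  have := h7.target_unique h'
  subst this
  exact ⟨a, R', e, h1, hD.restrict h2 hP h5, h6, fun x hx => h4 x (hP hx)⟩

end Decomp

/-- A Frattini argument: if each automorphism of a fully normalized proper subgroup of `T` is the
product of one in `D` and one that extends, then each isomorphism is a morphism of `D` followed by
an automorphism of `T`. -/
theorem IsoClass.decomp [Finite S] [Fact p.Prime] (hS : IsPGroup p S) (hF : F.IsSaturated p)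
    (hT : F.IsStronglyClosed T) (hD : IsoClass F T D)
    (H : ∀ P j, F.IsFN p P → P < T → F.Iso P P j → ∃ e n M M', D P P e ∧ P < M ∧ M ≤ T ∧
      F.Iso M M' n ∧ F.Iso P P n ∧ ∀ x ∈ P, j x = e (n x))
    (hP : P ≤ T) (h : F.Iso P Q f) : Decomp F T D P Q f := by
  induction hn : Nat.card T - Nat.card P using Nat.strong_induction_on generalizing P Q f with
  | _ n ih =>
    subst hn
    have hTS := hT.1
    have hTf : Finite T := finite_of_le hTS
    by_cases hPT : P = T
    · subst hPT
      have hQ : Q ≤ P := hT.le_of_iso h le_rfl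
      have : Q = P := h.eq_of_le hQ hTS le_rfl
      subst this
      exact Decomp.of_aut hD le_rfl h h
    -- A map that extends to a larger subgroup of `T` is covered by the induction hypothesis for the
    -- extension.
    have step : ∀ {P₁ Q₁ M M' : Subgroup G} {k : G → G}, Nat.card P₁ = Nat.card P → P₁ < M →
        M ≤ T → F.Iso M M' k → F.Iso P₁ Q₁ k → Decomp F T D P₁ Q₁ k := by
      intro P₁ Q₁ M M' k hc hlt hM hk hk'
      have h1 := card_lt_of_lt (hM.trans hTS) hlt
      have h2 := Subgroup.card_le_of_le hM
      exact (ih _ (by omega) hM hk rfl).restrict hD hlt.le hk'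
    have step2 : ∀ {P₁ Q₁ : Subgroup G} {k : G → G}, P₁ ≤ T → Nat.card P₁ = Nat.card P →
        F.IsFN p Q₁ → F.Iso P₁ Q₁ k → ∃ k', F.Iso P₁ Q₁ k' ∧ Decomp F T D P₁ Q₁ k' := by
      intro P₁ Q₁ k hP₁ hc hQ₁ hk
      obtain ⟨k', N', h1, h2, h3⟩ := hQ₁.exists_extend hS hk
      have hne : P₁ ≠ T := by
        rintro rfl
        exact hPT (Subgroup.eq_of_le_of_card_ge hP hc.le)
      obtain ⟨M, -, hM⟩ := h1.restrict (nz_mono hTS (P := P₁))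
      exact ⟨k', h2, step hc (lt_nz (hS.to_le hTS) (lt_of_le_of_ne hP₁ hne)) nz_le hM h2⟩
    obtain ⟨P₀, k, hP₀, hk⟩ := hF.exists_isFN h.le_left
    obtain ⟨r, hr, hrD⟩ := step2 hP rfl hP₀ hk
    obtain ⟨f', hf', hff, hff'⟩ := h.symm
    have hQT := hT.le_of_iso h hP
    have hPT₀ := hT.le_of_iso hr hP
    obtain ⟨s, hs, hsD⟩ := step2 hQT h.card_eq.symm hP₀ (hf'.comp hk)
    obtain ⟨r', hr', hrr, hrr'⟩ := hr.symm
    obtain ⟨s', hs', hss, hss'⟩ := hs.symm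
    -- Since `f = s⁻¹ (s f r⁻¹) r` with `r` and `s` already decomposed, only the automorphism `s f
    -- r⁻¹` of `P₀` is left.
    have hj : F.Iso P₀ P₀ (s ∘ f ∘ r') := (hr'.comp h).comp hs
    have hlt : P₀ < T := by
      refine lt_of_le_of_ne hPT₀ fun hh => hPT ?_
      exact Subgroup.eq_of_le_of_card_ge hP (by rw [hr.card_eq, hh])
    obtain ⟨e, n, M, M', he, hPM, hM, hnM, hn, hen⟩ := H _ _ hP₀ hlt hj
    have hjD : Decomp F T D P₀ P₀ (s ∘ f ∘ r') :=
      ((step hr.card_eq.symm hPM hM hnM hn).comp hD hT hPT₀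
        (Decomp.of_class hD hTS he)).congr fun x hx => (hen x hx).symm
    refine ((hrD.comp hD hT hP hjD).comp hD hT hP (hsD.symm_of hD hT hQT hss)).congr fun x hx => ?_
    simp only [Function.comp_apply]
    rw [hrr x hx, hss _ (h.mem hx)]

end FusionSystem

/-! ### Centric subgroups and weakly normal subsystems. -/

namespace FusionSystem

variable {G : Type*} [Group G] {S T : Subgroup G} {F : FusionSystem S} {E : FusionSystem T}
  {P Q R P' Q' R' N N' : Subgroup G} {f h k : G → G} {p : ℕ}

/-- `P ≤ T` contains its centralizer in `T`, as does each subgroup isomorphic to it in `E`. -/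
def IsCentric (E : FusionSystem T) (P : Subgroup G) : Prop :=
  P ≤ T ∧ ∀ Q f, E.Iso P Q f → T ⊓ Subgroup.centralizer (Q : Set G) ≤ Q

namespace IsCentric

theorem mem (hP : E.IsCentric P) {x : G} (hx : x ∈ T) (h : ∀ y ∈ P, x * y * x⁻¹ = y) : x ∈ P :=
  hP.2 P id (Iso.id hP.1) ⟨hx, fun y hy => by
    have := h y hy
    rw [mul_inv_eq_iff_eq_mul] at this
    exact this.symm⟩

theorem of_iso (hP : E.IsCentric P) (h : E.Iso P Q f) : E.IsCentric Q :=
  ⟨h.le_right, fun R g hg => hP.2 R _ (h.comp hg)⟩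

theorem mono (hP : E.IsCentric P) (hPN : P ≤ N) (hN : N ≤ T) : E.IsCentric N := by
  refine ⟨hN, fun Q f hf => ?_⟩
  obtain ⟨R, hR, h⟩ := hf.restrict hPN
  exact (inf_le_inf_left _ (Subgroup.centralizer_le hR)).trans ((hP.2 _ _ h).trans hR)

end IsCentric

theorem isCentric_self [Finite T] (E : FusionSystem T) : E.IsCentric T :=
  ⟨le_rfl, fun _ _ hf => hf.eq_of_le hf.le_right le_rfl le_rfl ▸ inf_le_left⟩

theorem image_eq {ψ : R →* R'} (hψ : ∀ x : R, (ψ x : G) = h x) (hP : P ≤ R) {y : G} :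
    y ∈ image ψ P ↔ ∃ x ∈ P, h x = y := by
  constructor
  · rintro ⟨_, ⟨x, hx, rfl⟩, rfl⟩
    exact ⟨x, Subgroup.mem_subgroupOf.1 hx, (hψ x).symm⟩
  · rintro ⟨x, hx, rfl⟩
    exact ⟨ψ ⟨x, hP hx⟩, ⟨⟨x, hP hx⟩, Subgroup.mem_subgroupOf.2 hx, rfl⟩, hψ _⟩

namespace IsWeaklyNormal

theorem conj_iso (hW : E.IsWeaklyNormal F) (hf : E.Iso P Q f) (hP : P ≤ R) (hQ : Q ≤ R)
    (hR : R ≤ T) (hh : F.Iso R R' h) (hPP : F.Iso P P' h) (hQQ : F.Iso Q Q' h)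
    (hk : ∀ x ∈ R, k (h x) = x) : E.Iso P' Q' (h ∘ f ∘ k) := by
  obtain ⟨e, he, hef⟩ := id hf
  obtain ⟨d, hd, hdh⟩ := id hh
  have hR' : R' ≤ T := hW.2.1.le_of_iso hh hR
  have hφ : (Subgroup.inclusion hQ).comp e.toMonoidHom ∈ E.Hom P R :=
    hf.hom_mem hQ hR fun x => hef x
  have hψ : (Subgroup.inclusion hR').comp d.toMonoidHom ∈ F.Hom R T :=
    hh.hom_mem hR' hW.1.1 fun x => hdh x
  obtain ⟨θ, hθ, hc⟩ := hW.2.2 hP hR _ hφ _ hψ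
  have him : image ((Subgroup.inclusion hR').comp d.toMonoidHom) P = P' := by
    ext y
    rw [image_eq (h := h) (fun x => hdh x) hP, hPP.mem_iff]
  obtain ⟨X, -, hX⟩ := Iso.of_hom (f := h ∘ f ∘ k) hθ (by
    rintro ⟨y, hy⟩
    obtain ⟨x, hx, rfl⟩ := (image_eq (h := h) (fun x => hdh x) hP).1 hy
    have h1 := congrArg (fun ξ => ((ξ ⟨x, hx⟩ : image _ R) : G)) hc
    have h2 : (θ ⟨h x, hy⟩ : G) = h (f x) := by
      have h3 : restrictImage ((Subgroup.inclusion hR').comp d.toMonoidHom) hP ⟨x, hx⟩ =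
          ⟨h x, hy⟩ := Subtype.ext (hdh ⟨x, hP hx⟩)
      have h4 : (restrictImage ((Subgroup.inclusion hR').comp d.toMonoidHom) le_rfl
          (Subgroup.inclusion hQ (e ⟨x, hx⟩)) : G) = h (f x) := by
        refine (hdh (Subgroup.inclusion hQ (e ⟨x, hx⟩))).trans ?_
        exact congrArg h (hef ⟨x, hx⟩)
      rw [← h3]
      exact h1.trans h4
    simp only [Function.comp_apply]
    rw [h2, hk x (hP hx)])
  rw [him] at hX
  have hXQ : X = Q' := by
    ext y
    rw [hX.mem_iff, hQQ.mem_iff]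
    constructor
    · rintro ⟨z, hz, rfl⟩
      obtain ⟨x, hx, rfl⟩ := hPP.surj hz
      exact ⟨f x, hf.mem hx, by simp [hk x (hP hx)]⟩
    · rintro ⟨z, hz, rfl⟩
      obtain ⟨x, hx, rfl⟩ := hf.surj hz
      exact ⟨h x, hPP.mem hx, by simp [hk x (hP hx)]⟩
  exact hXQ ▸ hX

theorem isoClass (hW : E.IsWeaklyNormal F) : IsoClass F T E.Iso where
  iso h := h.mono hW.1
  id hP := Iso.id hP
  comp h h' := h.comp h'
  symm_of h h' := h.symm_of h'
  restrict := fun {P Q P' Q' f} h hP h' => by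
    obtain ⟨X, -, hX⟩ := h.restrict hP
    exact (hX.mono hW.1).target_unique h' ▸ hX
  conj ha hb hf hP hQ := hW.conj_iso hf hf.le_left hf.le_right le_rfl ha hP hQ hb

/-- An `E`-isomorphism `Q → P` can be replaced by one in `F` defined on `N_S(Q)`, which carries
`N_T(Q)` into `N_T(P)` by strong closure. So `N_T(P)` has the largest order in the `E`-class. -/
theorem isFN [Finite S] [Fact p.Prime] (hW : E.IsWeaklyNormal F) (hS : IsPGroup p S)
    (hE : E.IsSaturated p) (hP : F.IsFN p P) (hPT : P ≤ T) : E.IsFN p P := by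
  have hTS := hW.1.1
  have : Finite T := finite_of_le hTS
  obtain ⟨Q, f, hQ, hf⟩ := hE.exists_isFN hPT
  obtain ⟨g, hg, -, -⟩ := hf.symm
  refine hQ.of_card (hS.to_le hTS) hf ?_
  obtain ⟨g', N', h1, h2, h3⟩ := hP.exists_extend hS (hg.mono hW.1)
  obtain ⟨M, hM, h4⟩ := h1.restrict (nz_mono hTS)
  have : Finite (nz T P) := finite_of_le nz_le
  rw [h4.card_eq]
  exact Subgroup.card_le_of_le (le_inf (hW.2.1.le_of_iso h4 nz_le) ((hM.trans h3).trans inf_le_right))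

/-- `Aut_E(P)` is normal in `Aut_F(P)` and has Sylow subgroup `Aut_T(P)` when `P` is fully
normalized. By the Frattini argument each `α ∈ Aut_F(P)` becomes, after a factor `γ ∈ Aut_E(P)`, a
map that normalizes `Aut_T(P)`, and such a map extends to `N_T(P)`. -/
theorem decomp [Finite S] [Fact p.Prime] (hW : E.IsWeaklyNormal F) (hS : IsPGroup p S)
    (hE : E.IsSaturated p) (hF : F.IsSaturated p) (hP : P ≤ T) (h : F.Iso P Q f) :
    Decomp F T E.Iso P Q f := by
  refine hW.isoClass.decomp hS hF hW.2.1 (fun P j hP hPT hj => ?_) hP h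
  have hTS := hW.1.1
  have : Finite T := finite_of_le hTS
  have hPE := hW.isFN hS hE hP hPT.le
  obtain ⟨α, hα, hαj⟩ := hj.exists_mulAut hP.le
  have hconj : ∀ β ∈ E.aut hPT.le, α * β * α⁻¹ ∈ E.aut hPT.le := by
    intro β hβ
    obtain ⟨i, hi, hij, -⟩ := hj.symm
    refine mem_aut_of_iso (hW.conj_iso (iso_of_mem_aut hβ) le_rfl le_rfl hPT.le hj hj hj hij)
      fun x => ?_
    obtain ⟨y, rfl⟩ := α.surjective x
    simp [hαj, hij, extFun_coe, MulAut.mul_apply]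
  obtain ⟨γ, hγ, hc⟩ := hPE.automized.exists_conj (H := conjSubgroup α (autS T P))
    (fun x hx => by
      obtain ⟨y, hy, rfl⟩ := mem_conjSubgroup.1 hx
      exact hconj y (autS_le_aut E _ hy))
    ((isPGroup_autS (hS.to_le hTS) P).conjSubgroup α)
  have hγF : F.Iso P P (extFun γ) := (iso_of_mem_aut hγ).mono hW.1
  obtain ⟨N, N', n, hn, hext, hPN, hN, hmem⟩ := hP.receptive.extend (hj.comp hγF)
  have hle : nz T P ≤ N := fun t ht => by
    refine hmem t (hTS ht.1) (fun x hx => conj_mem_of_mem_nz ht hx) ?_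
    have h1 : P.normalizerMonoidHom ⟨t, ht.2⟩ ∈ autS T P := mem_autS.2 ⟨t, ht, fun x => rfl⟩
    obtain ⟨s, hs, hsx⟩ := mem_autS.1 (hc _ (mem_conjSubgroup.2 ⟨_, h1, rfl⟩))
    refine ⟨s, hTS hs.1, fun x hx => ?_⟩
    have h2 := hsx (γ (α ⟨x, hx⟩))
    have h3 : P.normalizerMonoidHom ⟨t, ht.2⟩ ⟨x, hx⟩ = ⟨_, conj_mem_of_mem_nz ht hx⟩ := rfl
    simp only [MulAut.mul_apply, MulAut.inv_apply_self, h3] at h2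
    simpa [← hαj ⟨x, hx⟩, ← hαj ⟨_, conj_mem_of_mem_nz ht hx⟩, extFun_coe] using h2
  obtain ⟨M', -, hM'⟩ := hn.restrict hle
  have hPn : F.Iso P P n := (hj.comp hγF).congr fun x hx => (hext x hx).symm
  refine ⟨extFun γ⁻¹, n, nz T P, M', iso_of_mem_aut ((E.aut hPT.le).inv_mem hγ),
    lt_nz (hS.to_le hTS) hPT, nz_le, hM', hPn, fun x hx => ?_⟩
  rw [hext x hx, Function.comp_apply, extFun_of_mem γ (hj.mem hx), extFun_coe]
  simp

/-- By `decomp`, an `F`-isomorphism from `P` is an `E`-isomorphism followed by an automorphism of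
`T`, and both preserve the inclusion of the centralizer in `T`. -/
theorem isCentric_of_iso [Finite S] [Fact p.Prime] (hW : E.IsWeaklyNormal F) (hS : IsPGroup p S)
    (hE : E.IsSaturated p) (hF : F.IsSaturated p) (hP : E.IsCentric P) (h : F.Iso P Q f) :
    E.IsCentric Q := by
  have hTS := hW.1.1
  refine ⟨hW.2.1.le_of_iso h hP.1, fun Q' g hg => ?_⟩
  obtain ⟨a, R, e, ha, he, haR, -⟩ := hW.decomp hS hE hF hP.1 (h.comp (hg.mono hW.1))
  obtain ⟨b, hb, hba, hab⟩ := ha.symm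
  intro x hx
  have hR : ∀ y ∈ R, y ∈ T := fun y hy => he.le_right hy
  have h1 : b x ∈ R := (hP.of_iso he).mem (hb.mem hx.1) fun y hy => by
    have h2 : x * a y = a y * x := (hx.2 _ (haR.mem hy)).symm
    have h3 := congrArg b h2
    rw [hb.map_mul hx.1 (ha.mem (hR y hy)), hb.map_mul (ha.mem (hR y hy)) hx.1, hba y (hR y hy)] at h3
    rw [h3]; group
  rw [← hab x hx.1]
  exact haR.mem h1

end IsWeaklyNormal

end FusionSystem

/-! ### Good isomorphisms: extension to `C_S(T)` with trivial action modulo `T`. -/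

namespace FusionSystem

variable {G : Type*} [Group G] {S T : Subgroup G} {F : FusionSystem S} {E : FusionSystem T}
  {P Q R P' Q' R' N N' : Subgroup G} {f g h k a b : G → G} {p : ℕ}

/-- `C_S(T)`. -/
def cent (S T : Subgroup G) : Subgroup G := S ⊓ Subgroup.centralizer (T : Set G)

theorem cent_le : cent S T ≤ S := inf_le_left

theorem conj_of_mem_cent {c x : G} (hc : c ∈ cent S T) (hx : x ∈ T) : c * x * c⁻¹ = x := by
  rw [mul_inv_eq_iff_eq_mul]
  exact (hc.2 x hx).symm

theorem comm_of_mem_cent {c x : G} (hc : c ∈ cent S T) (hx : x ∈ T) : c * x = x * c :=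
  (hc.2 x hx).symm

theorem mem_cent {c : G} (hc : c ∈ S) (h : ∀ x ∈ T, c * x * c⁻¹ = x) : c ∈ cent S T :=
  ⟨hc, fun x hx => by
    have := h x hx
    rw [mul_inv_eq_iff_eq_mul] at this
    exact this.symm⟩

theorem mem_sup_cent (hP : P ≤ T) {z : G} :
    z ∈ P ⊔ cent S T ↔ ∃ x ∈ P, ∃ c ∈ cent S T, x * c = z :=
  mem_sup_of_conj_mem fun c hc x hx => by rwa [conj_of_mem_cent hc (hP hx)]

/-- `f` extends to an isomorphism from `P C_S(T)` to `Q C_S(T)` that induces the identity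
modulo `T`. -/
def Good (F : FusionSystem S) (T P Q : Subgroup G) (f : G → G) : Prop :=
  F.Iso P Q f ∧ ∃ f', F.Iso (P ⊔ cent S T) (Q ⊔ cent S T) f' ∧ (∀ x ∈ P, f' x = f x) ∧
    ∀ c ∈ cent S T, c⁻¹ * f' c ∈ T

/-- A weakly normal saturated subsystem of a saturated fusion system over a `p`-group. -/
structure WNPair (p : ℕ) (E : FusionSystem T) (F : FusionSystem S) : Prop where
  wn : E.IsWeaklyNormal F
  pgroup : IsPGroup p S
  satE : E.IsSaturated p
  satF : F.IsSaturated p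

theorem Good.congr (hf : Good F T P Q f) (hfg : ∀ x ∈ P, f x = g x) : Good F T P Q g := by
  obtain ⟨h1, f', h2, h3, h4⟩ := hf
  exact ⟨h1.congr hfg, f', h2, fun x hx => (h3 x hx).trans (hfg x hx), h4⟩

theorem good_id (hTS : T ≤ S) (hP : P ≤ T) : Good F T P P id :=
  ⟨Iso.id (hP.trans hTS), id, Iso.id (sup_le (hP.trans hTS) cent_le), fun _ _ => rfl,
    fun c _ => by simp⟩

namespace WNPair

variable [Finite S] [Fact p.Prime] (H : WNPair p E F)
include H

theorem le : T ≤ S := H.wn.1.1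

theorem finite : Finite T := finite_of_le H.le

theorem closed : F.IsStronglyClosed T := H.wn.2.1

theorem pgroupT : IsPGroup p T := H.pgroup.to_le H.le

theorem centric_of_iso (hP : E.IsCentric P) (h : F.Iso P Q f) : E.IsCentric Q :=
  H.wn.isCentric_of_iso H.pgroup H.satE H.satF hP h

theorem le_of_iso (hP : P ≤ T) (h : F.Iso P Q f) : Q ≤ T := H.closed.le_of_iso h hP

/-- Both `c` and `f c` centralize `Q`, so `c⁻¹ f(c)` lies in `C_T(Q)`, which is contained in the
centric subgroup `Q`. -/
theorem inv_mul_mem (hP : E.IsCentric P) (hQ : F.Iso P Q f) (hf : F.Iso (P ⊔ cent S T) R f)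
    {c : G} (hc : c ∈ cent S T) (hcT : c⁻¹ * f c ∈ T) : c⁻¹ * f c ∈ Q := by
  refine (H.centric_of_iso hP hQ).mem hcT fun y hy => ?_
  have hyT : y ∈ T := H.le_of_iso hP.1 hQ hy
  obtain ⟨x, hx, rfl⟩ := hQ.surj hy
  have h1 := hf.map_conj (le_sup_right (a := P) hc) (le_sup_left (b := cent S T) hx)
  rw [conj_of_mem_cent hc (hP.1 hx)] at h1
  have h2 := conj_of_mem_cent ((cent S T).inv_mem hc) hyT
  calc c⁻¹ * f c * f x * (c⁻¹ * f c)⁻¹ = c⁻¹ * (f c * f x * (f c)⁻¹) * c⁻¹⁻¹ := by group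
    _ = f x := by rw [← h1, h2]

/-- The image need not be checked: `g c ∈ c Q` by `inv_mul_mem`, which forces `R = Q C_S(T)`. -/
theorem good_mk (hP : E.IsCentric P) (h : F.Iso P Q f) (hf : F.Iso (P ⊔ cent S T) R g)
    (hfg : ∀ x ∈ P, g x = f x) (hc : ∀ c ∈ cent S T, c⁻¹ * g c ∈ T) : Good F T P Q f := by
  have hQg : F.Iso P Q g := h.congr fun x hx => (hfg x hx).symm
  have hQT := H.le_of_iso hP.1 h
  have hR : R = Q ⊔ cent S T := by
    refine le_antisymm (fun y hy => ?_) (sup_le (fun y hy => ?_) fun c hcc => ?_)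
    · obtain ⟨z, hz, rfl⟩ := hf.surj hy
      obtain ⟨x, hx, c, hcc, rfl⟩ := (mem_sup_cent hP.1).1 hz
      rw [hf.map_mul (Subgroup.mem_sup_left hx) (Subgroup.mem_sup_right hcc)]
      have h1 := H.inv_mul_mem hP hQg hf hcc (hc c hcc)
      have h2 : g c = c * (c⁻¹ * g c) := by group
      rw [h2]
      exact Subgroup.mul_mem _ (Subgroup.mem_sup_left (hQg.mem hx))
        (Subgroup.mul_mem _ (Subgroup.mem_sup_right hcc) (Subgroup.mem_sup_left h1))
    · obtain ⟨x, hx, rfl⟩ := hQg.surj hy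
      exact hf.mem (Subgroup.mem_sup_left hx)
    · have h1 := H.inv_mul_mem hP hQg hf hcc (hc c hcc)
      obtain ⟨x, hx, hxe⟩ := hQg.surj h1
      have h2 : g c * (g x)⁻¹ = c := by rw [hxe]; group
      rw [← h2]
      exact R.mul_mem (hf.mem (Subgroup.mem_sup_right hcc))
        (R.inv_mem (hf.mem (Subgroup.mem_sup_left hx)))
  exact ⟨h, g, hR ▸ hf, hfg, hc⟩

theorem good_comp (hP : E.IsCentric P) (hf : Good F T P Q f) (hg : Good F T Q R g) :
    Good F T P R (g ∘ f) := by
  obtain ⟨h1, f', h2, h3, h4⟩ := hf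
  obtain ⟨k1, g', k2, k3, k4⟩ := hg
  refine ⟨h1.comp k1, g' ∘ f', h2.comp k2, fun x hx => ?_, fun c hc => ?_⟩
  · simp [h3 x hx, k3 _ (h1.mem hx)]
  · have h5 := H.inv_mul_mem hP (h1.congr fun x hx => (h3 x hx).symm) h2 hc (h4 c hc)
    have h6 : f' c = c * (c⁻¹ * f' c) := by group
    simp only [Function.comp_apply]
    rw [h6, k2.map_mul (Subgroup.mem_sup_right hc) (Subgroup.mem_sup_left h5), k3 _ h5, ← mul_assoc]
    exact T.mul_mem (k4 c hc) (H.le_of_iso (H.le_of_iso hP.1 h1) k1 (k1.mem h5))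

theorem good_symm (hP : E.IsCentric P) (hf : Good F T P Q f) (hg : ∀ x ∈ P, g (f x) = x) :
    Good F T Q P g := by
  obtain ⟨h1, f', h2, h3, h4⟩ := hf
  obtain ⟨g', k1, k2, k3⟩ := h2.symm
  refine ⟨h1.symm_of hg, g', k1, fun y hy => ?_, fun c hc => ?_⟩
  · obtain ⟨x, hx, rfl⟩ := h1.surj hy
    rw [hg x hx, ← h3 x hx, k2 _ (Subgroup.mem_sup_left hx)]
  · have h5 := H.inv_mul_mem hP (h1.congr fun x hx => (h3 x hx).symm) h2 hc (h4 c hc)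
    obtain ⟨x, hx, hxe⟩ := h1.surj h5
    rw [← h3 x hx] at hxe
    have hxc := Subgroup.mem_sup_left (T := cent S T) hx
    have hcc := Subgroup.mem_sup_right (S := P) hc
    have h6 : c = f' (c * x⁻¹) := by
      rw [h2.map_mul hcc (Subgroup.inv_mem _ hxc), h2.map_inv hxc, hxe]; group
    have h7 : g' c = c * x⁻¹ := by
      conv_lhs => rw [h6]
      exact k2 _ (Subgroup.mul_mem _ hcc (Subgroup.inv_mem _ hxc))
    rw [h7]
    simpa using hP.1 hx

theorem good_restrict (hP' : E.IsCentric P') (hf : Good F T P Q f) (hP : P' ≤ P)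
    (h : F.Iso P' Q' f) : Good F T P' Q' f := by
  obtain ⟨h1, f', h2, h3, h4⟩ := hf
  obtain ⟨R, -, hR⟩ := h2.restrict (sup_le_sup_right hP (cent S T))
  exact H.good_mk hP' h hR (fun x hx => h3 x (hP hx)) h4

theorem good_conj (hP : E.IsCentric P) {t : G} (ht : t ∈ T) (h : F.Iso P Q fun x => t * x * t⁻¹) :
    Good F T P Q fun x => t * x * t⁻¹ := by
  obtain ⟨R, -, hR⟩ := (Iso.conj_self (F := F) le_rfl (H.le ht)
    (Subgroup.le_normalizer (H.le ht))).restrict (sup_le (hP.1.trans H.le) cent_le : P ⊔ cent S T ≤ S)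
  refine H.good_mk hP h hR (fun x _ => rfl) fun c hc => ?_
  have : c⁻¹ * (t * c * t⁻¹) = 1 := by rw [← comm_of_mem_cent hc ht]; group
  rw [this]
  exact T.one_mem

theorem isFN_self : F.IsFN p T := by
  obtain ⟨Q, f, hQ, hf⟩ := H.satF.exists_isFN H.le
  have : Q = T := hf.eq_of_le (H.le_of_iso le_rfl hf) H.le le_rfl
  exact this ▸ hQ

theorem exists_extend_aut (ha : F.Iso T T a) : ∃ a' R, F.Iso (T ⊔ cent S T) R a' ∧
    (∀ x ∈ T, a' x = a x) ∧ (∀ c ∈ cent S T, a' c ∈ cent S T) ∧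
      ∀ c ∈ cent S T, ∃ d ∈ cent S T, a' d = c := by
  obtain ⟨N, N', a', h1, h2, h3, -, h4⟩ := H.isFN_self.receptive.extend ha
  have hC : T ⊔ cent S T ≤ N := sup_le h3 fun c hc => h4 c hc.1
    (fun x hx => by rwa [conj_of_mem_cent hc hx])
    ⟨1, S.one_mem, fun x hx => by rw [conj_of_mem_cent hc hx]; simp⟩
  obtain ⟨R, -, hR⟩ := h1.restrict hC
  have hcc : ∀ c ∈ cent S T, a' c ∈ cent S T := fun c hc => by
    refine mem_cent (hR.le_right (hR.mem (Subgroup.mem_sup_right hc))) fun y hy => ?_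
    obtain ⟨x, hx, rfl⟩ := ha.surj hy
    rw [← h2 x hx, ← hR.map_conj (Subgroup.mem_sup_right hc) (Subgroup.mem_sup_left hx),
      conj_of_mem_cent hc hx]
  refine ⟨a', R, hR, h2, hcc, fun c hc => ?_⟩
  obtain ⟨C', -, hC'⟩ := hR.restrict (le_sup_right : cent S T ≤ T ⊔ cent S T)
  have : C' = cent S T := hC'.eq_of_le (fun y hy => by
    obtain ⟨x, hx, rfl⟩ := hC'.surj hy
    exact hcc x hx) cent_le le_rfl
  subst this
  exact hC'.surj hc

/-- The automorphism `a` extends to some `a'` on `T C_S(T)` because `C_S(T)` acts trivially on `T`.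
This `a'` need not be the identity modulo `T`, but conjugation by it preserves that property of the
extension of `f`. -/
theorem good_aut (ha : F.Iso T T a) (hb : ∀ x ∈ T, b (a x) = x) (hPc : E.IsCentric P)
    (hf : Good F T P Q f) (hP : F.Iso P P' a) (hQ : F.Iso Q Q' a) :
    Good F T P' Q' (a ∘ f ∘ b) := by
  obtain ⟨a', R, hR, h1, h2, h3⟩ := H.exists_extend_aut ha
  have key : ∀ {P P' : Subgroup G}, P ≤ T → F.Iso P P' a →
      F.Iso (P ⊔ cent S T) (P' ⊔ cent S T) a' := by
    intro P P' hPT hP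
    refine hR.restrict_to (sup_le_sup_right hPT _) fun y => ?_
    rw [mem_sup_cent (H.le_of_iso hPT hP)]
    constructor
    · rintro ⟨x, hx, c, hc, rfl⟩
      obtain ⟨z, hz, rfl⟩ := hP.surj hx
      obtain ⟨d, hd, rfl⟩ := h3 c hc
      refine ⟨z * d, Subgroup.mul_mem_sup hz hd, ?_⟩
      rw [hR.map_mul (Subgroup.mem_sup_left (hPT hz)) (Subgroup.mem_sup_right hd), h1 z (hPT hz)]
    · rintro ⟨x, hx, rfl⟩
      obtain ⟨z, hz, d, hd, rfl⟩ := (mem_sup_cent hPT).1 hx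
      refine ⟨a z, hP.mem hz, a' d, h2 d hd, ?_⟩
      rw [hR.map_mul (Subgroup.mem_sup_left (hPT hz)) (Subgroup.mem_sup_right hd), h1 z (hPT hz)]
  have hQT := H.le_of_iso hPc.1 hf.1
  have hP2 := key hPc.1 hP
  have hQ2 := key hQT hQ
  obtain ⟨b', hb', hba, hab⟩ := hP2.symm
  obtain ⟨k1, f', k2, k3, k4⟩ := hf
  have hP'b : F.Iso P' P b := hP.symm_of fun x hx => hb x (hPc.1 hx)
  have hP'c := H.centric_of_iso hPc hP
  refine H.good_mk hP'c ((hP'b.comp k1).comp hQ) ((hb'.comp k2).comp hQ2) (fun y hy => ?_)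
    fun c hc => ?_
  · obtain ⟨x, hx, rfl⟩ := hP.surj hy
    have h5 : b' (a x) = x := by rw [← h1 x (hPc.1 hx), hba x (Subgroup.mem_sup_left hx)]
    simp only [Function.comp_apply]
    rw [h5, hb x (hPc.1 hx), k3 x hx, h1 _ (hQT (k1.mem hx))]
  · obtain ⟨d, hd, rfl⟩ := h3 c hc
    have h6 := H.inv_mul_mem hPc (k1.congr fun x hx => (k3 x hx).symm) k2 hd (k4 d hd)
    have h7 : f' d = d * (d⁻¹ * f' d) := by group
    simp only [Function.comp_apply]
    rw [hba d (Subgroup.mem_sup_right hd), h7,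
      hQ2.map_mul (Subgroup.mem_sup_right hd) (Subgroup.mem_sup_left h6), inv_mul_cancel_left,
      h1 _ (hQT h6)]
    exact H.le_of_iso hQT hQ (hQ.mem h6)

/-- After transport by some `s` to a fully normalized `Q`, the automorphism `α` becomes conjugation
by an element `t ∈ T`. The map `s` extends to `σ` on `P C_S(T)`, the element `t` normalizes the
image of `σ`, and `σ⁻¹ c_t σ` is the extension of `α`. -/
theorem good_of_pow_eq_one (hP : E.IsCentric P) {α : MulAut P} (hα : α ∈ E.aut hP.1) {n : ℕ}
    (hn : α ^ p ^ n = 1) : Good F T P P (extFun α) := by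
  have hTS := H.le
  have := H.finite
  obtain ⟨Q, r, hQ, hr⟩ := H.satF.exists_isFN (hP.1.trans hTS)
  have hQT := H.le_of_iso hP.1 hr
  have hQE := H.wn.isFN H.pgroup H.satE hQ hQT
  obtain ⟨φ, hφ, hφr⟩ := id hr
  have hβ : MulAut.congr φ α ∈ E.aut hQE.le := by
    obtain ⟨i, hi, hir, -⟩ := hr.symm
    refine mem_aut_of_iso (H.wn.conj_iso (iso_of_mem_aut hα) le_rfl le_rfl hP.1 hr hr hr hir)
      fun y => ?_
    obtain ⟨x, rfl⟩ := φ.surjective y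
    rw [congr_apply]
    simp [hφr, hir, extFun_coe]
  obtain ⟨γ, hγ, hc⟩ := hQE.automized.exists_conj (H := Subgroup.zpowers (MulAut.congr φ α))
    (by rwa [Subgroup.zpowers_le]) (by
      have h1 : MulAut.congr φ α ^ p ^ n = 1 := by rw [← map_pow, hn, map_one]
      rintro ⟨_, m, rfl⟩
      refine ⟨n, Subtype.ext ?_⟩
      change ((MulAut.congr φ α) ^ m) ^ p ^ n = 1
      rw [← zpow_natCast, ← zpow_mul, mul_comm, zpow_mul, zpow_natCast, h1, one_zpow])
  obtain ⟨t, ht, htx⟩ := mem_autS.1 (hc _ (Subgroup.mem_zpowers _))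
  have hs : F.Iso P Q (extFun γ ∘ r) := hr.comp ((iso_of_mem_aut hγ).mono H.wn.1)
  have hst : ∀ x : P, (extFun γ ∘ r) (α x) = t * (extFun γ ∘ r) x * t⁻¹ := fun x => by
    have h1 := htx (γ (φ x))
    have h2 : (γ * MulAut.congr φ α * γ⁻¹) (γ (φ x)) = γ (φ (α x)) := by simp [MulAut.congr]
    rw [h2] at h1
    simpa [← hφr, extFun_coe] using h1
  generalize extFun γ ∘ r = s at hs hst
  obtain ⟨N, N', σ, h1, h2, h3, -, h4⟩ := hQ.receptive.extend hs
  have hC : P ⊔ cent S T ≤ N := sup_le h3 fun c hc => h4 c hc.1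
    (fun x hx => by rwa [conj_of_mem_cent hc (hP.1 hx)])
    ⟨1, S.one_mem, fun x hx => by rw [conj_of_mem_cent hc (hP.1 hx)]; simp⟩
  obtain ⟨R, -, hR⟩ := h1.restrict hC
  have hQR : F.Iso P Q σ := hs.congr fun x hx => (h2 x hx).symm
  have hQleR : Q ≤ R := hR.le_of_le hQR le_sup_left
  -- The commutator `[t, σ c]` is in `T` since `T` is normal in `S`. It centralizes `Q` since `σ c`
  -- does and `t` normalizes `Q`. Centricity puts it in `Q`.
  have hcomm : ∀ c ∈ cent S T, t * σ c * t⁻¹ * (σ c)⁻¹ ∈ Q := by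
    intro c hcc
    have hcS : σ c ∈ S := hR.le_right (hR.mem (Subgroup.mem_sup_right hcc))
    have hcent : ∀ y ∈ Q, σ c * y * (σ c)⁻¹ = y := fun y hy => by
      obtain ⟨x, hx, rfl⟩ := hQR.surj hy
      rw [← hR.map_conj (Subgroup.mem_sup_right hcc) (Subgroup.mem_sup_left hx),
        conj_of_mem_cent hcc (hP.1 hx)]
    refine (H.centric_of_iso hP hs).mem ?_ fun y hy => ?_
    · have h5 : σ c * t⁻¹ * (σ c)⁻¹ ∈ T := by
        have hn : F.Iso S S fun x => σ c * x * (σ c)⁻¹ :=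
          Iso.conj_self le_rfl hcS (Subgroup.le_normalizer hcS)
        exact H.closed.mem_of_iso hn (hTS (T.inv_mem ht.1)) (T.inv_mem ht.1)
      have := T.mul_mem ht.1 h5
      convert this using 1
      group
    · have hty : t⁻¹ * y * t ∈ Q := by
        simpa using conj_mem_of_mem_nz ((nz T Q).inv_mem ht) hy
      have h6 : (σ c)⁻¹ * y * σ c = y := by
        conv_lhs => rw [← hcent y hy]
        group
      calc t * σ c * t⁻¹ * (σ c)⁻¹ * y * (t * σ c * t⁻¹ * (σ c)⁻¹)⁻¹
          = t * (σ c * (t⁻¹ * ((σ c)⁻¹ * y * σ c) * t) * (σ c)⁻¹) * t⁻¹ := by group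
        _ = y := by rw [h6, hcent _ hty]; group
  have hnR : ∀ y ∈ R, t * y * t⁻¹ ∈ R := by
    intro y hy
    obtain ⟨z, hz, rfl⟩ := hR.surj hy
    obtain ⟨x, hx, c, hcc, rfl⟩ := (mem_sup_cent hP.1).1 hz
    rw [hR.map_mul (Subgroup.mem_sup_left hx) (Subgroup.mem_sup_right hcc)]
    have h5 : t * (σ x * σ c) * t⁻¹ =
        (t * σ x * t⁻¹) * ((t * σ c * t⁻¹ * (σ c)⁻¹) * σ c) := by group
    rw [h5]
    exact R.mul_mem (hQleR (conj_mem_of_mem_nz ht (hQR.mem hx)))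
      (R.mul_mem (hQleR (hcomm c hcc)) (hR.mem (Subgroup.mem_sup_right hcc)))
  obtain ⟨τ, hτ, hτσ, hστ⟩ := hR.symm
  have hRR : F.Iso R R fun y => t * y * t⁻¹ :=
    Iso.conj_self hR.le_right (hTS ht.1) (mem_nz hR.le_right (hTS ht.1) hnR).2
  refine H.good_mk hP ((iso_of_mem_aut hα).mono H.wn.1) ((hR.comp hRR).comp hτ) (fun x hx => ?_)
    fun c hcc => ?_
  · simp only [Function.comp_apply]
    rw [h2 x hx, ← hst ⟨x, hx⟩, ← h2 _ (α ⟨x, hx⟩).2, hτσ _ (Subgroup.mem_sup_left (α ⟨x, hx⟩).2),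
      extFun_of_mem α hx]
  · obtain ⟨x, hx, hxe⟩ := hQR.surj (hcomm c hcc)
    have hxc := Subgroup.mul_mem_sup hx hcc
    have h5 : t * σ c * t⁻¹ = σ (x * c) := by
      rw [hR.map_mul (Subgroup.mem_sup_left hx) (Subgroup.mem_sup_right hcc), hxe]; group
    simp only [Function.comp_apply]
    rw [h5, hτσ _ hxc, ← comm_of_mem_cent hcc (hP.1 hx), inv_mul_cancel_left]
    exact hP.1 hx

end WNPair

end FusionSystem

/-! ### Extending and lifting good isomorphisms to overgroups. -/

namespace FusionSystem

variable {G : Type*} [Group G] {S T : Subgroup G} {F : FusionSystem S} {E : FusionSystem T}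
  {P Q R P' Q' R' N N' : Subgroup G} {f g h k a b e α : G → G} {p : ℕ}

theorem exists_forall_pow_eq_one [Finite S] [Fact p.Prime] (hS : IsPGroup p S) :
    ∃ n : ℕ, ∀ s ∈ S, s ^ p ^ n = 1 := by
  obtain ⟨n, hn⟩ := IsPGroup.iff_card.1 hS
  refine ⟨n, fun s hs => ?_⟩
  have := pow_card_eq_one' (x := (⟨s, hs⟩ : S))
  rw [hn] at this
  exact congrArg Subtype.val this

/-- The automorphisms of `T` of `p`-power order in a saturated fusion system over `T` are inner. -/
theorem IsSaturated.exists_conj_of_pow_eq_one [Finite T] [Fact p.Prime] (hE : E.IsSaturated p)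
    {α : MulAut T} (hα : α ∈ E.aut le_rfl) {n : ℕ} (hn : α ^ p ^ n = 1) :
    ∃ t : T, α = MulAut.conj t := by
  obtain ⟨Q, k, hQ, hk⟩ := hE.exists_isFN le_rfl
  have : Q = T := hk.eq_of_le hk.le_right le_rfl le_rfl
  subst this
  obtain ⟨γ, hγ, hc⟩ := hQ.automized.exists_conj (H := Subgroup.zpowers α)
    (by rwa [Subgroup.zpowers_le]) (by
      rintro ⟨_, j, rfl⟩
      refine ⟨n, Subtype.ext ?_⟩
      change (α ^ j) ^ p ^ n = 1
      rw [← zpow_natCast, ← zpow_mul, mul_comm, zpow_mul, zpow_natCast, hn, one_zpow])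
  obtain ⟨t, ht, htx⟩ := mem_autS.1 (hc _ (Subgroup.mem_zpowers α))
  have h1 : γ * α * γ⁻¹ = MulAut.conj ⟨t, ht.1⟩ := MulEquiv.ext fun y => Subtype.ext (htx y)
  have h2 : α = γ⁻¹ * MulAut.conj ⟨t, ht.1⟩ * γ := by rw [← h1]; group
  refine ⟨γ⁻¹ ⟨t, ht.1⟩, MulEquiv.ext fun y => ?_⟩
  conv_lhs => rw [h2]
  simp [MulAut.mul_apply]

/-- An automorphism of a fully automized subgroup `R` that is the identity on `R ∩ T` and modulo
`T`, for a strongly closed `T`, is induced by an element of `S`. -/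
theorem IsFN.mem_autS_of_trivial [Finite S] [Fact p.Prime] (hS : IsPGroup p S)
    (hR : F.IsFN p R) (hT : F.IsStronglyClosed T) {κ : MulAut R} (hκ : κ ∈ F.aut hR.le)
    (h1 : ∀ r : R, (r : G) ∈ T → κ r = r) (h2 : ∀ r : R, (r : G)⁻¹ * κ r ∈ T) :
    κ ∈ autS S R := by
  -- All such automorphisms form a `p`-group `K`, so some `γ` conjugates `K` into `Aut_S(R)`. Strong
  -- closure of `T` makes `K` invariant under `γ`, hence `K` itself lies in `Aut_S(R)`.
  let K : Subgroup (MulAut R) :=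
    { carrier := {κ | κ ∈ F.aut hR.le ∧ (∀ r : R, (r : G) ∈ T → κ r = r) ∧
        ∀ r : R, (r : G)⁻¹ * κ r ∈ T}
      one_mem' := ⟨one_mem _, fun _ _ => rfl, fun r => by simp [T.one_mem]⟩
      mul_mem' := by
        rintro x y ⟨hx, hx1, hx2⟩ ⟨hy, hy1, hy2⟩
        refine ⟨mul_mem hx hy, fun r hr => ?_, fun r => ?_⟩
        · rw [MulAut.mul_apply, hy1 r hr, hx1 r hr]
        · have h3 : x (r⁻¹ * y r) = r⁻¹ * y r := hx1 _ (hy2 r)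
          have h4 : y r = r * (r⁻¹ * y r) := by group
          have h5 : (r : G)⁻¹ * (x * y) r = (r : G)⁻¹ * x r * ((r : G)⁻¹ * y r) := by
            rw [MulAut.mul_apply, h4, _root_.map_mul, h3]
            simp [mul_assoc]
          rw [h5]
          exact T.mul_mem (hx2 r) (hy2 r)
      inv_mem' := by
        rintro x ⟨hx, hx1, hx2⟩
        refine ⟨inv_mem hx, fun r hr => ?_, fun r => ?_⟩
        · conv_lhs => rw [← hx1 r hr]
          exact x.symm_apply_apply r
        · have := T.inv_mem (hx2 (x⁻¹ r))
          rw [MulAut.apply_inv_self] at this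
          simpa using this }
  have hK : IsPGroup p K := by
    obtain ⟨n, hn⟩ := exists_forall_pow_eq_one hS
    rintro ⟨x, hx, hx1, hx2⟩
    -- As `x` fixes `r⁻¹ x(r) ∈ T`, the order of `x` divides any exponent of `S`.
    have hpow : ∀ (r : R) (j : ℕ), (x ^ j) r = r * (r⁻¹ * x r) ^ j := by
      intro r j
      induction j with
      | zero => simp
      | succ j ih =>
        have h3 : x (r⁻¹ * x r) = r⁻¹ * x r := hx1 _ (hx2 r)
        rw [pow_succ', MulAut.mul_apply, ih, _root_.map_mul, _root_.map_pow, h3, pow_succ', ← mul_assoc r,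
          mul_inv_cancel_left]
    refine ⟨n, Subtype.ext (MulEquiv.ext fun r => ?_)⟩
    have h3 : (r⁻¹ * x r) ^ p ^ n = 1 := Subtype.ext (hn _ (hR.le (r⁻¹ * x r).2))
    refine (hpow r _).trans ?_
    rw [h3, mul_one]
    rfl
  obtain ⟨γ, hγ, hc⟩ := hR.automized.exists_conj (H := K) (fun x hx => hx.1) hK
  have hmem : γ⁻¹ * κ * γ ∈ K := by
    refine ⟨mul_mem (mul_mem (inv_mem hγ) hκ) hγ, fun r hr => ?_, fun r => ?_⟩
    · have h3 : (γ r : G) ∈ T := by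
        rw [← extFun_coe]
        exact hT.mem_of_iso (iso_of_mem_aut hγ) r.2 hr
      simp [MulAut.mul_apply, h1 _ h3]
    · have h3 := h2 (γ r)
      have h4 : (((γ r)⁻¹ * κ (γ r) : R) : G) ∈ T := h3
      have h5 := hT.mem_of_iso (iso_of_mem_aut (inv_mem hγ)) ((γ r)⁻¹ * κ (γ r)).2 h4
      rw [extFun_coe] at h5
      simpa [MulAut.mul_apply] using h5
  have := hc _ hmem
  simpa [mul_assoc] using this

namespace WNPair

variable [Finite S] [Fact p.Prime] (H : WNPair p E F)
include H

/-- Let `f'` be the extension of `a` from `P` to `P C_S(T)`, and `ρ` a map of `N_S(Q C_S(T))` that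
makes the image `R` of `Q C_S(T)` fully normalized. By receptivity `ρ f'` extends to `N C_S(T)` once
each `n ∈ N` acts on `R` as an element of `S`. Composition with `ρ⁻¹` then gives the good map on
`N`. -/
theorem good_extend (hP : E.IsCentric P) (hPN : P ≤ N) (hN : N ≤ nz T P) (ha : F.Iso N N' a)
    (hPa : Good F T P Q a) : ∃ ψ, Good F T N N' ψ ∧ ∀ x ∈ P, ψ x = a x := by
  have hTS := H.le
  have hNT : N ≤ T := hN.trans nz_le
  have hN'T : N' ≤ T := H.le_of_iso hNT ha
  obtain ⟨k1, f', k2, k3, k4⟩ := hPa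
  have hQT : Q ≤ T := H.le_of_iso hP.1 k1
  have hQN' : Q ≤ N' := ha.le_of_le k1 hPN
  obtain ⟨R, k, hR, hk⟩ := H.satF.exists_isFN k2.le_right
  obtain ⟨ρ, M, hρ, hρR, hM⟩ := hR.exists_extend H.pgroup hk
  have hQM : Q ⊔ cent S T ≤ nz S (Q ⊔ cent S T) := FusionSystem.le_nz k2.le_right
  have hN'n : N' ≤ nz S (Q ⊔ cent S T) := by
    intro m hm
    obtain ⟨n, hn, rfl⟩ := ha.surj hm
    refine mem_nz k2.le_right (hTS (hN'T hm)) fun y hy => ?_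
    obtain ⟨q, hq, c, hc, rfl⟩ := (mem_sup_cent hQT).1 hy
    obtain ⟨x, hx, rfl⟩ := k1.surj hq
    have h1 : a n * (a x * c) * (a n)⁻¹ = a (n * x * n⁻¹) * c := by
      rw [ha.map_conj hn (hPN hx)]
      have := comm_of_mem_cent hc (T.inv_mem (hN'T hm))
      simp only [mul_assoc, this]
    rw [h1]
    exact Subgroup.mul_mem_sup (k1.mem (conj_mem_of_mem_nz (hN hn) hx)) hc
  have hh : F.Iso (P ⊔ cent S T) R (ρ ∘ f') := k2.comp hρR
  obtain ⟨h', hh', hhh, hhh'⟩ := hh.symm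
  have hfc : ∀ c ∈ cent S T, f' c ∈ nz S (Q ⊔ cent S T) := fun c hc =>
    hQM (k2.mem (Subgroup.mem_sup_right hc))
  have hconj : ∀ n ∈ N, ∃ s ∈ S, ∀ z ∈ P ⊔ cent S T, n * z * n⁻¹ ∈ P ⊔ cent S T ∧
      (ρ ∘ f') (n * z * n⁻¹) = s * (ρ ∘ f') z * s⁻¹ := by
    intro n hn
    have hm : a n ∈ nz S (Q ⊔ cent S T) := hN'n (ha.mem hn)
    have hnz : n ∈ nz S (P ⊔ cent S T) := by
      refine mem_nz k2.le_left (hTS (hNT hn)) fun z hz => ?_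
      obtain ⟨x, hx, c, hc, rfl⟩ := (mem_sup_cent hP.1).1 hz
      have h1 : n * (x * c) * n⁻¹ = n * x * n⁻¹ * c := by
        have := comm_of_mem_cent hc (T.inv_mem (hNT hn))
        simp only [mul_assoc, this]
      rw [h1]
      exact Subgroup.mul_mem_sup (conj_mem_of_mem_nz (hN hn) hx) hc
    -- The map `κ` compares the action of `n`, transported by `ρ f'`, with conjugation by `ρ (a n)`.
    -- It is the identity on `R ∩ T` and modulo `T`, hence induced by `S`.
    have hκ : F.Iso R R ((fun y => (ρ (a n))⁻¹ * y * (ρ (a n))⁻¹⁻¹) ∘ ((ρ ∘ f') ∘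
        ((fun z => n * z * n⁻¹) ∘ h'))) :=
      ((hh'.comp (Iso.conj_self k2.le_left hnz.1 hnz.2)).comp hh).comp
        (Iso.conj_self hR.le (nz_le ((nz S R).inv_mem (hM (hρ.mem hm))))
          ((nz S R).inv_mem (hM (hρ.mem hm))).2)
    obtain ⟨κ, hκa, hκf⟩ := hκ.exists_mulAut hR.le
    have hval : ∀ (r : R) (x c : G), x ∈ P → c ∈ cent S T → (r : G) = (ρ ∘ f') (x * c) →
        (κ r : G) = ρ (a x * ((a n)⁻¹ * f' c * a n)) ∧ (r : G) = ρ (a x * f' c) := by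
      intro r x c hx hc hr
      have hxc := Subgroup.mul_mem_sup hx hc
      have h1 : n * (x * c) * n⁻¹ = n * x * n⁻¹ * c := by
        have := comm_of_mem_cent hc (T.inv_mem (hNT hn))
        simp only [mul_assoc, this]
      have hnx := conj_mem_of_mem_nz (hN hn) hx
      have hax : a x ∈ nz S (Q ⊔ cent S T) := hN'n (ha.mem (hPN hx))
      refine ⟨?_, ?_⟩
      · rw [hκf, hr]
        simp only [Function.comp_apply] at hhh ⊢
        rw [hhh _ hxc, h1, k2.map_mul (Subgroup.mem_sup_left hnx) (Subgroup.mem_sup_right hc),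
          k3 _ hnx, ha.map_conj hn (hPN hx)]
        rw [hρ.map_mul (mul_mem (mul_mem hm hax) (inv_mem hm)) (hfc c hc),
          hρ.map_mul (mul_mem hm hax) (inv_mem hm), hρ.map_mul hm hax, hρ.map_inv hm,
          hρ.map_mul hax (mul_mem (mul_mem (inv_mem hm) (hfc c hc)) hm),
          hρ.map_mul (mul_mem (inv_mem hm) (hfc c hc)) hm, hρ.map_mul (inv_mem hm) (hfc c hc),
          hρ.map_inv hm]
        group
      · rw [hr]
        simp only [Function.comp_apply]
        rw [k2.map_mul (Subgroup.mem_sup_left hx) (Subgroup.mem_sup_right hc), k3 x hx]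
    have hκS : κ ∈ autS S R := by
      refine hR.mem_autS_of_trivial H.pgroup H.closed hκa (fun r hr => ?_) fun r => ?_
      · obtain ⟨z, hz, hzr⟩ := hh.surj r.2
        have hzT : z ∈ T := H.closed.mem_of_iso' hh hz (hzr ▸ hr)
        -- `P C_S(T) ∩ T = P`, because `Z(T) ≤ P` by centricity.
        have hzP : z ∈ P := by
          obtain ⟨x, hx, c, hc, rfl⟩ := (mem_sup_cent hP.1).1 hz
          have hcT : c ∈ T := by simpa using mul_mem (inv_mem (hP.1 hx)) hzT
          exact mul_mem hx (hP.mem hcT fun y hy => conj_of_mem_cent hc (hP.1 hy))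
        obtain ⟨h1, h2⟩ := hval r z 1 hzP (one_mem _) (by rw [mul_one, hzr])
        refine Subtype.ext (h1.trans (Eq.trans ?_ h2.symm))
        rw [k2.map_one]
        simp
      · obtain ⟨z, hz, hzr⟩ := hh.surj r.2
        obtain ⟨x, hx, c, hc, rfl⟩ := (mem_sup_cent hP.1).1 hz
        obtain ⟨h1, h2⟩ := hval r x c hx hc hzr.symm
        have hax : a x ∈ nz S (Q ⊔ cent S T) := hN'n (ha.mem (hPN hx))
        rw [h1, h2, ← hρ.map_inv (mul_mem hax (hfc c hc)), ← hρ.map_mul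
          (inv_mem (mul_mem hax (hfc c hc)))
          (mul_mem hax (mul_mem (mul_mem (inv_mem hm) (hfc c hc)) hm))]
        refine H.closed.mem_of_iso hρ (mul_mem
          (inv_mem (mul_mem hax (hfc c hc)))
          (mul_mem hax (mul_mem (mul_mem (inv_mem hm) (hfc c hc)) hm))) ?_
        have h3 : (a x * f' c)⁻¹ * (a x * ((a n)⁻¹ * f' c * a n)) =
            (c⁻¹ * f' c)⁻¹ * ((c⁻¹ * (a n)⁻¹ * c⁻¹⁻¹) * (c⁻¹ * f' c) * a n) := by group
        rw [h3, conj_of_mem_cent (inv_mem hc) (inv_mem (hN'T (ha.mem hn)))]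
        have h4 := k4 c hc
        have h5 := hN'T (ha.mem hn)
        exact mul_mem (inv_mem h4) (mul_mem (mul_mem (inv_mem h5) h4) h5)
    obtain ⟨s, hs, hsx⟩ := mem_autS.1 hκS
    refine ⟨ρ (a n) * s, mul_mem (hρ.le_right (hρ.mem hm)) hs.1, fun z hz => ⟨?_, ?_⟩⟩
    · exact conj_mem_of_mem_nz hnz hz
    · have h1 := hsx ⟨_, hh.mem hz⟩
      rw [hκf] at h1
      simp only [Function.comp_apply] at h1 hhh ⊢
      rw [hhh z hz] at h1
      calc ρ (f' (n * z * n⁻¹))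
          = ρ (a n) * ((ρ (a n))⁻¹ * ρ (f' (n * z * n⁻¹)) * (ρ (a n))⁻¹⁻¹) * (ρ (a n))⁻¹ := by group
        _ = _ := by rw [h1]; group
  obtain ⟨N₁, N₁', ψ, hψ, hψh, hPN₁, -, hmem⟩ := hR.receptive.extend hh
  have hle : N ⊔ cent S T ≤ N₁ := by
    refine sup_le (fun n hn => ?_) (le_sup_right.trans hPN₁)
    obtain ⟨s, hs, hsx⟩ := hconj n hn
    exact hmem n (hTS (hNT hn)) (fun z hz => (hsx z hz).1) ⟨s, hs, fun z hz => (hsx z hz).2⟩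
  have hNN₁ : N ≤ N₁ := le_sup_left.trans hle
  obtain ⟨Q₀, -, hQ₀⟩ := hh.restrict (le_sup_left : P ≤ P ⊔ cent S T)
  have hQ₀c := H.centric_of_iso hP hQ₀
  -- `ψ n` and `ρ (a n)` act alike on the centric image `Q₀` of `P`, so they differ by an element of
  -- `Q₀`. Consequently `ψ N` lies in the domain of `ρ⁻¹` and is carried by it onto `N'`.
  have hψn : ∀ n ∈ N, ∃ x ∈ P, ψ n = ρ (a (n * x)) := by
    intro n hn
    have hm : a n ∈ nz S (Q ⊔ cent S T) := hN'n (ha.mem hn)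
    have h1 : (ρ (a n))⁻¹ * ψ n ∈ Q₀ := by
      refine hQ₀c.mem (mul_mem (inv_mem (H.closed.mem_of_iso hρ hm (hN'T (ha.mem hn))))
        (H.closed.mem_of_iso hψ (hNN₁ hn) (hNT hn))) fun y hy => ?_
      obtain ⟨z, hz, rfl⟩ := hQ₀.surj hy
      have hnz := conj_mem_of_mem_nz (hN hn) hz
      have h2 : ψ n * (ρ ∘ f') z * (ψ n)⁻¹ = ρ (a n) * (ρ ∘ f') z * (ρ (a n))⁻¹ := by
        rw [← hψh z (Subgroup.mem_sup_left hz), ← hψ.map_conj (hNN₁ hn)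
          (hPN₁ (Subgroup.mem_sup_left hz)), hψh _ (Subgroup.mem_sup_left hnz),
          hψh z (Subgroup.mem_sup_left hz)]
        simp only [Function.comp_apply]
        rw [k3 _ hnz, k3 z hz, ha.map_conj hn (hPN hz), hρ.map_conj hm (hN'n (ha.mem (hPN hz)))]
      calc (ρ (a n))⁻¹ * ψ n * (ρ ∘ f') z * ((ρ (a n))⁻¹ * ψ n)⁻¹
          = (ρ (a n))⁻¹ * (ψ n * (ρ ∘ f') z * (ψ n)⁻¹) * ρ (a n) := by group
        _ = (ρ ∘ f') z := by rw [h2]; group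
    obtain ⟨x, hx, hxe⟩ := hQ₀.surj h1
    refine ⟨x, hx, ?_⟩
    simp only [Function.comp_apply] at hxe
    rw [ha.map_mul hn (hPN hx), hρ.map_mul hm (hN'n (ha.mem (hPN hx))), ← k3 x hx, hxe]
    group
  obtain ⟨ρ', hρ', hρρ, hρρ'⟩ := hρ.symm
  obtain ⟨W, -, hW⟩ := hψ.restrict hle
  have hWM : W ≤ M := by
    intro w hw
    obtain ⟨z, hz, rfl⟩ := hW.surj hw
    obtain ⟨n, hn, c, hc, rfl⟩ := (mem_sup_cent hNT).1 hz
    obtain ⟨x, hx, hxe⟩ := hψn n hn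
    rw [hW.map_mul (Subgroup.mem_sup_left hn) (Subgroup.mem_sup_right hc), hxe,
      hψh c (Subgroup.mem_sup_right hc)]
    exact mul_mem (hρ.mem (hN'n (ha.mem (mul_mem hn (hPN hx))))) (hρ.mem (hfc c hc))
  obtain ⟨W', -, hW'⟩ := hW.comp_restrict hρ' hWM
  have hval : ∀ z ∈ P ⊔ cent S T, (ρ' ∘ ψ) z = f' z := by
    intro z hz
    simp only [Function.comp_apply]
    rw [hψh z hz, Function.comp_apply, hρρ _ (hQM (k2.mem hz))]
  obtain ⟨X, -, hX⟩ := hW'.restrict (le_sup_left : N ≤ N ⊔ cent S T)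
  have hXN : X = N' := by
    refine hX.eq_of_le (fun y hy => ?_) (hN'T.trans hTS) ha.card_eq.ge
    obtain ⟨n, hn, rfl⟩ := hX.surj hy
    obtain ⟨x, hx, hxe⟩ := hψn n hn
    have h1 := ha.mem (mul_mem hn (hPN hx))
    simp only [Function.comp_apply]
    rw [hxe, hρρ _ (hN'n h1)]
    exact h1
  subst hXN
  refine ⟨_, H.good_mk (hP.mono hPN hNT) hX hW' (fun _ _ => rfl) fun c hc => ?_, fun x hx => ?_⟩
  · rw [hval c (Subgroup.mem_sup_right hc)]
    exact k4 c hc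
  · rw [hval x (Subgroup.mem_sup_left hx), k3 x hx]

/-- With `m` the `p'`-part of the order of `b`, the power `bᵐ` has `p`-power order, and such
elements of `Aut_E(T)` are inner. -/
theorem mem_cyclic_of_iso (hβ : E.Iso T T b) :
    ∃ m : ℕ, m.Coprime p ∧ ∃ t ∈ T, ∀ y ∈ T, b^[m] y = t * y * t⁻¹ := by
  have := H.finite
  have hfin := finite_mulAut (le_refl T)
  obtain ⟨β, hβa, hβb⟩ := hβ.exists_mulAut le_rfl
  obtain ⟨k, m, hm, hkm⟩ := Nat.exists_eq_pow_mul_and_not_dvd (orderOf_pos β).ne' p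
    (Fact.out : p.Prime).ne_one
  have hpow : (β ^ m) ^ p ^ k = 1 := by rw [← pow_mul, mul_comm, ← hkm, pow_orderOf_eq_one]
  obtain ⟨t, ht⟩ := H.satE.exists_conj_of_pow_eq_one (pow_mem hβa m) hpow
  have hiter : ∀ (j : ℕ) (y : T), ((β ^ j) y : G) = b^[j] y := by
    intro j y
    induction j with
    | zero => rfl
    | succ j ih => rw [pow_succ', MulAut.mul_apply, hβb, ih, Function.iterate_succ_apply']
  refine ⟨m, ((Nat.Prime.coprime_iff_not_dvd Fact.out).2 hm).symm, t, t.2, fun y hy => ?_⟩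
  rw [← hiter m ⟨y, hy⟩, ht]
  rfl

theorem good_iterate (hP : E.IsCentric P) (h : Good F T P P f) (n : ℕ) :
    Good F T P P f^[n] := by
  induction n with
  | zero => exact good_id H.le hP.1
  | succ n ih =>
    rw [Function.iterate_succ']
    exact H.good_comp hP ih h

/-- Take a good `ψ` on `N` that agrees with `a` on `P`, and put `κ = ψ a⁻¹`. It is trivial on `Q`,
so it has `p`-power order. Up to good maps `κ` is `α⁻¹`, some power of which, prime to `p`, is inner
and hence good. So a power of `κ` prime to `p` is good, therefore `κ` is, and so is `a = κ⁻¹ ψ`. -/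
theorem good_lift (hP : E.IsCentric P) (hPN : P ≤ N) (hN : N ≤ nz T P)
    (hPa : Good F T P Q a) (hα : E.Iso T T α) (he : Good F T N R e) (hR : F.Iso R N' α)
    (hae : ∀ x ∈ N, a x = α (e x)) : Good F T N N' a := by
  have hNT : N ≤ T := hN.trans nz_le
  have hNc := hP.mono hPN hNT
  have ha : F.Iso N N' a := (he.1.comp hR).congr fun x hx => (hae x hx).symm
  have hRT := H.le_of_iso hNT he.1
  have hN'c := H.centric_of_iso hNc ha
  obtain ⟨ψ, hψ, hψa⟩ := H.good_extend hP hPN hN ha hPa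
  obtain ⟨b, hb, hbα, hαb⟩ := hα.symm
  have hαF := hα.mono H.wn.1
  have hbF := hb.mono H.wn.1
  obtain ⟨e', he', hee, -⟩ := he.1.symm
  have hg : Good F T R N' (ψ ∘ e') :=
    H.good_comp (H.centric_of_iso hNc he.1) (H.good_symm hNc he hee) hψ
  have hbN' : F.Iso N' R b := hR.symm_of fun x hx => hbα x (hRT hx)
  set κ := (ψ ∘ e') ∘ b with hκdef
  have hκ : F.Iso N' N' κ := hbN'.comp hg.1
  have hκa : ∀ x ∈ N, κ (a x) = ψ x := fun x hx => by
    simp only [hκdef, Function.comp_apply]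
    rw [hae x hx, hbα _ (hRT (he.1.mem hx)), hee x hx]
  -- `κʲ = h bʲ` with `h` good: each new factor `b` is moved past the good part by `good_aut`.
  have key : ∀ j : ℕ, ∃ X h, F.Iso N' X b^[j] ∧ Good F T X N' h ∧
      ∀ y ∈ N', h (b^[j] y) = κ^[j] y := by
    intro j
    induction j with
    | zero => exact ⟨N', id, Iso.id ha.le_right, good_id H.le hN'c.1, fun _ _ => rfl⟩
    | succ j ih =>
      obtain ⟨X, h, h1, h2, h3⟩ := ih
      have hXc := H.centric_of_iso hN'c h1
      obtain ⟨Y, -, hY⟩ := hbF.restrict hXc.1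
      have h4 : Good F T Y R (b ∘ h ∘ α) := H.good_aut hbF hαb hXc h2 hY hbN'
      refine ⟨Y, _, by rw [Function.iterate_succ']; exact h1.comp hY,
        H.good_comp (H.centric_of_iso hXc hY) h4 hg, fun y hy => ?_⟩
      have h5 := h1.mem hy
      rw [Function.iterate_succ_apply', Function.iterate_succ_apply', ← h3 y hy]
      simp only [Function.comp_apply, hκdef]
      rw [hαb _ (hXc.1 h5)]
  obtain ⟨m, hm, t, ht, hbt⟩ := H.mem_cyclic_of_iso hb
  obtain ⟨X, h, h1, h2, h3⟩ := key m
  have hκm : Good F T N' N' κ^[m] := by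
    have h4 := H.good_conj hN'c ht (h1.congr fun y hy => hbt y (hN'c.1 hy))
    refine (H.good_comp hN'c h4 h2).congr fun y hy => ?_
    rw [← h3 y hy, Function.comp_apply, hbt y (hN'c.1 hy)]
  obtain ⟨n, hn⟩ := exists_forall_pow_eq_one H.pgroup
  have hQT := H.le_of_iso hP.1 hPa.1
  have hQN' : Q ≤ N' := ha.le_of_le hPa.1 hPN
  have hκQ : ∀ y ∈ Q, κ y = y := fun y hy => by
    obtain ⟨x, hx, rfl⟩ := hPa.1.surj hy
    rw [hκa x (hPN hx), hψa x hx]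
  have hN'Q : N' ≤ nz S Q := ha.le_nz (hN.trans (nz_mono H.le)) hPN hPa.1
  -- `y` and `κ y` induce the same action on `Q`, which `κ` fixes pointwise.
  have hκz : ∀ y ∈ N', y⁻¹ * κ y ∈ Q := fun y hy => by
    refine (H.centric_of_iso hP hPa.1).mem (mul_mem (inv_mem (hN'c.1 hy)) (hN'c.1 (hκ.mem hy)))
      fun q hq => ?_
    have h4 := hκ.map_conj hy (hQN' hq)
    rw [hκQ q hq, hκQ _ (conj_mem_of_mem_nz (hN'Q hy) hq)] at h4
    calc y⁻¹ * κ y * q * (y⁻¹ * κ y)⁻¹ = y⁻¹ * (κ y * q * (κ y)⁻¹) * y := by group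
      _ = q := by rw [← h4]; group
  have hκpow : ∀ (j : ℕ), ∀ y ∈ N', κ^[j] y = y * (y⁻¹ * κ y) ^ j := by
    intro j y hy
    have hz := hκz y hy
    induction j with
    | zero => simp
    | succ j ih =>
      rw [Function.iterate_succ_apply', ih, hκ.map_mul hy (hQN' (pow_mem hz j)),
        hκQ _ (pow_mem hz j), pow_succ', ← mul_assoc y,
        mul_inv_cancel_left]
  -- The exponent `n + 1` keeps the modulus above `1` even for `n = 0`. Below, `l` is an inverse of
  -- `m` modulo it, so that `κ = (κᵐ)ˡ`.
  have hpn : 1 < p ^ (n + 1) := Nat.one_lt_pow (by omega) (Fact.out : p.Prime).one_lt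
  obtain ⟨l, -, hl⟩ := Nat.exists_mul_mod_eq_one_of_coprime (hm.pow_right (n + 1)) hpn
  have hκg : Good F T N' N' κ := by
    refine (H.good_iterate hN'c hκm l).congr fun y hy => ?_
    rw [← Function.iterate_mul, hκpow _ y hy, ← Nat.div_add_mod (m * l) (p ^ (n + 1)), hl, pow_add,
      pow_mul, pow_succ, pow_mul, hn _ (H.le (hQT (hκz y hy)))]
    simp
  obtain ⟨κ', hκ', hκκ, -⟩ := hκ.symm
  refine (H.good_comp hNc hψ (H.good_symm hN'c hκg hκκ)).congr fun x hx => ?_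
  rw [Function.comp_apply, ← hκa x hx, hκκ _ (ha.mem hx)]

end WNPair

end FusionSystem

/-! ### The subgroups `P C_T(P)`, and subsystems of index prime to `p`. -/

namespace FusionSystem

variable {G : Type*} [Group G] {T : Subgroup G} {E E₁ : FusionSystem T}
  {P Q R X W P' Q' R' N N' : Subgroup G} {f g h k a b e : G → G} {p : ℕ}

/-- `P C_T(P)`. -/
def supCent (T P : Subgroup G) : Subgroup G := P ⊔ (T ⊓ Subgroup.centralizer (P : Set G))

theorem mem_centralizer_of_conj {c : G} (hc : c ∈ T) (h : ∀ x ∈ P, c * x * c⁻¹ = x) :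
    c ∈ T ⊓ Subgroup.centralizer (P : Set G) :=
  ⟨hc, fun x hx => by
    have := h x hx
    rw [mul_inv_eq_iff_eq_mul] at this
    exact this.symm⟩

theorem conj_of_mem_centralizer {c x : G} (hc : c ∈ T ⊓ Subgroup.centralizer (P : Set G))
    (hx : x ∈ P) : c * x * c⁻¹ = x := by
  rw [mul_inv_eq_iff_eq_mul]
  exact (hc.2 x hx).symm

theorem mem_supCent {z : G} :
    z ∈ supCent T P ↔ ∃ x ∈ P, ∃ c ∈ T ⊓ Subgroup.centralizer (P : Set G), x * c = z :=
  mem_sup_of_conj_mem fun c hc x hx => by rwa [conj_of_mem_centralizer hc hx]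

theorem le_supCent : P ≤ supCent T P := le_sup_left

theorem centralizer_le_supCent : T ⊓ Subgroup.centralizer (P : Set G) ≤ supCent T P := le_sup_right

theorem supCent_le (hP : P ≤ T) : supCent T P ≤ T := sup_le hP inf_le_left

theorem supCent_le_nz [Finite T] (hP : P ≤ T) : supCent T P ≤ nz T P :=
  sup_le (le_nz hP) fun c hc => mem_nz hP hc.1 fun x hx => by rwa [conj_of_mem_centralizer hc hx]

theorem nz_le_nz_supCent [Finite T] (hP : P ≤ T) : nz T P ≤ nz T (supCent T P) := by
  intro n hn
  refine mem_nz (supCent_le hP) hn.1 fun z hz => ?_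
  obtain ⟨x, hx, c, hc, rfl⟩ := mem_supCent.1 hz
  have h1 : n * (x * c) * n⁻¹ = (n * x * n⁻¹) * (n * c * n⁻¹) := by group
  rw [h1]
  refine Subgroup.mul_mem_sup (conj_mem_of_mem_nz hn hx) (mem_centralizer_of_conj
    (mul_mem (mul_mem hn.1 hc.1) (inv_mem hn.1)) fun y hy => ?_)
  have h2 : n⁻¹ * y * n ∈ P := by simpa using conj_mem_of_mem_nz (inv_mem hn) hy
  calc n * c * n⁻¹ * y * (n * c * n⁻¹)⁻¹ = n * (c * (n⁻¹ * y * n) * c⁻¹) * n⁻¹ := by group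
    _ = y := by rw [conj_of_mem_centralizer hc h2]; group

theorem Iso.mem_centralizer (hf : E.Iso X W f) (hP : P ≤ X) (hPQ : E.Iso P Q f) {c : G}
    (hcX : c ∈ X) (hc : c ∈ T ⊓ Subgroup.centralizer (P : Set G)) :
    f c ∈ T ⊓ Subgroup.centralizer (Q : Set G) := by
  refine mem_centralizer_of_conj (hf.le_right (hf.mem hcX)) fun y hy => ?_
  obtain ⟨x, hx, rfl⟩ := hPQ.surj hy
  rw [← hf.map_conj hcX (hP hx), conj_of_mem_centralizer hc hx]

theorem Iso.le_supCent (hf : E.Iso X W f) (hP : P ≤ X) (hX : X ≤ supCent T P)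
    (hPQ : E.Iso P Q f) : W ≤ supCent T Q := by
  intro w hw
  obtain ⟨z, hz, rfl⟩ := hf.surj hw
  obtain ⟨x, hx, c, hc, rfl⟩ := mem_supCent.1 (hX hz)
  have hcX : c ∈ X := by simpa using mul_mem (inv_mem (hP hx)) hz
  rw [hf.map_mul (hP hx) hcX]
  exact Subgroup.mul_mem_sup (hPQ.mem hx) (hf.mem_centralizer hP hPQ hcX hc)

theorem IsFN.extend_supCent [Finite T] (hQ : E.IsFN p Q) (h : E.Iso P Q f) :
    ∃ f' W, E.Iso (supCent T P) W f' ∧ (∀ x ∈ P, f' x = f x) ∧ W ≤ supCent T Q := by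
  obtain ⟨N, N', f', h1, h2, h3, -, h4⟩ := hQ.receptive.extend h
  have hle : supCent T P ≤ N := sup_le h3 fun c hc => h4 c hc.1
    (fun x hx => by rwa [conj_of_mem_centralizer hc hx])
    ⟨1, T.one_mem, fun x hx => by rw [conj_of_mem_centralizer hc hx]; simp⟩
  obtain ⟨W, -, hW⟩ := h1.restrict hle
  exact ⟨f', W, hW, h2, hW.le_supCent FusionSystem.le_supCent le_rfl
    (h.congr fun x hx => (h2 x hx).symm)⟩

theorem IsFN.card_supCent_le [Finite T] (hQ : E.IsFN p Q) (h : E.Iso P Q f) :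
    Nat.card (supCent T P) ≤ Nat.card (supCent T Q) := by
  obtain ⟨f', W, h1, -, h3⟩ := hQ.extend_supCent h
  have := finite_of_le (supCent_le (T := T) hQ.le)
  rw [h1.card_eq]
  exact Subgroup.card_le_of_le h3

/-- The order of `P C_T(P)` is largest in the class of `P`, so an image of it that contains the
image `Q` of `P` is all of `Q C_T(Q)`, and this contains `C_T(Q)`. -/
theorem IsFN.isCentric_supCent [Finite T] (hP : E.IsFN p P) : E.IsCentric (supCent T P) := by
  refine ⟨supCent_le hP.le, fun W f hf => ?_⟩
  obtain ⟨Q, hQW, hQ⟩ := hf.restrict (le_supCent (T := T))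
  obtain ⟨f', hf', hff, -⟩ := hQ.symm
  have h1 := hP.card_supCent_le hf'
  have h2 : W ≤ supCent T Q := hf.le_supCent le_supCent le_rfl hQ
  have := finite_of_le (supCent_le (T := T) hQ.le_right)
  have h3 : W = supCent T Q := Subgroup.eq_of_le_of_card_ge h2 (hf.card_eq ▸ h1)
  refine (inf_le_inf_left _ (Subgroup.centralizer_le hQW)).trans ?_
  rw [h3]
  exact centralizer_le_supCent

theorem IsFN.exists_mem_centralizer [Finite T] (hP : E.IsFN p P) (hc : ¬ E.IsCentric P) :
    ∃ x ∈ T ⊓ Subgroup.centralizer (P : Set G), x ∉ P := by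
  by_contra hcon
  push Not at hcon
  have : supCent T P = P := le_antisymm (sup_le le_rfl hcon) le_supCent
  exact hc (this ▸ hP.isCentric_supCent)

theorem isFN_of_aut [Finite T] [Fact p.Prime] (hT : IsPGroup p T) (ha : E.Iso T T a)
    (h : E.Iso P Q a) (hQ : E.IsFN p Q) : E.IsFN p P := by
  refine hQ.of_card hT h ?_
  obtain ⟨b, hb, hba, -⟩ := ha.symm
  have hQP : E.Iso Q P b := h.symm_of fun x hx => hba x (h.le_left hx)
  obtain ⟨M, hM, hM'⟩ := hb.restrict (nz_le (S := T) (P := Q))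
  have := finite_of_le (nz_le (S := T) (P := P))
  rw [hM'.card_eq]
  exact Subgroup.card_le_of_le (hM'.le_nz le_rfl (le_nz hQ.le) hQP)

/-- `Q` and `Q C_T(Q)` are fully automized and receptive. -/
def IsDFN (E : FusionSystem T) (p : ℕ) (Q : Subgroup G) : Prop :=
  E.IsFN p Q ∧ E.IsFN p (supCent T Q)

/-- Starting from a fully normalized `Q₀`, move `Q₀ C_T(Q₀)` to a fully normalized subgroup by a map
defined on its normalizer. That normalizer contains `N_T(Q₀)`, so the image of `Q₀` still has a
normalizer of largest order. -/
theorem exists_isDFN [Finite T] [Fact p.Prime] (hT : IsPGroup p T) (hE : E.IsSaturated p)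
    (hP : P ≤ T) : ∃ Q f M, E.IsDFN p Q ∧ E.Iso (nz T P) M f ∧ E.Iso P Q f := by
  obtain ⟨Q₀, k, hQ₀, hk⟩ := hE.exists_isFN hP
  obtain ⟨f, M, hf, hfP, hM⟩ := hQ₀.exists_extend hT hk
  obtain ⟨V, l, hV, hl⟩ := hE.exists_isFN (supCent_le hQ₀.le)
  obtain ⟨g, L, hg, hgV, hL⟩ := hV.exists_extend hT hl
  obtain ⟨Q, hQV, hQ⟩ := hgV.restrict (le_supCent (T := T))
  obtain ⟨g', hg', hgg, -⟩ := hQ.symm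
  have hle := nz_le_nz_supCent hQ₀.le
  obtain ⟨K, -, hK⟩ := hg.restrict hle
  have hKn : K ≤ nz T Q := hK.le_nz le_rfl (le_nz hQ₀.le) hQ
  have hQF : E.IsFN p Q := by
    refine hQ₀.of_card hT hg' ?_
    have := finite_of_le (nz_le (S := T) (P := Q))
    rw [hK.card_eq]
    exact Subgroup.card_le_of_le hKn
  have hVQ : V = supCent T Q := by
    have := finite_of_le (supCent_le (T := T) hQF.le)
    refine Subgroup.eq_of_le_of_card_ge (hgV.le_supCent le_supCent le_rfl hQ) ?_
    rw [← hgV.card_eq]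
    exact hQ₀.card_supCent_le hg'
  obtain ⟨M', -, hM'⟩ := hf.comp_restrict hg (hM.trans hle)
  exact ⟨Q, g ∘ f, M', ⟨hQF, hVQ ▸ hV⟩, hM', hfP.comp hQ⟩

/-- The properties of a subsystem `E₁` of a saturated fusion system `E` that make it saturated and
of index prime to `p`. -/
structure PPrimePair (p : ℕ) (E E₁ : FusionSystem T) : Prop where
  pgroup : IsPGroup p T
  sat : E.IsSaturated p
  sub : E₁.IsSubsystem E
  conj : ∀ {P Q P' Q' f a b}, E.Iso T T a → (∀ x ∈ T, b (a x) = x) → E₁.Iso P Q f →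
    E.Iso P P' a → E.Iso Q Q' a → E₁.Iso P' Q' (a ∘ f ∘ b)
  pow : ∀ {P} (hP : E.IsCentric P) {α : MulAut P} {n : ℕ}, α ∈ E.aut hP.1 → α ^ p ^ n = 1 →
    α ∈ E₁.aut hP.1
  lift : ∀ {P Q N N' a}, E.IsCentric P → P ≤ N → N ≤ nz T P → E₁.Iso P Q a →
    Decomp E T E₁.Iso N N' a → E₁.Iso N N' a
  generated : ∀ (C : Subgroup G → Subgroup G → (G → G) → Prop),
    (∀ P Q R R' f, E.IsCentric R → E₁.Iso R R' f → P ≤ R → E₁.Iso P Q f → C P Q f) →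
    (∀ P Q R f g, E₁.Iso P Q f → E₁.Iso Q R g → C P Q f → C Q R g → C P R (g ∘ f)) →
    (∀ P Q f g, C P Q f → (∀ x ∈ P, f x = g x) → C P Q g) →
    ∀ P Q f, E₁.Iso P Q f → C P Q f

namespace PPrimePair

theorem isoClass (H : PPrimePair p E E₁) : IsoClass E T E₁.Iso where
  iso h := h.mono H.sub
  id hP := Iso.id hP
  comp h h' := h.comp h'
  symm_of h h' := h.symm_of h'
  restrict := fun {P Q P' Q' f} h hP h' => by
    obtain ⟨X, -, hX⟩ := h.restrict hP
    exact (hX.mono H.sub).target_unique h' ▸ hX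
  conj := H.conj

theorem isFullyAutomized (H : PPrimePair p E E₁) (hQ : E.IsFN p Q) : E₁.IsFullyAutomized p hQ.le :=
  isFullyAutomized_iff.2 ((isFullyAutomized_iff.1 hQ.automized).of_le (autS_le_aut E₁ hQ.le)
    fun _ hx => mem_aut_iff.2 ((iso_of_mem_aut hx).mono H.sub))

variable [Finite T] [Fact p.Prime] (H : PPrimePair p E E₁)
include H

/-- For centric `P` the Frattini argument works since `E₁` contains the `p`-elements of `Aut_E(P)`.
For other `P` every automorphism already extends to `P C_T(P) > P`, and the factor in `E₁` is the
identity. -/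
theorem decomp (h : E.Iso P Q f) : Decomp E T E₁.Iso P Q f := by
  refine H.isoClass.decomp H.pgroup H.sat (isStronglyClosed_self E) (fun P j hP hPT hj => ?_)
    h.le_left h
  by_cases hc : E.IsCentric P
  · obtain ⟨α, hα, hαj⟩ := hj.exists_mulAut hP.le
    have hsy : IsSylowIn p (E₁.aut hP.le) (autS T P) :=
      (isFullyAutomized_iff.1 hP.automized).of_le (autS_le_aut E₁ hP.le) fun x hx =>
        mem_aut_iff.2 ((iso_of_mem_aut hx).mono H.sub)
    have := finite_mulAut hP.le
    obtain ⟨γ, hγ, hconj⟩ := hsy.exists_conj (H := conjSubgroup α (autS T P)) (fun x hx => by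
        obtain ⟨n, hn⟩ := (isPGroup_autS H.pgroup P).conjSubgroup α ⟨x, hx⟩
        refine H.pow hc (n := n) ?_ (congrArg Subtype.val hn)
        obtain ⟨y, hy, rfl⟩ := mem_conjSubgroup.1 hx
        exact mul_mem (mul_mem hα (autS_le_aut E _ hy)) (inv_mem hα))
      ((isPGroup_autS H.pgroup P).conjSubgroup α)
    have hγE : E.Iso P P (extFun γ) := (iso_of_mem_aut hγ).mono H.sub
    obtain ⟨N, N', n, hn, hext, hPN, hN, hmem⟩ := hP.receptive.extend (hj.comp hγE)
    have hle : nz T P ≤ N := fun t ht => by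
      refine hmem t ht.1 (fun x hx => conj_mem_of_mem_nz ht hx) ?_
      have h1 : P.normalizerMonoidHom ⟨t, ht.2⟩ ∈ autS T P := mem_autS.2 ⟨t, ht, fun x => rfl⟩
      obtain ⟨s, hs, hsx⟩ := mem_autS.1 (hconj _ (mem_conjSubgroup.2 ⟨_, h1, rfl⟩))
      refine ⟨s, hs.1, fun x hx => ?_⟩
      have h2 := hsx (γ (α ⟨x, hx⟩))
      have h3 : P.normalizerMonoidHom ⟨t, ht.2⟩ ⟨x, hx⟩ = ⟨_, conj_mem_of_mem_nz ht hx⟩ := rfl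
      simp only [MulAut.mul_apply, MulAut.inv_apply_self, h3] at h2
      simpa [← hαj ⟨x, hx⟩, ← hαj ⟨_, conj_mem_of_mem_nz ht hx⟩, extFun_coe] using h2
    obtain ⟨M', -, hM'⟩ := hn.restrict hle
    have hPn : E.Iso P P n := (hj.comp hγE).congr fun x hx => (hext x hx).symm
    refine ⟨extFun γ⁻¹, n, nz T P, M', iso_of_mem_aut (inv_mem hγ),
      lt_nz H.pgroup hPT, nz_le, hM', hPn, fun x hx => ?_⟩
    rw [hext x hx, Function.comp_apply, extFun_of_mem γ (hj.mem hx), extFun_coe]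
    simp
  · obtain ⟨x, hx, hxP⟩ := hP.exists_mem_centralizer hc
    obtain ⟨n, W, hn, hext, -⟩ := hP.extend_supCent hj
    refine ⟨id, n, supCent T P, W, Iso.id hP.le, lt_of_le_of_ne le_supCent fun hh => hxP ?_,
      supCent_le hP.le, hn, hj.congr fun x hx => (hext x hx).symm, fun x hx => (hext x hx).symm⟩
    rw [hh]
    exact centralizer_le_supCent hx

/-- By `decomp`, `h` is an `E₁`-isomorphism followed by an automorphism of `T`; conjugation by
either preserves `E₁`. -/
theorem conj_iso (hh : E.Iso R R' h) (hk : ∀ x ∈ R, k (h x) = x) (hf : E₁.Iso P Q f) (hP : P ≤ R)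
    (hQ : Q ≤ R) (hPP : E.Iso P P' h) (hQQ : E.Iso Q Q' h) : E₁.Iso P' Q' (h ∘ f ∘ k) := by
  obtain ⟨a, X, e, ha, he, hX, hae⟩ := H.decomp hh
  obtain ⟨b, hb, hba, -⟩ := ha.symm
  obtain ⟨e', he', hee, -⟩ := he.symm
  obtain ⟨P₁, hP₁X, hP₁⟩ := he.restrict hP
  obtain ⟨Q₁, hQ₁X, hQ₁⟩ := he.restrict hQ
  have h1 : E₁.Iso P₁ Q₁ (e ∘ f ∘ e') := ((hP₁.symm_of fun x hx => hee x (hP hx)).comp hf).comp hQ₁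
  have key : ∀ {A B A' : Subgroup G}, A ≤ R → E₁.Iso A B e → E.Iso A A' h → E.Iso B A' a := by
    intro A B A' hA hAB hAA
    obtain ⟨A'', -, hA''⟩ := ha.restrict hAB.le_right
    have := ((hAB.mono H.sub).comp hA'').congr fun x hx => (hae x (hA hx)).symm
    exact this.target_unique hAA ▸ hA''
  refine (H.conj ha hba h1 (key hP hP₁ hPP) (key hQ hQ₁ hQQ)).congr fun y hy => ?_
  obtain ⟨x, hx, rfl⟩ := hPP.surj hy
  have hxR := hP hx
  simp only [Function.comp_apply]
  rw [hk x hxR, hae x hxR, hba _ (he.le_right (he.mem hxR)), hee x hxR, hae _ (hQ (hf.mem hx))]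

/-- This removes centricity from the field `pow`: at a fully normalized conjugate, `α` becomes
conjugation by an element of `T`, which lies in `E₁`, and `conj_iso` brings it back. -/
theorem mem_aut_of_pow (hP : P ≤ T) {α : MulAut P} {n : ℕ} (hα : α ∈ E.aut hP)
    (hn : α ^ p ^ n = 1) : α ∈ E₁.aut hP := by
  obtain ⟨Q, r, hQ, hr⟩ := H.sat.exists_isFN hP
  obtain ⟨f, hf, -, hc⟩ := hQ.exists_iso_conj hr (H := Subgroup.zpowers α)
    (by rwa [Subgroup.zpowers_le]) (by
      rintro ⟨_, j, rfl⟩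
      refine ⟨n, Subtype.ext ?_⟩
      change (α ^ j) ^ p ^ n = 1
      rw [← zpow_natCast, ← zpow_mul, mul_comm, zpow_mul, zpow_natCast, hn, one_zpow])
  obtain ⟨s, hs, hsx⟩ := hc α (Subgroup.mem_zpowers α)
  obtain ⟨g, hg, hgf, hfg⟩ := hf.symm
  refine mem_aut_of_iso (H.conj_iso hg hfg (Iso.conj_self hQ.le hs.1 hs.2) le_rfl le_rfl hg hg)
    fun x => ?_
  simp only [Function.comp_apply]
  rw [← hsx x, hgf _ (α x).2]

theorem conj_mem_aut (hP : P ≤ T) {α β : MulAut P} (hα : α ∈ E.aut hP) (hβ : β ∈ E₁.aut hP) :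
    α * β * α⁻¹ ∈ E₁.aut hP := by
  have h1 := iso_of_mem_aut hα
  obtain ⟨g, hg, hgf, -⟩ := h1.symm
  refine mem_aut_of_iso (H.conj_iso h1 hgf (iso_of_mem_aut hβ) le_rfl le_rfl h1 h1) fun x => ?_
  obtain ⟨y, rfl⟩ := α.surjective x
  have h2 : g (α y) = y := by rw [← extFun_coe, hgf _ y.2]
  simp [MulAut.mul_apply, h2, extFun_coe]

/-- `Aut_{E₁}(P)` is normal in `Aut_E(P)` and contains its elements of `p`-power order, hence a
Sylow `p`-subgroup. -/
theorem hasIndexPrimeTo : HasIndexPrimeTo p E₁ E := by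
  refine ⟨H.sub, fun P hP => ?_⟩
  have hfin := finite_mulAut hP
  have hle : E₁.aut hP ≤ E.aut hP := fun x hx =>
    mem_aut_iff.2 ((iso_of_mem_aut hx).mono H.sub)
  rintro _ ⟨x, hx, rfl⟩
  have hN : ((E₁.aut hP).subgroupOf (E.aut hP)).Normal :=
    ⟨fun n hn g => Subgroup.mem_subgroupOf.2 (H.conj_mem_aut hP g.2 (Subgroup.mem_subgroupOf.1 hn))⟩
  have hcop : ((E₁.aut hP).subgroupOf (E.aut hP)).index.Coprime p := by
    obtain ⟨U⟩ := (inferInstance : Nonempty (Sylow p (E.aut hP)))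
    have hU : (U : Subgroup (E.aut hP)) ≤ (E₁.aut hP).subgroupOf (E.aut hP) := by
      intro u hu
      obtain ⟨n, hn⟩ := U.isPGroup' ⟨u, hu⟩
      refine Subgroup.mem_subgroupOf.2 (H.mem_aut_of_pow hP (n := n) u.2 ?_)
      have := congrArg (fun z : (U : Subgroup (E.aut hP)) => ((z : E.aut hP) : MulAut P)) hn
      exact this
    rw [Nat.coprime_comm, Nat.Prime.coprime_iff_not_dvd Fact.out]
    exact fun hd => U.not_dvd_index (hd.trans (Subgroup.index_dvd_of_le hU))
  have h1 : x ∈ (E₁.aut hP).subgroupOf (E.aut hP) := by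
    have : pPrimeResidual p (E.aut hP) ≤ (E₁.aut hP).subgroupOf (E.aut hP) := sInf_le ⟨hN, hcop⟩
    exact this hx
  exact Subgroup.mem_subgroupOf.1 h1

/-- The map given for `E` is changed into one in `E₁` by removing an automorphism of `T`, which does
not affect the properties of the target. -/
theorem exists_isDFN (hP : P ≤ T) :
    ∃ Q f M, E.IsDFN p Q ∧ E₁.Iso (nz T P) M f ∧ E₁.Iso P Q f := by
  obtain ⟨Q, f, M, hQ, hM, hf⟩ := FusionSystem.exists_isDFN H.pgroup H.sat hP
  obtain ⟨a, R, e, ha, he, haR, hae⟩ := H.decomp hM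
  obtain ⟨Q₁, hQ₁R, hQ₁⟩ := he.restrict (le_nz hP)
  obtain ⟨Q₂, -, hQ₂⟩ := ha.restrict hQ₁.le_right
  have h1 := ((hQ₁.mono H.sub).comp hQ₂).congr fun x hx => (hae x (le_nz hP hx)).symm
  have := h1.target_unique hf
  subst this
  refine ⟨Q₁, e, R, ⟨isFN_of_aut H.pgroup ha hQ₂ hQ.1, ?_⟩, he, hQ₁⟩
  obtain ⟨b, hb, hba, -⟩ := ha.symm
  obtain ⟨W, -, hW⟩ := ha.restrict (supCent_le (T := T) hQ₂.le_left)
  have hWeq : W = supCent T Q₂ := by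
    refine hW.eq_of_le (hW.le_supCent le_supCent le_rfl hQ₂) (supCent_le hQ₂.le_right) ?_
    refine (isFN_of_aut H.pgroup ha hQ₂ hQ.1).card_supCent_le
      (hQ₂.symm_of fun x hx => hba x (hQ₂.le_left hx))
  exact isFN_of_aut H.pgroup ha (hWeq ▸ hW) hQ.2

end PPrimePair

end FusionSystem

/-! ### Stabilizers and pointwise stabilizers of subgroups. -/

namespace FusionSystem

variable {G : Type*} [Group G] {T : Subgroup G} {E E₁ : FusionSystem T}
  {P Q R X W P' Q' R' N N' M : Subgroup G} {f g h k a b e : G → G} {p m : ℕ}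

theorem extFun_mul (α β : MulAut P) (x : G) : extFun (α * β) x = extFun α (extFun β x) := by
  by_cases hx : x ∈ P
  · rw [extFun_of_mem _ hx, extFun_of_mem β hx, extFun_coe, MulAut.mul_apply]
  · simp [extFun, hx]

theorem extFun_one (x : G) : extFun (1 : MulAut P) x = x := by
  by_cases hx : x ∈ P <;> simp [extFun, hx]

theorem extFun_inv_apply (α : MulAut P) (x : G) : extFun α⁻¹ (extFun α x) = x := by
  rw [← extFun_mul, inv_mul_cancel, extFun_one]

theorem extFun_apply_inv (α : MulAut P) (x : G) : extFun α (extFun α⁻¹ x) = x := by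
  rw [← extFun_mul, mul_inv_cancel, extFun_one]

/-- The stabilizer of `Q ≤ P` in `Aut_E(P)`. -/
def stab (E : FusionSystem T) (hP : P ≤ T) (hQ : Q ≤ P) : Subgroup (MulAut P) where
  carrier := {α | α ∈ E.aut hP ∧ E.Iso Q Q (extFun α)}
  one_mem' := ⟨one_mem _, (Iso.id (hQ.trans hP)).congr fun x _ => (extFun_one x).symm⟩
  mul_mem' := fun {α β} hα hβ =>
    ⟨mul_mem hα.1 hβ.1, (hβ.2.comp hα.2).congr fun x _ => (extFun_mul α β x).symm⟩
  inv_mem' := fun {α} hα => ⟨inv_mem hα.1, hα.2.symm_of fun x _ => extFun_inv_apply α x⟩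

/-- The pointwise stabilizer of `Q` in `Aut_E(P)`. -/
def fixer (E : FusionSystem T) (hP : P ≤ T) (Q : Subgroup G) : Subgroup (MulAut P) where
  carrier := {α | α ∈ E.aut hP ∧ ∀ x ∈ Q, extFun α x = x}
  one_mem' := ⟨one_mem _, fun x _ => extFun_one x⟩
  mul_mem' := fun {α β} hα hβ =>
    ⟨mul_mem hα.1 hβ.1, fun x hx => by rw [extFun_mul, hβ.2 x hx, hα.2 x hx]⟩
  inv_mem' := fun {α} hα => ⟨inv_mem hα.1, fun x hx => by
    conv_lhs => rw [← hα.2 x hx]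
    exact extFun_inv_apply α x⟩

theorem fixer_le_stab {hP : P ≤ T} (hQ : Q ≤ P) : fixer E hP Q ≤ stab E hP hQ := fun _ hα =>
  ⟨hα.1, (Iso.id (hQ.trans hP)).congr fun x hx => (hα.2 x hx).symm⟩

theorem conj_mem_fixer {hP : P ≤ T} {hQ : Q ≤ P} {α β : MulAut P} (hα : α ∈ stab E hP hQ)
    (hβ : β ∈ fixer E hP Q) : α * β * α⁻¹ ∈ fixer E hP Q := by
  refine ⟨mul_mem (mul_mem hα.1 hβ.1) (inv_mem hα.1), fun x hx => ?_⟩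
  have h1 : extFun α⁻¹ x ∈ Q := (inv_mem hα).2.mem hx
  rw [extFun_mul, extFun_mul, hβ.2 _ h1, extFun_apply_inv]

/-- The `p`-subgroups of the stabilizer of `Q` can be conjugated in it into `Aut_T(P)`. -/
def StabAutomized (E : FusionSystem T) (p : ℕ) (hP : P ≤ T) (hQ : Q ≤ P) : Prop :=
  ∀ H ≤ stab E hP hQ, IsPGroup p H → ∃ j ∈ stab E hP hQ, ∀ h ∈ H, j * h * j⁻¹ ∈ autS T P

/-- Some `γ` conjugates a Sylow subgroup of the stabilizer of `Q` into `Aut_T(P)`; then `Q' = γ(Q)`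
has the property. -/
theorem IsFN.exists_stabAutomized [Finite T] [Fact p.Prime] (hP : E.IsFN p P) (hQ : Q ≤ P) :
    ∃ γ ∈ E.aut hP.le, ∃ (Q' : Subgroup G) (hQ' : Q' ≤ P), E.Iso Q Q' (extFun γ) ∧
      StabAutomized E p hP.le hQ' := by
  have hfin := finite_mulAut hP.le
  obtain ⟨U, hU, -⟩ := exists_isSylowIn (p := p) (bot_le : ⊥ ≤ stab E hP.le hQ) IsPGroup.of_bot
  obtain ⟨γ, hγ, hc⟩ := hP.automized.exists_conj (fun x hx => (hU.1 hx).1) hU.2.1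
  obtain ⟨Q', hQ', hγQ⟩ := (iso_of_mem_aut hγ).restrict hQ
  have hγQ' : E.Iso Q' Q (extFun γ⁻¹) := hγQ.symm_of fun x _ => extFun_inv_apply γ x
  refine ⟨γ, hγ, Q', hQ', hγQ, fun H hH hp => ?_⟩
  obtain ⟨a, ha, hac⟩ := hU.exists_conj (H := conjSubgroup γ⁻¹ H) (fun x hx => by
    obtain ⟨y, hy, rfl⟩ := mem_conjSubgroup.1 hx
    refine ⟨mul_mem (mul_mem (inv_mem hγ) (hH hy).1) (inv_mem (inv_mem hγ)),
      ((hγQ.comp (hH hy).2).comp hγQ').congr fun x _ => ?_⟩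
    rw [inv_inv, extFun_mul, extFun_mul]
    rfl) (hp.conjSubgroup _)
  refine ⟨γ * a * γ⁻¹, ⟨mul_mem (mul_mem hγ ha.1) (inv_mem hγ),
    ((hγQ'.comp ha.2).comp hγQ).congr fun x _ => ?_⟩, fun h hh => ?_⟩
  · rw [extFun_mul, extFun_mul]
    rfl
  · have := hc _ (hac _ (mem_conjSubgroup.2 ⟨h, hh, rfl⟩))
    simpa [mul_assoc] using this

/-- A version of `exists_extend` for the pair `P' ≤ P`: the correcting automorphism is taken in the
stabilizer of `Q`, so that the image of `P'` is still `Q`. -/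
theorem IsFN.exists_extend_stab [Finite T] [Fact p.Prime] (hT : IsPGroup p T) (hR : E.IsFN p R)
    {hQ : Q ≤ R} (hS : StabAutomized E p hR.le hQ) (h : E.Iso P R f) (hP : P' ≤ P)
    (h' : E.Iso P' Q f) :
    ∃ f' M, E.Iso (nz T P ⊓ nz T P') M f' ∧ E.Iso P R f' ∧ E.Iso P' Q f' := by
  obtain ⟨φ, hφ, hφf⟩ := id h
  let K : Subgroup (MulAut P) := autS T P ⊓ stab E h.le_left hP
  obtain ⟨j, hj, hjc⟩ := hS (K.map (MulAut.congr φ).toMonoidHom) (by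
    rintro _ ⟨α, hα, rfl⟩
    refine ⟨congr_mem_aut hφ h.le_left hR.le hα.2.1, ?_⟩
    obtain ⟨g, hg, hgf, -⟩ := h'.symm
    refine ((hg.comp hα.2.2).comp h').congr fun y hy => ?_
    obtain ⟨x, hx, rfl⟩ := h'.surj hy
    have h1 : f x = φ ⟨x, hP hx⟩ := (hφf ⟨x, hP hx⟩).symm
    have h2 : extFun ((MulAut.congr φ).toMonoidHom α) (f x) = φ (α ⟨x, hP hx⟩) := by
      rw [h1, extFun_coe]
      exact congrArg Subtype.val (congr_apply φ α _)
    simp only [Function.comp_apply]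
    rw [h2, hgf x hx, hφf, extFun_of_mem α (hP hx)])
    (((isPGroup_autS hT P).to_le inf_le_left).map _)
  have hjR : E.Iso R R (extFun j) := iso_of_mem_aut hj.1
  obtain ⟨N, N', f', hf', hext, hPN, hN, hmem⟩ := hR.receptive.extend (h.comp hjR)
  have hle : nz T P ⊓ nz T P' ≤ N := fun t ht => by
    refine hmem t ht.1.1 (fun x hx => conj_mem_of_mem_nz ht.1 hx) ?_
    have h1 : P.normalizerMonoidHom ⟨t, ht.1.2⟩ ∈ K := by
      refine ⟨mem_autS.2 ⟨t, ht.1, fun x => rfl⟩,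
        mem_aut_of_iso (Iso.conj_self h.le_left ht.1.1 ht.1.2) fun x => rfl,
        (Iso.conj_self (hP.trans h.le_left) ht.2.1 ht.2.2).congr fun x hx => ?_⟩
      rw [extFun_of_mem _ (hP hx)]
      rfl
    obtain ⟨s, hs, hsx⟩ := mem_autS.1 (hjc _ ⟨_, h1, rfl⟩)
    refine ⟨s, hs.1, fun x hx => ?_⟩
    have h2 := hsx (j (φ ⟨x, hx⟩))
    have h3 : ((MulAut.congr φ).toMonoidHom (P.normalizerMonoidHom ⟨t, ht.1.2⟩)) (φ ⟨x, hx⟩) =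
        φ ⟨_, conj_mem_of_mem_nz ht.1 hx⟩ := congr_apply φ _ _
    simp only [MulAut.mul_apply, MulAut.inv_apply_self, h3] at h2
    simpa [← hφf ⟨x, hx⟩, ← hφf ⟨_, conj_mem_of_mem_nz ht.1 hx⟩, extFun_coe] using h2
  obtain ⟨L, -, hL⟩ := hf'.restrict hle
  exact ⟨f', L, hL, (h.comp hjR).congr fun x hx => (hext x hx).symm,
    (h'.comp hj.2).congr fun x hx => (hext x (hP hx)).symm⟩

/-- The restriction of `f` to `P` extends to `P C_T(P)`. -/
def ExtendsCent (E : FusionSystem T) (P : Subgroup G) (f : G → G) : Prop :=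
  ∃ χ W, E.Iso (supCent T P) W χ ∧ ∀ x ∈ P, χ x = f x

theorem ExtendsCent.congr (h : ExtendsCent E P f) (hfg : ∀ x ∈ P, f x = g x) :
    ExtendsCent E P g := by
  obtain ⟨χ, W, h1, h2⟩ := h
  exact ⟨χ, W, h1, fun x hx => (h2 x hx).trans (hfg x hx)⟩

theorem ExtendsCent.comp (h : ExtendsCent E P f) (hf : E.Iso P Q f) (h' : ExtendsCent E Q g) :
    ExtendsCent E P (g ∘ f) := by
  obtain ⟨χ, W, h1, h2⟩ := h
  obtain ⟨χ', W', h3, h4⟩ := h'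
  have hPQ := hf.congr fun x hx => (h2 x hx).symm
  obtain ⟨W'', -, h5⟩ := h1.comp_restrict h3 (h1.le_supCent le_supCent le_rfl hPQ)
  exact ⟨_, W'', h5, fun x hx => by simp only [Function.comp_apply]; rw [h2 x hx, h4 _ (hf.mem hx)]⟩

theorem supCent_eq_of_iso [Finite T] (hP : E.IsFN p P) (h : E.Iso (supCent T P) W f)
    (h' : E.Iso P Q f) : W = supCent T Q := by
  obtain ⟨g, hg, -, -⟩ := h'.symm
  exact h.eq_of_le (h.le_supCent le_supCent le_rfl h') (supCent_le h'.le_right)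
    (hP.card_supCent_le hg)

theorem IsFN.extend_fixer [Finite T] (hR : E.IsFN p R) (hQ : Q ≤ R) {n : MulAut R}
    (hn : n ∈ E.aut hR.le)
    (hc : ∀ c ∈ fixer E hR.le Q ⊓ autS T R, n * c * n⁻¹ ∈ autS T R) :
    ∃ n' M, E.Iso (R ⊔ (nz T R ⊓ Subgroup.centralizer (Q : Set G))) M n' ∧
      ∀ x ∈ R, n' x = extFun n x := by
  obtain ⟨N, N', n', hn', hext, hRN, hN, hmem⟩ := hR.receptive.extend (iso_of_mem_aut hn)
  have hle : R ⊔ (nz T R ⊓ Subgroup.centralizer (Q : Set G)) ≤ N := by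
    refine sup_le hRN fun d hd => hmem d hd.1.1 (fun x hx => conj_mem_of_mem_nz hd.1 hx) ?_
    have hdQ : d ∈ T ⊓ Subgroup.centralizer (Q : Set G) := ⟨hd.1.1, hd.2⟩
    have h1 : R.normalizerMonoidHom ⟨d, hd.1.2⟩ ∈ fixer E hR.le Q ⊓ autS T R :=
      ⟨⟨mem_aut_of_iso (Iso.conj_self hR.le hd.1.1 hd.1.2) fun x => rfl, fun x hx => by
        rw [extFun_of_mem _ (hQ hx)]
        exact conj_of_mem_centralizer hdQ hx⟩, mem_autS.2 ⟨d, hd.1, fun x => rfl⟩⟩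
    obtain ⟨s, hs, hsx⟩ := mem_autS.1 (hc _ h1)
    refine ⟨s, hs.1, fun x hx => ?_⟩
    have h2 := hsx (n ⟨x, hx⟩)
    have h3 : R.normalizerMonoidHom ⟨d, hd.1.2⟩ ⟨x, hx⟩ = ⟨_, conj_mem_of_mem_nz hd.1 hx⟩ := rfl
    simp only [MulAut.mul_apply, MulAut.inv_apply_self, h3] at h2
    rw [extFun_of_mem n hx, extFun_of_mem n (conj_mem_of_mem_nz hd.1 hx)]
    exact h2
  obtain ⟨M, -, hM⟩ := hn'.restrict hle
  exact ⟨n', M, hM, hext⟩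

/-- `R` normalizes `C_T(P)`, so `C_T(P) R` is a `p`-group in which the normalizer of `R` is larger
than `R`. An element `cr` of it outside `R` yields `c`. -/
theorem exists_centralizer_notMem [Finite T] [Fact p.Prime] (hT : IsPGroup p T) (hPR : P ≤ R)
    (hR : R ≤ nz T P) (hC : ¬ T ⊓ Subgroup.centralizer (P : Set G) ≤ R) :
    ∃ c ∈ nz T R ⊓ nz T P, c ∈ T ⊓ Subgroup.centralizer (P : Set G) ∧ c ∉ R := by
  have hRT : R ≤ T := hR.trans nz_le
  have hPT : P ≤ T := hPR.trans hRT
  set C := T ⊓ Subgroup.centralizer (P : Set G) with hCdef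
  have hY : C ⊔ R ≤ T := sup_le inf_le_left hRT
  have hYf := finite_of_le hY
  have hlt : R < C ⊔ R := lt_of_le_of_ne le_sup_right fun h => hC (h ▸ le_sup_left)
  obtain ⟨y, hy, hyR, hyn⟩ := exists_mem_normalizer_of_lt (hT.to_le hY) hlt
  obtain ⟨c, hc, r, hr, rfl⟩ := (mem_sup_of_conj_mem fun r hr c hc => by
    refine mem_centralizer_of_conj (mul_mem (mul_mem (hRT hr) hc.1) (inv_mem (hRT hr)))
      fun x hx => ?_
    have h2 : r⁻¹ * x * r ∈ P := by simpa using conj_mem_of_mem_nz (inv_mem (hR hr)) hx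
    calc r * c * r⁻¹ * x * (r * c * r⁻¹)⁻¹ = r * (c * (r⁻¹ * x * r) * c⁻¹) * r⁻¹ := by group
      _ = x := by rw [conj_of_mem_centralizer hc h2]; group).1 hy
  have hcR : c ∉ R := fun h => hyR (mul_mem h hr)
  refine ⟨c, ⟨mem_nz hRT hc.1 fun x hx => ?_, mem_nz hPT hc.1 fun x hx => by
    rwa [conj_of_mem_centralizer hc hx]⟩, hc, hcR⟩
  have h1 := hyn (r⁻¹ * x * r) (mul_mem (mul_mem (inv_mem hr) hx) hr)
  convert h1 using 1
  group

end FusionSystem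

/-! ### Extension of morphisms of `E₁` to `P C_T(P)` for non-centric `P`. -/

namespace FusionSystem

variable {G : Type*} [Group G] {T : Subgroup G} {E E₁ : FusionSystem T}
  {P Q R X W P' Q' R' N N' M : Subgroup G} {f g h k a b e ξ : G → G} {p m : ℕ}

namespace PPrimePair

variable [Finite T] [Fact p.Prime] (H : PPrimePair p E E₁)
include H

/-- Descending induction on `|R|`. If `C_T(Q)` is not in `R`, send `R` and `R'` by `τ` and `τ₂` to
the same subgroup `A`, where `Q` and `Q'` both go to `B`. On `Q`, `ξ` equals `τ₂⁻¹ n τ` for a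
suitable automorphism `n` of `A`, and each of the three factors, restricted to the relevant
subgroup, extends to a group of order larger than `|R|`. -/
theorem extendsCent_of_lt_nz (hI : ∀ R : Subgroup G, m < Nat.card R → E.IsDFN p R → E₁.IsFN p R)
    (hξ : E₁.Iso R R' ξ) (hξQ : E₁.Iso Q Q' ξ) (hQR : Q < R) (hR : R ≤ nz T Q)
    (hQ' : E.IsFN p Q') (hm : Nat.card Q = m) : ExtendsCent E₁ Q ξ := by
  induction hn : Nat.card T - Nat.card R using Nat.strong_induction_on
    generalizing R R' Q Q' ξ with
  | _ n ih =>
    subst hn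
    have hRT : R ≤ T := hξ.le_left
    by_cases hC : T ⊓ Subgroup.centralizer (Q : Set G) ≤ R
    · obtain ⟨W, -, hW⟩ := hξ.restrict (sup_le hQR.le hC)
      exact ⟨ξ, W, hW, fun _ _ => rfl⟩
    have step : ∀ {R₂ R₂' Q₂ Q₂' : Subgroup G} {ζ : G → G}, E₁.Iso R₂ R₂' ζ → E₁.Iso Q₂ Q₂' ζ →
        Q₂ < R₂ → R₂ ≤ nz T Q₂ → E.IsFN p Q₂' → Nat.card Q₂ = m → Nat.card R < Nat.card R₂ →
        ExtendsCent E₁ Q₂ ζ := by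
      intro R₂ R₂' Q₂ Q₂' ζ h1 h2 h3 h4 h5 h6 h7
      have h8 := Subgroup.card_le_of_le (h4.trans nz_le)
      exact ih _ (by omega) h1 h2 h3 h4 h5 h6 rfl
    obtain ⟨c, hc, hcQ, hcR⟩ := exists_centralizer_notMem H.pgroup hQR.le hR hC
    obtain ⟨A, τ₀, _, hA, -, hτ₀⟩ := H.exists_isDFN hRT
    have hmR : m < Nat.card R := hm ▸ card_lt_of_lt hRT hQR
    have hA₁ : E₁.IsFN p A := hI A (hτ₀.card_eq ▸ hmR) hA
    obtain ⟨B₀, hB₀, hτ₀Q⟩ := hτ₀.restrict hQR.le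
    obtain ⟨γ, hγ, B, hB, hγB, hBs⟩ := hA₁.exists_stabAutomized hB₀
    have hσ := hτ₀.comp (iso_of_mem_aut hγ)
    have hσQ := hτ₀Q.comp hγB
    obtain ⟨τ, M₁, hτ, hτA, hτB⟩ := hA₁.exists_extend_stab H.pgroup hBs hσ hQR.le hσQ
    obtain ⟨ξ', hξ', hξξ, hξξ'⟩ := hξ.symm
    have hξQ' : E₁.Iso Q' Q ξ' := hξQ.symm_of fun x hx => hξξ x (hQR.le hx)
    have hQR' : Q' ≤ R' := hξ.le_of_le hξQ hQR.le
    obtain ⟨τ₂, M₂, hτ₂, hτ₂A, hτ₂B⟩ := hA₁.exists_extend_stab H.pgroup hBs (hξ'.comp hσ) hQR'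
      (hξQ'.comp hσQ)
    obtain ⟨τ', hτ', hττ, hττ'⟩ := hτA.symm
    have hτB' : E₁.Iso B Q τ' := hτB.symm_of fun x hx => hττ x (hQR.le hx)
    obtain ⟨j, hj, hjx⟩ := ((hτ'.comp hξ).comp hτ₂A).exists_mulAut hA₁.le
    have hjs : j ∈ stab E₁ hA₁.le hB := ⟨hj, ((hτB'.comp hξQ).comp hτ₂B).congr fun x hx => by
      rw [extFun_of_mem j (hB hx), hjx]⟩
    have hfin := finite_mulAut hA₁.le
    -- The correction `u` fixes `B` pointwise, so `uj` agrees with `j` on `B`. It is chosen so that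
    -- `uj` extends to `A (N_T(A) ∩ C_T(B))`, which contains `τ c ∉ A`.
    obtain ⟨u, hu, huc⟩ := exists_conj_of_normal (p := p) (fixer_le_stab hB)
      (fun α hα β hβ => conj_mem_fixer hα hβ) hBs (isPGroup_autS H.pgroup A)
      (H := conjSubgroup j (fixer E₁ hA₁.le B ⊓ autS T A)) (fun x hx => by
        obtain ⟨y, hy, rfl⟩ := mem_conjSubgroup.1 hx
        exact conj_mem_fixer hjs hy.1)
      (((isPGroup_autS H.pgroup A).to_le inf_le_right).conjSubgroup j)
    obtain ⟨n, D, hn, hnx⟩ := hA₁.extend_fixer hB (mul_mem hu.1 hj) fun c hc => by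
      have := huc _ (mem_conjSubgroup.2 ⟨c, hc, rfl⟩)
      simpa [mul_assoc] using this
    have hnB : ∀ y ∈ B, n y = τ₂ (ξ (τ' y)) := fun y hy => by
      have h1 : extFun j y = τ₂ (ξ (τ' y)) := by rw [extFun_of_mem j (hB hy), hjx]; rfl
      rw [hnx y (hB hy), extFun_mul, h1]
      exact hu.2 _ (((hτB'.comp hξQ).comp hτ₂B).mem hy)
    have hnBB : E₁.Iso B B n := ((hτB'.comp hξQ).comp hτ₂B).congr fun y hy => (hnB y hy).symm
    -- The induction hypothesis needs fully normalized targets, so `B` is replaced by `Q₃` between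
    -- consecutive factors.
    obtain ⟨Q₃, ρ, L, hQ₃, hρL, hρ⟩ := H.exists_isDFN (hB.trans hA₁.le)
    obtain ⟨ρ', hρ', hρρ, hρρ'⟩ := hρL.symm
    have hBT : B ≤ T := hB.trans hA₁.le
    have hBn := le_nz hBT
    have hAB : A ≤ nz T B := hτA.le_nz hR hQR.le hτB
    have hRN : R ≤ nz T R ⊓ nz T Q := le_inf (le_nz hRT) hR
    have hcard : Nat.card R < Nat.card (nz T R ⊓ nz T Q : Subgroup G) :=
      card_lt_of_lt (inf_le_left.trans nz_le) (lt_of_le_of_ne hRN fun h => hcR (h ▸ hc))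
    have hQ₃m : Nat.card Q₃ = m := by rw [← hρ.card_eq, ← hτB.card_eq, hm]
    -- the first factor
    have e₁ : ExtendsCent E₁ Q (ρ ∘ τ) := by
      obtain ⟨L₁, -, h1⟩ := hτ.comp_restrict hρL (hτ.le_nz inf_le_right (hQR.le.trans hRN) hτB)
      exact step h1 (hτB.comp hρ) (hQR.trans_le hRN) inf_le_right hQ₃.1 hm hcard
    -- the second factor
    have hρ'B : E₁.Iso Q₃ B ρ' := hρ.symm_of fun x hx => hρρ x (hBn hx)
    have e₂ : ExtendsCent E₁ Q₃ (ρ ∘ n ∘ ρ') := by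
      set V := A ⊔ (nz T A ⊓ Subgroup.centralizer (B : Set G)) with hV
      have hVB : V ≤ nz T B := sup_le hAB fun d hd => supCent_le_nz hBT
        (centralizer_le_supCent ⟨hd.1.1, hd.2⟩)
      obtain ⟨V', hV'L, hρV⟩ := hρL.restrict hVB
      have hρ'V : E₁.Iso V' V ρ' := hρV.symm_of fun x hx => hρρ x (hVB hx)
      have hBV : B ≤ V := hB.trans le_sup_left
      obtain ⟨V'', -, h1⟩ := (hρ'V.comp hn).comp_restrict hρL (hn.le_nz hVB hBV hnBB)
      have hτc : τ c ∈ V := Subgroup.mem_sup_right ⟨hτ.le_nz inf_le_left hRN hτA (hτ.mem hc),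
        (hτ.mem_centralizer (hQR.le.trans hRN) hτB hc hcQ).2⟩
      have hτcA : τ c ∉ A := fun h => by
        obtain ⟨r, hr, hrc⟩ := hτA.surj h
        exact hcR (hτ.inj (hRN hr) hc hrc ▸ hr)
      have hcV : Nat.card R < Nat.card V := by
        rw [hτA.card_eq]
        exact card_lt_of_lt hn.le_left (lt_of_le_of_ne le_sup_left fun h => hτcA (h ▸ hτc))
      refine step h1 ((hρ'B.comp hnBB).comp hρ) (lt_of_le_of_ne (hρV.le_of_le hρ hBV) ?_)
        (hρV.le_nz hVB hBV hρ) hQ₃.1 hQ₃m (hρV.card_eq ▸ hcV)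
      rintro rfl
      rw [← hρV.card_eq] at hQ₃m
      omega
    -- the third factor
    have hR'n : R' ≤ nz T Q' := hξ.le_nz hR hQR.le hξQ
    have hR'N : R' ≤ nz T R' ⊓ nz T Q' := le_inf (le_nz hξ.le_right) hR'n
    obtain ⟨τ₂', hτ₂', hτt, hτt'⟩ := hτ₂.symm
    have hQ'N := hQR'.trans hR'N
    have hτ₂'B : E₁.Iso B Q' τ₂' := hτ₂B.symm_of fun x hx => hτt x (hQ'N hx)
    have e₃ : ExtendsCent E₁ Q₃ (τ₂' ∘ ρ') := by
      have hM₂ := hτ₂.le_nz inf_le_right hQ'N hτ₂B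
      obtain ⟨Y, hYL, hρY⟩ := hρL.restrict hM₂
      have hρ'Y : E₁.Iso Y M₂ ρ' := hρY.symm_of fun x hx => hρρ x (hM₂ hx)
      have hBM : B ≤ M₂ := hτ₂.le_of_le hτ₂B hQ'N
      have hc2 : Nat.card R < Nat.card Y := by
        rw [← hρY.card_eq, ← hτ₂.card_eq, hξ.card_eq]
        have h1 : Nat.card (nz T R ⊓ nz T Q : Subgroup G) ≤ Nat.card (nz T Q) := by
          have := finite_of_le (nz_le (S := T) (P := Q))
          exact Subgroup.card_le_of_le inf_le_right
        have h2 := hQ'.card_nz_le H.pgroup (hξQ.mono H.sub)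
        -- Equality would give `|N_T(Q')| = |R| < |N_T(R) ∩ N_T(Q)| ≤ |N_T(Q)|`, against the
        -- maximality of `|N_T(Q')|`.
        have h3 : R' < nz T Q' := lt_of_le_of_ne hR'n fun h => by
          rw [← h, ← hξ.card_eq] at h2
          omega
        have := finite_of_le (nz_le (S := T) (P := Q'))
        obtain ⟨x, hx, hxR, hxn⟩ := exists_mem_normalizer_of_lt (H.pgroup.to_le nz_le) h3
        refine card_lt_of_lt (inf_le_left.trans nz_le) (lt_of_le_of_ne hR'N fun h => hxR ?_)
        rw [h]
        exact ⟨mem_nz hξ.le_right hx.1 hxn, hx⟩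
      refine step (hρ'Y.comp hτ₂') (hρ'B.comp hτ₂'B) (lt_of_le_of_ne (hρY.le_of_le hρ hBM) ?_)
        (hρY.le_nz hM₂ hBM hρ) hQ' hQ₃m hc2
      rintro rfl
      omega
    refine ((e₁.comp (hτB.comp hρ) e₂).comp ((hτB.comp hρ).comp ((hρ'B.comp hnBB).comp hρ))
      e₃).congr fun x hx => ?_
    have hτx := hτB.mem hx
    have h1 := hnBB.mem hτx
    simp only [Function.comp_apply]
    rw [hρρ _ (hBn hτx), hρρ _ (hBn h1), hnB _ hτx, hττ x (hQR.le hx), hτt _ (hQ'N (hξQ.mem hx))]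

/-- `E₁` is generated by restrictions of isomorphisms between centric subgroups `R`. A non-centric
`P ≤ R` is proper, so each generator is defined on `R ∩ N_T(P) > P`, where `extendsCent_of_lt_nz`
applies. -/
theorem extendsCent_of_iso (hI : ∀ R : Subgroup G, m < Nat.card R → E.IsDFN p R → E₁.IsFN p R)
    (hf : E₁.Iso P Q f) (hm : Nat.card P = m) (hc : ¬ E.IsCentric P)
    (hP : E.IsFN p P) (hQ : E.IsFN p Q) : ExtendsCent E₁ P f := by
  -- Intermediate subgroups of a composite need not be fully normalized. The predicate therefore
  -- concerns the transport of `f` by maps `ρ`, `ρ'` with fully normalized targets; their definition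
  -- on normalizers preserves the extension to `R ∩ N_T(P)`.
  have key := H.generated (fun P Q f => Nat.card P = m → ¬ E.IsCentric P →
    ∀ ρ ρ' M M' X X' k, E₁.Iso (nz T P) M ρ → E₁.Iso P X ρ → E.IsFN p X →
      E₁.Iso (nz T Q) M' ρ' → E₁.Iso Q X' ρ' → E.IsFN p X' → (∀ x ∈ P, k (ρ x) = ρ' (f x)) →
      E₁.Iso P Q f → ExtendsCent E₁ X k) ?_ ?_ ?_ P Q f hf hm hc id id _ _ P Q f
    (Iso.id nz_le) (Iso.id hP.le) hP (Iso.id nz_le) (Iso.id hQ.le) hQ (fun _ _ => rfl) hf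
  · exact key
  · intro P Q R R' f hR hf hPR hPQ hm hc ρ ρ' M M' X X' k hρ hρX hX hρ' hρ'X hX' hk _
    have hlt : P < R := lt_of_le_of_ne hPR fun h => hc (h ▸ hR)
    have := finite_of_le hR.1
    obtain ⟨y, hy, hyP, hyn⟩ := exists_mem_normalizer_of_lt (H.pgroup.to_le hR.1) hlt
    have hPT := hPR.trans hR.1
    have hPA : P ≤ R ⊓ nz T P := le_inf hPR (le_nz hPT)
    have hltA : P < R ⊓ nz T P := lt_of_le_of_ne hPA fun h =>
      hyP (h.symm ▸ (⟨hy, mem_nz hPT (hR.1 hy) hyn⟩ : y ∈ R ⊓ nz T P))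
    obtain ⟨A, -, hA⟩ := hf.restrict (inf_le_left : R ⊓ nz T P ≤ R)
    obtain ⟨A', -, hA'⟩ := hρ.restrict (inf_le_right : R ⊓ nz T P ≤ nz T P)
    obtain ⟨σ, hσ, hσρ, -⟩ := hA'.symm
    obtain ⟨B, -, hB⟩ := (hσ.comp hA).comp_restrict hρ' (hA.le_nz inf_le_right hPA hPQ)
    have hσX : E₁.Iso X P σ := hρX.symm_of fun x hx => hσρ x (hPA hx)
    refine (H.extendsCent_of_lt_nz hI hB ((hσX.comp hPQ).comp hρ'X)
      (lt_of_le_of_ne (hA'.le_of_le hρX hPA) ?_) (hA'.le_nz inf_le_right hPA hρX) hX'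
      (by rw [← hρX.card_eq, hm])).congr fun y hy => ?_
    · rintro rfl
      have h1 := card_lt_of_lt (inf_le_right.trans nz_le) hltA
      rw [hA'.card_eq, ← hρX.card_eq] at h1
      exact lt_irrefl _ h1
    · obtain ⟨x, hx, rfl⟩ := hρX.surj hy
      simp only [Function.comp_apply]
      rw [hσρ x (hPA hx), hk x hx]
  · intro P Q R f g hf hg ihf ihg hm hc ρ ρ' M M' X X' k hρ hρX hX hρ' hρ'X hX' hk _
    obtain ⟨Y, σ, L, hY, hσL, hσ⟩ := H.exists_isDFN hf.le_right
    obtain ⟨ρi, hρi, hρρ, -⟩ := hρX.symm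
    obtain ⟨σi, hσi, hσσ, -⟩ := hσ.symm
    have e₁ := ihf hm hc ρ σ M L X Y (σ ∘ f ∘ ρi) hρ hρX hX hσL hσ hY.1
      (fun x hx => by simp only [Function.comp_apply]; rw [hρρ x hx]) hf
    have e₂ := ihg (hf.card_eq ▸ hm) (fun h => hc (h.of_iso (hf.mono H.sub |>.symm.choose_spec.1)))
      σ ρ' L M' Y X' (ρ' ∘ g ∘ σi) hσL hσ hY.1 hρ' hρ'X hX'
      (fun x hx => by simp only [Function.comp_apply]; rw [hσσ x hx]) hg
    refine (e₁.comp ((hρi.comp hf).comp hσ) e₂).congr fun y hy => ?_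
    obtain ⟨x, hx, rfl⟩ := hρX.surj hy
    simp only [Function.comp_apply]
    rw [hρρ x hx, hσσ _ (hf.mem hx), hk x hx]
    rfl
  · intro P Q f g ih hfg hm hc ρ ρ' M M' X X' k hρ hρX hX hρ' hρ'X hX' hk hg
    exact ih hm hc ρ ρ' M M' X X' k hρ hρX hX hρ' hρ'X hX' (fun x hx => by rw [hk x hx, hfg x hx])
      (hg.congr fun x hx => (hfg x hx).symm)

end PPrimePair

end FusionSystem

/-! ### Receptivity and saturation of `E₁`. -/

namespace FusionSystem

variable {G : Type*} [Group G] {T : Subgroup G} {E E₁ : FusionSystem T}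
  {P Q R X W P' Q' R' N N' M : Subgroup G} {f g h k a b e ξ : G → G} {p m : ℕ}

/-- Some `γ` turns `κ` into conjugation by `t ∈ T`. As this fixes `X = γ(Q)` pointwise, `t` lies in
`C_T(X) ≤ X C_T(X) = Q C_T(Q)`, so `γ⁻¹(t)` induces `κ`. -/
theorem IsFN.mem_autS_of_fixer [Finite T] [Fact p.Prime] (hQ : E.IsFN p Q)
    (hV : E.IsFN p (supCent T Q)) {K : Subgroup (MulAut (supCent T Q))}
    (hK : K ≤ fixer E hV.le Q) (hKp : IsPGroup p K) {κ : MulAut (supCent T Q)} (hκ : κ ∈ K) :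
    ∃ t ∈ supCent T Q, ∀ x : supCent T Q, (κ x : G) = t * x * t⁻¹ := by
  obtain ⟨γ, hγ, hc⟩ := hV.automized.exists_conj (fun x hx => (hK hx).1) hKp
  obtain ⟨t, ht, htx⟩ := mem_autS.1 (hc κ hκ)
  have hγV := iso_of_mem_aut hγ
  obtain ⟨X, hXV, hX⟩ := hγV.restrict (le_supCent (T := T) (P := Q))
  have htX : t ∈ T ⊓ Subgroup.centralizer (X : Set G) := by
    refine mem_centralizer_of_conj ht.1 fun y hy => ?_
    obtain ⟨x, hx, rfl⟩ := hX.surj hy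
    have hxV := le_supCent (T := T) hx
    have h1 := htx (γ ⟨x, hxV⟩)
    have h2 : κ ⟨x, hxV⟩ = ⟨x, hxV⟩ := Subtype.ext <| by
      rw [← extFun_of_mem κ hxV]
      exact (hK hκ).2 x hx
    simp only [MulAut.mul_apply, MulAut.inv_apply_self, h2] at h1
    rw [extFun_of_mem γ hxV, ← h1]
  have hXeq : supCent T Q = supCent T X := supCent_eq_of_iso hQ hγV hX
  obtain ⟨s, hs⟩ := γ.surjective ⟨t, hXeq ▸ centralizer_le_supCent htX⟩
  refine ⟨s, s.2, fun x => ?_⟩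
  have h1 := htx (γ x)
  simp only [MulAut.mul_apply, MulAut.inv_apply_self] at h1
  have h2 : γ (κ x) = γ (s * x * s⁻¹) := Subtype.ext <| by
    rw [h1, map_mul, map_mul, map_inv, hs]
    rfl
  rw [γ.injective h2]
  rfl

namespace PPrimePair

theorem isReceptive_of_isCentric [Finite T] [Fact p.Prime] (H : PPrimePair p E E₁)
    (hQ : E.IsFN p Q) (hc : E.IsCentric Q) : E₁.IsReceptive Q := by
  refine isReceptive_of fun P f N hf hPN hN hs => ?_
  have hfE := hf.mono H.sub
  obtain ⟨g, hg, -, -⟩ := hfE.symm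
  obtain ⟨M, M', f', hf', hext, -, -, hmem⟩ := hQ.receptive.extend hfE
  have hNM : N ≤ M := fun n hn => by
    obtain ⟨s, hs, hsx⟩ := hs n hn
    exact hmem n (hN hn).1 (fun x hx => conj_mem_of_mem_nz (hN hn) hx) ⟨s, hs.1, hsx⟩
  obtain ⟨N', -, hN'⟩ := hf'.restrict hNM
  exact ⟨N', f', H.lift (hc.of_iso hg) hPN hN (hf.congr fun x hx => (hext x hx).symm)
    (H.decomp hN'), hext⟩

variable [Finite T] [Fact p.Prime] (H : PPrimePair p E E₁)
include H

/-- For non-centric `Q`, a map `k : R₀ → Q` has an extension `χ` in `E₁` to `R₀ C_T(R₀)` and an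
extension `α` in `E` to the largest possible domain. They differ on `V = Q C_T(Q)` by some `y` that
fixes `Q`. After a correction `z` in `E₁` that also fixes `Q`, `zy` extends to some `n` on the image
of `α`, and `nα` is in `E₁` by `lift` from the centric subgroup `R₀ C_T(R₀)`. -/
theorem isReceptive_of_isDFN (hI : ∀ R : Subgroup G, Nat.card Q < Nat.card R → E.IsDFN p R → E₁.IsFN p R)
    (hQ : E.IsDFN p Q) : E₁.IsReceptive Q := by
  by_cases hc : E.IsCentric Q
  · exact H.isReceptive_of_isCentric hQ.1 hc
  have hQT := hQ.1.le
  refine isReceptive_of fun R f N hf hRN hN hs => ?_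
  obtain ⟨R₀, ρ, L, hR₀, hρL, hρ⟩ := H.exists_isDFN hf.le_left
  obtain ⟨ρ', hρ', hρρ, hρρ'⟩ := hρL.symm
  have hRn := le_nz hf.le_left
  have hρ'R : E₁.Iso R₀ R ρ' := hρ.symm_of fun x hx => hρρ x (hRn hx)
  have hk := hρ'R.comp hf
  obtain ⟨χ, W, hχ, hχk⟩ := H.extendsCent_of_iso hI hk
    (by rw [← hρ.card_eq, hf.card_eq]) (fun h => hc (h.of_iso (hk.mono H.sub))) hR₀.1 hQ.1
  have hχQ : E₁.Iso R₀ Q χ := hk.congr fun x hx => (hχk x hx).symm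
  have hW : W = supCent T Q := supCent_eq_of_iso hR₀.1 (hχ.mono H.sub) (hχQ.mono H.sub)
  subst hW
  set V := supCent T Q with hVdef
  have hVT : V ≤ T := supCent_le hQT
  -- extend to the maximal domain in `E`
  obtain ⟨A, A', α, hα, hαk, hRA, hA, hmem⟩ := hQ.1.receptive.extend (hk.mono H.sub)
  have hαQ : E.Iso R₀ Q α := (hk.mono H.sub).congr fun x hx => (hαk x hx).symm
  have hVA : supCent T R₀ ≤ A := sup_le hRA fun c hc => hmem c hc.1
    (fun x hx => by rwa [conj_of_mem_centralizer hc hx])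
    ⟨1, T.one_mem, fun x hx => by rw [conj_of_mem_centralizer hc hx]; simp⟩
  obtain ⟨N₀, hN₀L, hρN⟩ := hρL.restrict hN
  have hNA : N₀ ≤ A := fun n hn => by
    obtain ⟨ν, hν, rfl⟩ := hρN.surj hn
    obtain ⟨s, hs, hsx⟩ := hs ν hν
    have h1 := hρN.le_nz hN hRN hρ (hρN.mem hν)
    refine hmem _ h1.1 (fun x hx => conj_mem_of_mem_nz h1 hx) ⟨s, hs.1, fun y hy => ?_⟩
    obtain ⟨x, hx, rfl⟩ := hρ.surj hy
    simp only [Function.comp_apply]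
    rw [← hρN.map_conj hν (hRN hx), hρρ _ (hRn (conj_mem_of_mem_nz (hN hν) hx)),
      hρρ x (hRn hx), hsx x hx]
  obtain ⟨V', hV'A, hαV⟩ := hα.restrict hVA
  have hV' : V' = V := supCent_eq_of_iso hR₀.1 hαV hαQ
  subst hV'
  have hA' : A' ≤ nz T Q := hα.le_nz hA hRA hαQ
  have hA'V : A' ≤ nz T V := hA'.trans (nz_le_nz_supCent hQT)
  -- the difference of the two extensions
  obtain ⟨α', hα', hαα, hαα'⟩ := hαV.symm
  obtain ⟨y, hy, hyx⟩ := (hα'.comp (hχ.mono H.sub)).exists_mulAut hVT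
  have hyα : ∀ x ∈ supCent T R₀, extFun y (α x) = χ x := fun x hx => by
    rw [extFun_of_mem y (hαV.mem hx), hyx]
    simp only [Function.comp_apply]
    rw [hαα x hx]
  have hyQ : ∀ x ∈ Q, extFun y x = x := fun x hx => by
    obtain ⟨z, hz, rfl⟩ := hαQ.surj hx
    rw [hyα z (le_supCent hz), hχk z hz, hαk z hz]
  have hyF : y ∈ fixer E hVT Q := ⟨hy, hyQ⟩
  have hmemA : ∀ {β : MulAut V}, β ∈ autS A' V ↔ ∃ s ∈ A', ∀ x : V, (β x : G) = s * x * s⁻¹ := by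
    intro β
    rw [mem_autS]
    exact ⟨fun ⟨s, hs, h⟩ => ⟨s, hs.1, h⟩, fun ⟨s, hs, h⟩ => ⟨s, ⟨hs, (hA'V hs).2⟩, h⟩⟩
  have hstab : autS A' V ≤ stab E₁ hVT le_supCent := fun β hβ => by
    obtain ⟨s, hs, hsx⟩ := hmemA.1 hβ
    refine ⟨mem_aut_of_iso (Iso.conj_self hVT (hA'V hs).1 (hA'V hs).2) hsx,
      (Iso.conj_self hQT (hA' hs).1 (hA' hs).2).congr fun x hx => ?_⟩
    rw [extFun_of_mem β (le_supCent hx), hsx]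
  have hfin := finite_mulAut hVT
  -- The `p`-subgroups of the pointwise stabilizer of `Q` are induced by `V ≤ A'`, and `y u y⁻¹ u⁻¹`
  -- lies in that stabilizer within `E₁`. So `y Aut_{A'}(V) y⁻¹` can be moved back into
  -- `Aut_{A'}(V)` by some `z` in it.
  obtain ⟨z, hz, hzc⟩ := exists_conj_of_le_sup (p := p) (Z := fixer E₁ hVT Q) (U := autS A' V)
    (H := conjSubgroup y (autS A' V)) (isPGroup_autS (H.pgroup.to_le hα.le_right) V)
    (fun u hu β hβ => conj_mem_fixer (hstab hu) hβ) (fun K hK hp κ hκ => by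
      have hle : fixer E₁ hVT Q ≤ fixer E hVT Q := fun x hx =>
        ⟨mem_aut_iff.2 ((iso_of_mem_aut hx.1).mono H.sub), hx.2⟩
      obtain ⟨t, ht, htx⟩ := hQ.1.mem_autS_of_fixer hQ.2 (hK.trans hle) hp hκ
      exact hmemA.2 ⟨t, hV'A ht, htx⟩)
    ((isPGroup_autS (H.pgroup.to_le hα.le_right) V).conjSubgroup y) (by
      intro x hx
      obtain ⟨u, hu, rfl⟩ := mem_conjSubgroup.1 hx
      have h1 : y * u * y⁻¹ * u⁻¹ ∈ fixer E₁ hVT Q := by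
        refine ⟨mul_mem (H.conj_mem_aut hVT hy (hstab hu).1) (inv_mem (hstab hu).1),
          fun x hx => ?_⟩
        have h2 := (conj_mem_fixer (hQ := le_supCent)
          (show u ∈ stab E hVT le_supCent from
            ⟨mem_aut_iff.2 ((iso_of_mem_aut (hstab hu).1).mono H.sub),
              (hstab hu).2.mono H.sub⟩) (inv_mem hyF)).2 x hx
        have h3 : y * u * y⁻¹ * u⁻¹ = y * (u * y⁻¹ * u⁻¹) := by group
        rw [h3, extFun_mul, h2, hyQ x hx]
      have h4 : y * u * y⁻¹ = (y * u * y⁻¹ * u⁻¹) * u := by group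
      rw [h4]
      exact Subgroup.mul_mem_sup h1 hu)
  have hn : z * y ∈ E.aut hVT :=
    mul_mem (mem_aut_iff.2 ((iso_of_mem_aut hz.1).mono H.sub)) hy
  obtain ⟨B, B', n, hnB, hnx, hVB, hB, hmemB⟩ := hQ.2.receptive.extend (iso_of_mem_aut hn)
  have hA'B : A' ≤ B := fun t ht => by
    refine hmemB t (hA'V ht).1 (fun x hx => conj_mem_of_mem_nz (hA'V ht) hx) ?_
    have h1 : V.normalizerMonoidHom ⟨t, (hA'V ht).2⟩ ∈ autS A' V := hmemA.2 ⟨t, ht, fun x => rfl⟩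
    obtain ⟨s, hs, hsx⟩ := hmemA.1 (hzc _ (mem_conjSubgroup.2 ⟨_, h1, rfl⟩))
    refine ⟨s, (hA'V hs).1, fun x hx => ?_⟩
    have h2 := hsx (z (y ⟨x, hx⟩))
    have h3 : V.normalizerMonoidHom ⟨t, (hA'V ht).2⟩ ⟨x, hx⟩ =
        ⟨_, conj_mem_of_mem_nz (hA'V ht) hx⟩ := rfl
    simp only [MulAut.mul_apply, MulAut.inv_apply_self, h3] at h2
    rw [extFun_of_mem _ hx, extFun_of_mem _ (conj_mem_of_mem_nz (hA'V ht) hx)]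
    exact h2
  obtain ⟨A'', -, hnα⟩ := hα.comp_restrict hnB hA'B
  have hnV : ∀ x ∈ supCent T R₀, extFun z (χ x) = n (α x) := fun x hx => by
    rw [hnx _ (hαV.mem hx), extFun_mul, hyα x hx]
  have hlift : E₁.Iso A A'' (n ∘ α) :=
    H.lift hR₀.1.isCentric_supCent hVA (hA.trans (nz_le_nz_supCent hR₀.1.le))
      ((hχ.comp (iso_of_mem_aut hz.1)).congr fun x hx => hnV x hx) (H.decomp hnα)
  obtain ⟨N', -, hN'⟩ := hρN.comp_restrict hlift hNA
  refine ⟨N', _, hN', fun x hx => ?_⟩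
  have hρx := hρ.mem hx
  simp only [Function.comp_apply]
  rw [← hnV _ (le_supCent hρx), hχk _ hρx]
  simp only [Function.comp_apply]
  rw [hρρ x (hRn hx), hz.2 _ (hf.mem hx)]

theorem isFN_of_isDFN (hQ : E.IsDFN p Q) : E₁.IsFN p Q := by
  induction hn : Nat.card T - Nat.card Q using Nat.strong_induction_on generalizing Q with
  | _ n ih =>
    subst hn
    refine ⟨hQ.1.le, H.isFullyAutomized hQ.1, H.isReceptive_of_isDFN (fun R hR hRD => ?_) hQ⟩
    have := Subgroup.card_le_of_le hRD.1.le
    exact ih _ (by omega) hRD rfl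

theorem isSaturated : E₁.IsSaturated p := fun P hP => by
  obtain ⟨Q, f, M, hQ, -, φ, hφ, -⟩ := H.exists_isDFN hP
  have := H.isFN_of_isDFN hQ
  exact ⟨Q, this.le, ⟨φ, hφ⟩, this.automized, this.receptive⟩

end PPrimePair

end FusionSystem

/-! ### The subsystem generated by good isomorphisms. -/

namespace FusionSystem

variable {G : Type*} [Group G] {S T : Subgroup G} {F : FusionSystem S} {E : FusionSystem T}
  {P Q R X W P' Q' R' N N' M : Subgroup G} {f g h k a b e : G → G} {p m : ℕ}

/-- The isomorphisms generated by restrictions of those isomorphisms of `E` between centric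
subgroups that are good with respect to `F`. -/
inductive Gen (E : FusionSystem T) (F : FusionSystem S) :
    Subgroup G → Subgroup G → (G → G) → Prop
  | base {P Q R R' : Subgroup G} {f : G → G} (hR : E.IsCentric R) (h : E.Iso R R' f)
      (hf : Good F T R R' f) (hP : P ≤ R) (hPQ : E.Iso P Q f) : Gen E F P Q f
  | comp {P Q R : Subgroup G} {f g : G → G} (hf : Gen E F P Q f) (hg : Gen E F Q R g) :
      Gen E F P R (g ∘ f)
  | congr {P Q : Subgroup G} {f g : G → G} (hf : Gen E F P Q f) (hfg : ∀ x ∈ P, f x = g x) :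
      Gen E F P Q g

namespace Gen

theorem iso (h : Gen E F P Q f) : E.Iso P Q f := by
  induction h with
  | base _ _ _ _ h => exact h
  | comp _ _ ihf ihg => exact ihf.comp ihg
  | congr _ hfg ih => exact ih.congr hfg

theorem restrict (h : Gen E F P Q f) (hP : P' ≤ P) (h' : E.Iso P' Q' f) : Gen E F P' Q' f := by
  induction h generalizing P' Q' with
  | base hR h hf hPR _ => exact base hR h hf (hP.trans hPR) h'
  | comp hf hg ihf ihg =>
    obtain ⟨M, hM, hfM⟩ := hf.iso.restrict hP
    obtain ⟨L, -, hgL⟩ := hg.iso.restrict hM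
    exact (hfM.comp hgL).target_unique h' ▸ (ihf hP hfM).comp (ihg hM hgL)
  | congr hf hfg ih =>
    exact (ih hP (h'.congr fun x hx => (hfg x (hP hx)).symm)).congr fun x hx => hfg x (hP hx)

theorem of_good (hP : E.IsCentric P) (h : E.Iso P Q f) (hf : Good F T P Q f) : Gen E F P Q f :=
  .base hP h hf le_rfl h

end Gen

namespace WNPair

variable [Finite S] [Fact p.Prime] (H : WNPair p E F)
include H

theorem gen_symm (h : Gen E F P Q f) : ∃ g, Gen E F Q P g ∧ ∀ x ∈ P, g (f x) = x := by
  induction h with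
  | base hR h hf hPR hPQ =>
    obtain ⟨g, hg, hgf, -⟩ := h.symm
    exact ⟨g, .base (hR.of_iso h) hg (H.good_symm hR hf hgf) (h.le_of_le hPQ hPR)
      (hPQ.symm_of fun x hx => hgf x (hPR hx)), fun x hx => hgf x (hPR hx)⟩
  | comp hf hg ihf ihg =>
    obtain ⟨f', hf', hff⟩ := ihf
    obtain ⟨g', hg', hgg⟩ := ihg
    exact ⟨_, hg'.comp hf', fun x hx => by
      simp only [Function.comp_apply]
      rw [hgg _ (hf.iso.mem hx), hff x hx]⟩
  | congr hf hfg ih =>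
    obtain ⟨g, hg, hgf⟩ := ih
    exact ⟨g, hg, fun x hx => by rw [← hfg x hx, hgf x hx]⟩

/-- On a centric source every intermediate subgroup is centric, so each generator restricts to a
good isomorphism and the composite is good. -/
theorem good_of_gen (h : Gen E F P Q f) (hP : E.IsCentric P) : Good F T P Q f := by
  induction h with
  | base hR h hf hPR hPQ => exact H.good_restrict hP hf hPR (hPQ.mono H.wn.1)
  | comp hf hg ihf ihg => exact H.good_comp hP (ihf hP) (ihg (hP.of_iso hf.iso))
  | congr hf hfg ih => exact (ih hP).congr hfg

theorem gen_conj (hP : P ≤ T) {t : G} (ht : t ∈ T) (h : E.Iso P Q fun x => t * x * t⁻¹) :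
    Gen E F P Q fun x => t * x * t⁻¹ := by
  have := H.finite
  have h1 : E.Iso T T fun x => t * x * t⁻¹ :=
    Iso.conj_self le_rfl ht (Subgroup.le_normalizer ht)
  exact .base (isCentric_self E) h1
    (H.good_conj (isCentric_self E) ht (h1.mono H.wn.1)) hP h

/-- The subsystem of `E` generated by the good isomorphisms between centric subgroups. -/
def goodSubsystem : FusionSystem T where
  Hom P Q := {φ | Q ≤ T ∧ ∃ Q' ≤ Q, ∃ f, Gen E F P Q' f ∧ ∀ x : P, (φ x : G) = f x}
  le_of_mem := fun ⟨hQ, _, _, _, h, _⟩ => ⟨h.iso.le_left, hQ⟩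
  injective_of_mem := fun ⟨_, _, _, _, h, hφ⟩ x y hxy =>
    Subtype.ext (h.iso.inj x.2 y.2 (by rw [← hφ, ← hφ, hxy]))
  conj_mem := fun {P Q} hP hQ φ ⟨t, ht, h⟩ => by
    obtain ⟨R, hR, hi⟩ := Iso.of_hom (f := fun x => t * x * t⁻¹)
      (E.conj_mem hP hQ φ ⟨t, ht, h⟩) h
    exact ⟨hQ, R, hR, _, H.gen_conj hP ht hi, h⟩
  comp_mem := fun ⟨_, Q', hQ', f, h, hφ⟩ ⟨hR, R', hR', g, h', hψ⟩ => by
    obtain ⟨L, hL, hi⟩ := h'.iso.restrict hQ'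
    refine ⟨hR, L, hL.trans hR', _, h.comp (h'.restrict hQ' hi), fun x => ?_⟩
    rw [Function.comp_apply, ← hφ, ← hψ]
    rfl
  factor := fun {P Q φ} ⟨hQ, Q', hQ', f, h, hφ⟩ => by
    obtain ⟨e, he, hef⟩ := id h.iso
    obtain ⟨g, hg, hgf⟩ := H.gen_symm h
    refine ⟨Q', hQ', e, ⟨hQ'.trans hQ, Q', le_rfl, f, h, hef⟩,
      ⟨h.iso.le_left, P, le_rfl, g, hg, fun y => ?_⟩, ?_⟩
    · obtain ⟨x, rfl⟩ := e.surjective y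
      have : (e.symm (e x) : G) = g (e x) := by rw [e.symm_apply_apply, hef, hgf x x.2]
      exact this
    · ext x
      rw [hφ, ← hef]
      rfl

theorem iso_goodSubsystem : H.goodSubsystem.Iso P Q f ↔ Gen E F P Q f := by
  constructor
  · rintro ⟨φ, ⟨-, Q', hQ', f', h, hφ⟩, hf⟩
    have h1 : Q' = Q := by
      refine le_antisymm hQ' fun y hy => ?_
      obtain ⟨x, hx⟩ := φ.surjective ⟨y, hy⟩
      have h2 : (φ x : G) = f' x := hφ x
      rw [hx] at h2
      exact (show y = f' x from h2) ▸ h.iso.mem x.2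
    subst h1
    exact h.congr fun x hx => (hφ ⟨x, hx⟩).symm.trans (hf ⟨x, hx⟩)
  · intro h
    obtain ⟨e, he, hef⟩ := id h.iso
    exact ⟨e, ⟨h.iso.le_right, Q, le_rfl, f, h, hef⟩, hef⟩

theorem gen_aut (ha : E.Iso T T a) (hb : ∀ x ∈ T, b (a x) = x) (hf : Gen E F P Q f)
    (hP : E.Iso P P' a) (hQ : E.Iso Q Q' a) : Gen E F P' Q' (a ∘ f ∘ b) := by
  have hinv : ∀ {A A' : Subgroup G}, E.Iso A A' a → E.Iso A' A b := fun hA =>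
    hA.symm_of fun x hx => hb x (hA.le_left hx)
  induction hf generalizing P' Q' with
  | base hR h hf hPR hPQ =>
    obtain ⟨R₁, -, h1⟩ := ha.restrict h.le_left
    obtain ⟨R₂, -, h2⟩ := ha.restrict h.le_right
    exact .base (hR.of_iso h1) (((hinv h1).comp h).comp h2)
      (H.good_aut (ha.mono H.wn.1) hb hR hf (h1.mono H.wn.1) (h2.mono H.wn.1))
      (h1.le_of_le hP hPR) (((hinv hP).comp hPQ).comp hQ)
  | comp hf hg ihf ihg =>
    obtain ⟨L, -, hL⟩ := ha.restrict hf.iso.le_right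
    refine ((ihf hP hL).comp (ihg hL hQ)).congr fun y hy => ?_
    simp only [Function.comp_apply]
    rw [hb _ (hf.iso.le_right (hf.iso.mem ((hinv hP).mem hy)))]
  | congr hf hfg ih =>
    refine (ih hP hQ).congr fun y hy => ?_
    simp only [Function.comp_apply]
    rw [hfg _ ((hinv hP).mem hy)]

theorem goodSubsystem_isSubsystem : H.goodSubsystem.IsSubsystem E :=
  ⟨le_rfl, fun _ _ _ ⟨hQ, _, hQ', _, h, hφ⟩ => h.iso.hom_mem hQ' hQ hφ⟩

theorem pPrimePair : PPrimePair p E H.goodSubsystem where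
  pgroup := H.pgroupT
  sat := H.satE
  sub := H.goodSubsystem_isSubsystem
  conj ha hb hf hP hQ :=
    H.iso_goodSubsystem.2 (H.gen_aut ha hb (H.iso_goodSubsystem.1 hf) hP hQ)
  pow hP _ _ hα hn := mem_aut_iff.2 (H.iso_goodSubsystem.2
    (Gen.of_good hP (mem_aut_iff.1 hα) (H.good_of_pow_eq_one hP hα hn)))
  lift := fun hP hPN hN hPa ⟨α, R, e, hα, he, hR, hae⟩ => by
    have hNc := hP.mono hPN (hN.trans nz_le)
    have he := H.iso_goodSubsystem.1 he
    exact H.iso_goodSubsystem.2 (Gen.of_good hNc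
      ((he.iso.comp hR).congr fun x hx => (hae x hx).symm)
      (H.good_lift hP hPN hN (H.good_of_gen (H.iso_goodSubsystem.1 hPa) hP) hα
        (H.good_of_gen he hNc) (hR.mono H.wn.1) hae))
  generated C h1 h2 h3 P Q f h := by
    replace h := H.iso_goodSubsystem.1 h
    induction h with
    | base hR h hf hPR hPQ =>
      exact h1 _ _ _ _ _ hR (H.iso_goodSubsystem.2 (Gen.of_good hR h hf)) hPR
        (H.iso_goodSubsystem.2 (.base hR h hf hPR hPQ))
    | comp hf hg ihf ihg =>
      have hf' := H.iso_goodSubsystem.2 hf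
      have hg' := H.iso_goodSubsystem.2 hg
      exact h2 _ _ _ _ _ hf' hg' ihf ihg
    | congr hf hfg ih => exact h3 _ _ _ _ ih hfg

/-- The subsystem of good isomorphisms is one of those intersected in `O^{p'}(E)`, so it contains
`Aut_E(T)`; and `T` is centric. -/
theorem good_of_eq_pPrimeSubsystem (hE : E = E.pPrimeSubsystem p) (h : E.Iso T T a) :
    Good F T T T a := by
  have := H.finite
  have H' := H.pPrimePair
  obtain ⟨φ, hφ, hφa⟩ := h
  rw [hE] at hφ
  have h1 : H.goodSubsystem.Iso T T a := ⟨φ, hφ.2 _ H'.isSaturated H'.hasIndexPrimeTo, hφa⟩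
  exact H.good_of_gen (H.iso_goodSubsystem.1 h1) (isCentric_self E)

end WNPair

/-- The isomorphisms from `T C_S(T)` to itself that induce the identity on `T C_S(T) / T` give
the extension condition. -/
theorem extensionCondition_of
    (h : ∀ a, E.Iso T T a → ∃ f, F.Iso (T ⊔ cent S T) (T ⊔ cent S T) f ∧ (∀ x ∈ T, f x = a x) ∧
      ∀ c ∈ cent S T, c⁻¹ * f c ∈ T) : E.ExtensionCondition F := by
  intro α hα
  have ha := iso_of_mem_aut (F := E) (hP := le_rfl) hα
  obtain ⟨f, hf, hfa, hfc⟩ := h _ ha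
  obtain ⟨β, hβ, hβf⟩ := id hf
  refine ⟨β, hβ, ⟨le_sup_left, fun x => ?_⟩, fun x hx => ?_⟩
  · have h1 : (β (Subgroup.inclusion le_sup_left x) : G) = f x := hβf _
    have h2 : (α x : G) = f x := by rw [hfa x x.2, extFun_coe]
    exact h1.trans h2.symm
  · have hx : (x : G) ∈ cent S T := hx
    have h1 := hfc x hx
    have hβx : (β x : G) = f x := hβf x
    rw [← hβx] at h1
    -- `x` and its image both centralize `T`, so their quotient in `T` is central.
    refine ⟨⟨_, h1⟩, Subgroup.mem_center_iff.2 fun y => Subtype.ext ?_, rfl⟩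
    obtain ⟨z, hz, hzy⟩ := ha.surj y.2
    have h3 := hf.map_conj x.2 (Subgroup.mem_sup_left hz)
    rw [conj_of_mem_cent hx hz, hfa z hz, hzy, ← hβx] at h3
    have h4 := conj_of_mem_cent (inv_mem hx) y.2
    have h5 : (x : G)⁻¹ * β x * y * ((x : G)⁻¹ * β x)⁻¹ = y := by
      calc (x : G)⁻¹ * β x * y * ((x : G)⁻¹ * β x)⁻¹
          = (x : G)⁻¹ * (β x * y * (β x : G)⁻¹) * (x : G)⁻¹⁻¹ := by group
        _ = y := by rw [← h3, h4]
    exact (mul_inv_eq_iff_eq_mul.1 h5).symm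

end FusionSystem

/-! ### Subsystems of `p`-power index, and the conclusion. -/

theorem mem_pPowerResidual_of_pow_eq_one {Γ : Type*} [Group Γ] [Finite Γ] {p m : ℕ} {x : Γ}
    (hm : m.Coprime p) (hx : x ^ m = 1) : x ∈ pPowerResidual p Γ := by
  refine Subgroup.mem_sInf.2 fun N ⟨hN, k, hk⟩ => ?_
  rw [← QuotientGroup.eq_one_iff, ← orderOf_eq_one_iff]
  refine Nat.eq_one_of_dvd_coprimes (hm.pow_right k) (orderOf_dvd_of_pow_eq_one ?_) ?_
  · rw [← QuotientGroup.mk_pow, hx, QuotientGroup.mk_one]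
  · rw [← hk]
    exact orderOf_dvd_natCard _

namespace FusionSystem

variable {G : Type*} [Group G] {S S₀ T : Subgroup G} {F : FusionSystem S} {F₀ : FusionSystem S₀}
  {E : FusionSystem T} {p : ℕ}

theorem IsWeaklyNormal.of_isSubsystem (hE : E.IsSubsystem F₀) (hF : F₀.IsSubsystem F)
    (h : E.IsWeaklyNormal F) : E.IsWeaklyNormal F₀ :=
  ⟨hE, ⟨hE.1, fun _ _ φ hφ x hx => h.2.1.2 φ (hF.2 _ _ hφ) x hx⟩, fun _ _ hPQ hQ φ hφ ψ hψ =>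
    h.2.2 hPQ hQ φ hφ ψ (hF.2 _ _ hψ)⟩

theorem WNPair.extensionCondition_of_eq_pPrimeSubsystem [Finite S] [Fact p.Prime]
    (H : WNPair p E F) (hE : E = E.pPrimeSubsystem p) : E.ExtensionCondition F :=
  extensionCondition_of fun _ ha => (H.good_of_eq_pPrimeSubsystem hE ha).2

/-- The `p'`-part of the given extension lies in `F₀` by the hypothesis on `O^p`, and the `p`-part
of `α` is inner. -/
theorem ExtensionCondition.of_hasPPowerIndex [Finite S] [Fact p.Prime] (hE : E.IsSaturated p)
    (hTS₀ : T ≤ S₀) (hF : F₀.HasPPowerIndex F p) (h : E.ExtensionCondition F) :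
    E.ExtensionCondition F₀ := by
  have hS₀ := hF.1.1
  have hfT := finite_of_le (hTS₀.trans hS₀)
  refine extensionCondition_of fun a ha => ?_
  obtain ⟨α, hα, hαa⟩ := ha.exists_mulAut le_rfl
  obtain ⟨β, hβ, ⟨hTX, hβα⟩, hβc⟩ := h α hα
  have hTS := hTS₀.trans hS₀
  have hβF : F.Iso (T ⊔ cent S T) (T ⊔ cent S T) (extFun β) :=
    iso_of_mem_aut (hP := sup_le hTS cent_le) hβ
  have hβT : ∀ x ∈ T, extFun β x = a x := fun x hx => by
    rw [extFun_of_mem β (Subgroup.mem_sup_left hx), ← hαa ⟨x, hx⟩]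
    exact hβα ⟨x, hx⟩
  have hle : cent S₀ T ≤ cent S T := inf_le_inf_right _ hS₀
  have hβC : ∀ c ∈ cent S₀ T, c⁻¹ * extFun β c ∈ T := fun c hc => by
    have hcS := Subgroup.mem_sup_right (S := T) (hle hc)
    rw [extFun_of_mem β hcS]
    exact Subgroup.map_subtype_le _ (hβc ⟨c, hcS⟩ (hle hc))
  set X := T ⊔ cent S₀ T with hX
  have hXS₀ : X ≤ S₀ := sup_le hTS₀ cent_le
  have hXS := hXS₀.trans hS₀
  obtain ⟨X', -, hβX⟩ := hβF.restrict (sup_le_sup_left hle T)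
  have hX' : X' = X := by
    refine hβX.eq_of_le (fun y hy => ?_) hXS le_rfl
    obtain ⟨z, hz, rfl⟩ := hβX.surj hy
    obtain ⟨x, hx, c, hc, rfl⟩ := (mem_sup_cent le_rfl).1 hz
    rw [hβX.map_mul (Subgroup.mem_sup_left hx) (Subgroup.mem_sup_right hc), hβT x hx]
    have h1 : extFun β c = c * (c⁻¹ * extFun β c) := by group
    rw [h1]
    exact mul_mem (Subgroup.mem_sup_left (ha.mem hx)) (mul_mem (Subgroup.mem_sup_right hc)
      (Subgroup.mem_sup_left (hβC c hc)))
  rw [hX'] at hβX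
  obtain ⟨δ, hδ, hδβ⟩ := hβX.exists_mulAut hXS
  have hδT : ∀ (n : ℕ) (x : X) (hx : (x : G) ∈ T), ((δ ^ n) x : G) = (α ^ n) ⟨x, hx⟩ := by
    intro n
    induction n with
    | zero => intro x hx; rfl
    | succ n ih =>
      intro x hx
      have h1 : (δ x : G) = α ⟨x, hx⟩ := by rw [hδβ, hβT _ hx, hαa]
      have h2 : (δ x : G) ∈ T := h1 ▸ (α _).2
      rw [pow_succ, pow_succ, MulAut.mul_apply, MulAut.mul_apply, ih _ h2]
      congr 2
      exact Subtype.ext h1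
  have hδC : ∀ (n : ℕ) (c : X), (c : G) ∈ cent S₀ T → (c : G)⁻¹ * (δ ^ n) c ∈ T := by
    intro n
    induction n with
    | zero => intro c hc; simp
    | succ n ih =>
      intro c hc
      have h1 : (c⁻¹ * δ c : X) = (c : G)⁻¹ * δ c := rfl
      have h2 : ((c⁻¹ * δ c : X) : G) ∈ T := by rw [h1, hδβ]; exact hβC c hc
      have h3 : (δ ^ (n + 1)) c = (δ ^ n) c * (δ ^ n) (c⁻¹ * δ c) := by
        rw [← map_mul, mul_inv_cancel_left, pow_succ, MulAut.mul_apply]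
      rw [h3, Subgroup.coe_mul, ← mul_assoc, hδT n _ h2]
      exact mul_mem (ih c hc) ((α ^ n) _).2
  have hfin := finite_mulAut hXS
  obtain ⟨k, m, hm, hkm⟩ := Nat.exists_eq_pow_mul_and_not_dvd (orderOf_pos δ).ne' p
    (Fact.out : p.Prime).ne_one
  have hmp : m.Coprime p := ((Nat.Prime.coprime_iff_not_dvd Fact.out).2 hm).symm
  -- With `|δ| = pᵏ m`, the choice `n ≡ 0 (mod pᵏ)`, `n ≡ 1 (mod m)` makes `δⁿ` of order dividing
  -- `m`, and `α^{1-n}` of order dividing `pᵏ`.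
  obtain ⟨n, hn0, hn1⟩ := Nat.chineseRemainder ((hmp.pow_right k).symm) 0 1
  have hαpow : α ^ (p ^ k * m) = 1 := by
    refine MulEquiv.ext fun x => Subtype.ext ?_
    rw [← hδT _ ⟨x, Subgroup.mem_sup_left x.2⟩ x.2, ← hkm, pow_orderOf_eq_one]
    rfl
  have hδn : δ ^ n ∈ F₀.aut hXS₀ := by
    refine hF.2.2 X hXS₀ hXS ⟨⟨δ, hδ⟩ ^ n, mem_pPowerResidual_of_pow_eq_one hmp ?_, rfl⟩
    obtain ⟨l, rfl⟩ := (Nat.modEq_zero_iff_dvd).1 hn0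
    refine Subtype.ext ?_
    change (δ ^ (p ^ k * l)) ^ m = 1
    rw [← pow_mul, mul_right_comm, pow_mul, ← hkm, pow_orderOf_eq_one, one_pow]
  obtain ⟨t, ht⟩ := hE.exists_conj_of_pow_eq_one (α := α * (α ^ n)⁻¹) (n := k)
    (mul_mem hα (inv_mem (pow_mem hα n))) (by
      have h1 : α * (α ^ n)⁻¹ = α ^ (1 - n : ℤ) := by rw [zpow_sub, zpow_one, zpow_natCast]
      obtain ⟨l, hl⟩ := (Nat.modEq_iff_dvd.1 hn1)
      have h2 : (1 - n : ℤ) * (p ^ k : ℕ) = ((p ^ k * m : ℕ) : ℤ) * l := by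
        push_cast at hl ⊢
        rw [hl]; ring
      rw [h1, ← zpow_natCast, ← zpow_mul, h2, zpow_mul, zpow_natCast, hαpow, one_zpow])
  have htX := Subgroup.mem_sup_left (T := cent S₀ T) t.2
  refine ⟨_, (iso_of_mem_aut hδn).comp (Iso.conj_self hXS₀ (hTS₀ t.2)
    (Subgroup.le_normalizer htX)), fun x hx => ?_, fun c hc => ?_⟩
  · have hxX := Subgroup.mem_sup_left (T := cent S₀ T) hx
    simp only [Function.comp_apply]
    rw [extFun_of_mem _ hxX, hδT n ⟨x, hxX⟩ hx, ← hαa ⟨x, hx⟩]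
    have h1 : α = MulAut.conj t * α ^ n := by rw [← ht]; group
    conv_rhs => rw [h1]
    rfl
  · have hcX := Subgroup.mem_sup_right (S := T) hc
    have h1 := hδC n ⟨c, hcX⟩ hc
    simp only [Function.comp_apply]
    rw [extFun_of_mem _ hcX]
    have h2 : c⁻¹ * (t * ((δ ^ n) ⟨c, hcX⟩ : G) * (t : G)⁻¹) =
        (c⁻¹ * t * c⁻¹⁻¹) * (c⁻¹ * (δ ^ n) ⟨c, hcX⟩) * (t : G)⁻¹ := by group
    rw [h2, conj_of_mem_cent (inv_mem hc) t.2]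
    exact mul_mem (mul_mem t.2 h1) (inv_mem t.2)

end FusionSystem

theorem proposition1 {G : Type*} [Group G] (p : ℕ) [Fact p.Prime]
    (T S₀ S : Subgroup G) [Finite S] (hS : IsPGroup p S)
    (E : FusionSystem T) (F₀ : FusionSystem S₀) (F : FusionSystem S)
    (hE : E.IsSaturated p) (hF₀ : F₀.IsSaturated p) (hF : F.IsSaturated p)
    (hEF₀ : E.IsSubsystem F₀) (hF₀F : F₀.IsSubsystem F) :
    (E.IsWeaklyNormal F → E.IsWeaklyNormal F₀) ∧
    (E.IsNormal F → E = E.pPrimeSubsystem p → E.IsNormal F₀) ∧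
    (E.IsNormal F → F₀.HasPPowerIndex F p → E.IsNormal F₀) := by
  have hfin := FusionSystem.finite_of_le hF₀F.1
  refine ⟨fun h => h.of_isSubsystem hEF₀ hF₀F, fun h hEp => ?_, fun h hp =>
    ⟨h.1.of_isSubsystem hEF₀ hF₀F, h.2.of_hasPPowerIndex hE hEF₀.1 hp⟩⟩
  have hW := h.1.of_isSubsystem hEF₀ hF₀F
  have H : FusionSystem.WNPair p E F₀ := ⟨hW, hS.to_le hF₀F.1, hE, hF₀⟩
  exact ⟨hW, H.extensionCondition_of_eq_pPrimeSubsystem hEp⟩
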